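/- Notation. Let $v$ be the valuation of $\bar{\mathbb Q}_2$ with $v(2)=1$ and $v(0)=\infty$, $\bar{\mathbb Z}_2$ its valuation ring, and $\bar{\mathbb F}_2$ the residue field. Let $G=\mathrm{GL}_2(\mathbb Q_2)$ and $K=\mathrm{GL}_2(\mathbb Z_2)$. For a $\mathbb Z_2$-algebra $R$ let $\mathrm{Sym}^rR^2$ be the space of homogeneous polynomials of degree $r$ in $X,Y$ over $R$, with $\begin{pmatrix}a&b\\c&d\end{pmatrix}\in K$ acting by $f(X,Y)\mapsto f(aX+cY,bX+dY)$ and the scalar matrix $2$ acting trivially. Let $V_r=\mathrm{Sym}^r\bar{\mathbb F}_2^2$. Let $\mathcal I$ denote compact induction from $K\mathbb Q_2^\times$ to $G$. For $g\in G$ let $[g,w]\in\mathcal I(\mathrm{Sym}^rR^2)$ be the function that sends $x$ to $(xg)\cdot w$ if $x\in K\mathbb Q_2^\times g^{-1}$ and to $0$ otherwise. The Hecke operator $T$ on $\mathcal I(\mathrm{Sym}^rR^2)$ is the $G$-linear operator with $$T[g,w]=\sum_{\mu\in\{0,1\}}\left[g\begin{pmatrix}2&\mu\\0&1\end{pmatrix},\,w(X,2Y-\mu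 X)\right]+\left[g\begin{pmatrix}1&0\\0&2\end{pmatrix},\,w(2X,Y)\right].$$ For $a_2\in\bar{\mathbb Q}_2$ and $k=r+2$ put $$\Theta_{k,a_2}=\frac{\mathcal I(\mathrm{Sym}^r\bar{\mathbb Z}_2^2)}{(T-a_2)\,\mathcal I(\mathrm{Sym}^r\bar{\mathbb Q}_2^2)\cap\mathcal I(\mathrm{Sym}^r\bar{\mathbb Z}_2^2)},\qquad \bar\Theta=\Theta_{k,a_2}\otimes_{\bar{\mathbb Z}_2}\bar{\mathbb F}_2,$$ and let $P:\mathcal I(V_r)\to\bar\Theta$ be the natural surjection. Let $\theta=X^2Y-XY^2$, and let $V_r^{(n)}=\theta^nV_{r-3n}$ if $3n\le r$ and $V_r^{(n)}=0$ otherwise. For $r\ge 6$ the rule $X\mapsto\overline{\theta X^{r-3}}$, $Y\mapsto\overline{\theta Y^{r-3}}$ defines a $K$-equivariant injection $V_1\to V_r^{(1)}/V_r^{(2)}$. If $v(a_2)=1$, then $P$ kills $\mathcal I(V_r^{(2)})$, so $P$ and this injection induce a natural map $\mathcal I(V_1)\to\bar\Theta$; let $\mathcal F'_2$ be its image. **Proposition.**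 Let $r\ge 6$ be even and let $a_2\in\bar{\mathbb Q}_2$ with $v(a_2)=1$. Put $$\alpha=\frac{a_2^2-2^2\binom r2}{2a_2},\qquad \tau=v(\alpha),\qquad t=v(r-2).$$ 1. If $\tau\le t-1$, then $\frac{a_2}{2}+\frac{r-2}{2\alpha}$ lies in $\bar{\mathbb Z}_2$, and with $c_0\in\bar{\mathbb F}_2$ its reduction, the natural map $\mathcal I(V_1)\to\mathcal F'_2$ factors through $\mathcal I(V_1)/(T^2-c_0T+1)$. Thus $\mathcal F'_2$ is a quotient of the $G$-representation $\mathcal I(V_1)/(T^2-c_0T+1)$. 2. If $\tau>t-1$, then the natural map $\mathcal I(V_1)\to\mathcal F'_2$ factors through $\mathcal I(V_1)/(T)$. Thus $\mathcal F'_2$ is a quotient of the $G$-representation $\mathcal I(V_1)/(T)$. -/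

import Mathlib

noncomputable section

namespace ModTwo

open scoped NNReal TensorProduct

/-! ## Groups and polynomials -/

/-- The group `GL₂(ℚ₂)`. -/
abbrev G : Type := GL (Fin 2) ℚ_[2]
/-- The group `GL₂(ℤ₂)`. -/
abbrev K : Type := GL (Fin 2) ℤ_[2]

/-- The inclusion `GL₂(ℤ₂) → GL₂(ℚ₂)`. -/
def ofK : K →* G := Matrix.GeneralLinearGroup.map (algebraMap ℤ_[2] ℚ_[2])

/-- The scalar matrix `2`. Since `ℚ₂ˣ = 2^ℤ × ℤ₂ˣ`, the group `K ℚ₂ˣ` consists of the `ϖ ^ n * k`, with `n : ℤ`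
and `k` in `K`, in a unique way. -/
def ϖ : G := Matrix.GeneralLinearGroup.mkOfDetNeZero !![2, 0; 0, 2] (by simp)

lemma ϖ_comm (g : G) : ϖ * g = g * ϖ := by
  ext i j
  fin_cases i <;> fin_cases j <;>
    simp [ϖ, Matrix.GeneralLinearGroup.mkOfDetNeZero, Matrix.mul_apply, mul_comm]

/-- Polynomials over `R` in two variables `X = X 0` and `Y = X 1`. -/
abbrev Poly (R : Type) [CommRing R] : Type := MvPolynomial (Fin 2) R

section
variable (R : Type) [CommRing R] [Algebra ℤ_[2] R]

/-- The action of an integral matrix `(a b; c d)`: `f(X, Y) ↦ f(aX + cY, bX + dY)`. -/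
def polyAct (M : Matrix (Fin 2) (Fin 2) ℤ_[2]) : Poly R →ₐ[R] Poly R :=
  MvPolynomial.aeval fun j => ∑ i, MvPolynomial.C (algebraMap ℤ_[2] R (M i j)) * MvPolynomial.X i

lemma polyAct_mul (M N : Matrix (Fin 2) (Fin 2) ℤ_[2]) (P : Poly R) :
    polyAct R (M * N) P = polyAct R M (polyAct R N P) := by
  have : polyAct R (M * N) = (polyAct R M).comp (polyAct R N) := by
    apply MvPolynomial.algHom_ext
    intro j
    simp [polyAct, Matrix.mul_apply, Fin.sum_univ_two, MvPolynomial.algHom_C]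
    ring
  rw [this]; rfl

lemma polyAct_one (P : Poly R) : polyAct R 1 P = P := by
  have : polyAct R 1 = AlgHom.id R (Poly R) := by
    apply MvPolynomial.algHom_ext
    intro j
    fin_cases j <;> simp [polyAct, Fin.sum_univ_two]
  rw [this]; rfl

lemma polyAct_mem (r : ℕ) (M : Matrix (Fin 2) (Fin 2) ℤ_[2]) (P : Poly R)
    (hP : P.IsHomogeneous r) : (polyAct R M P).IsHomogeneous r := by
  have := hP.aeval (fun j => ∑ i, MvPolynomial.C (algebraMap ℤ_[2] R (M i j)) * MvPolynomial.X i)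
    (n := 1) (fun j => by
      apply MvPolynomial.IsHomogeneous.sum
      intro i _
      exact MvPolynomial.isHomogeneous_C_mul_X _ _)
  simpa [polyAct] using this
end

/-- Representatives `(1 0; 0 2)`, `(1 1; 0 2)`, `(2 0; 0 1)` of `K \ K diag(1, 2) K`. -/
def cosetMat : Fin 3 → Matrix (Fin 2) (Fin 2) ℤ_[2] :=
  ![!![1, 0; 0, 2], !![1, 1; 0, 2], !![2, 0; 0, 1]]

lemma det_cosetMat (j : Fin 3) : (cosetMat j).det = 2 := by
  fin_cases j <;> simp [cosetMat, Matrix.det_fin_two]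

lemma zmod_perm : ∀ a b c d : ZMod 2, a * d - b * c ≠ 0 → ∃ s : Fin 3 → Fin 3, Function.Injective s ∧
    ∀ j, (![fun _ y => y, fun x y => x + y, fun x _ => x] (s j) : ZMod 2 → ZMod 2 → ZMod 2)
      (![a, a + c, c] j) (![b, b + d, d] j) = 0 := by
  decide +revert

lemma dvd_iff (x : ℤ_[2]) : 2 ∣ x ↔ PadicInt.toZMod x = 0 := by
  rw [← RingHom.mem_ker, PadicInt.ker_toZMod, PadicInt.maximalIdeal_eq_span_p,
    Ideal.mem_span_singleton]
  norm_num

lemma factor (M : Matrix (Fin 2) (Fin 2) ℤ_[2]) (i : Fin 3)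
    (h : ∀ l, 2 ∣ (![fun _ y => y, fun x y => x + y, fun x _ => x] i : ℤ_[2] → ℤ_[2] → ℤ_[2])
      (M l 0) (M l 1)) : ∃ N, M = N * cosetMat i := by
  obtain ⟨u, hu⟩ := h 0
  obtain ⟨v, hv⟩ := h 1
  fin_cases i
  · refine ⟨!![M 0 0, u; M 1 0, v], ?_⟩
    ext l m
    fin_cases l <;> fin_cases m <;> simp_all [cosetMat, Matrix.mul_apply, Fin.sum_univ_two, mul_comm]
  · refine ⟨!![M 0 0, u - M 0 0; M 1 0, v - M 1 0], ?_⟩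
    ext l m
    fin_cases l <;> fin_cases m <;> simp_all [cosetMat, Matrix.mul_apply, Fin.sum_univ_two]
    · linear_combination hu
    · linear_combination hv
  · refine ⟨!![u, M 0 1; v, M 1 1], ?_⟩
    ext l m
    fin_cases l <;> fin_cases m <;> simp_all [cosetMat, Matrix.mul_apply, Fin.sum_univ_two, mul_comm]

lemma coset_perm (k : K) : ∃ (s : Equiv.Perm (Fin 3)) (k' : Fin 3 → K),
    ∀ j, cosetMat j * k.val = (k' j).val * cosetMat (s j) := by
  have hd : IsUnit k.val.det :=
    (Matrix.isUnit_iff_isUnit_det _).1 k.isUnit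
  set M : Matrix (Fin 2) (Fin 2) ℤ_[2] := k.val with hM
  have h2 : PadicInt.toZMod M.det ≠ 0 := (hd.map PadicInt.toZMod).ne_zero
  rw [Matrix.det_fin_two] at h2
  obtain ⟨s, hs, h⟩ := zmod_perm (PadicInt.toZMod (M 0 0)) (PadicInt.toZMod (M 0 1))
    (PadicInt.toZMod (M 1 0)) (PadicInt.toZMod (M 1 1)) (by simpa using h2)
  have key : ∀ j, ∃ N, cosetMat j * M = N * cosetMat (s j) := by
    intro j
    apply factor
    have h20 : PadicInt.toZMod (2 : ℤ_[2]) = 0 := by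
      rw [← dvd_iff]
    have h2' : (2 : ZMod 2) = 0 := rfl
    intro l
    rw [dvd_iff]
    have := h j
    generalize s j = i at this ⊢
    fin_cases j <;> fin_cases i <;> fin_cases l <;>
      simp_all [cosetMat, Matrix.mul_apply, Fin.sum_univ_two]
  choose N hN using key
  have hdet : ∀ j, (N j).det = M.det := by
    intro j
    have := congrArg Matrix.det (hN j)
    rw [Matrix.det_mul, Matrix.det_mul, det_cosetMat, det_cosetMat] at this
    have h2 : (2 : ℤ_[2]) ≠ 0 := two_ne_zero
    apply mul_left_cancel₀ h2
    rw [this, mul_comm]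
  refine ⟨Equiv.ofBijective s (Finite.injective_iff_bijective.1 hs),
    fun j => Matrix.GeneralLinearGroup.mk'' (N j) (by rw [hdet]; exact hd), fun j => ?_⟩
  exact hN j

/-- The same representatives in `GL₂(ℚ₂)`. -/
def cosetG (j : Fin 3) : G :=
  Matrix.GeneralLinearGroup.mkOfDetNeZero ((cosetMat j).map (algebraMap ℤ_[2] ℚ_[2])) (by
    have := det_cosetMat j
    rw [← RingHom.mapMatrix_apply, ← RingHom.map_det, this]; simp)

lemma cosetG_mul (k : K) : ∃ (s : Equiv.Perm (Fin 3)) (k' : Fin 3 → K),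
    (∀ j, cosetG j * ofK k = ofK (k' j) * cosetG (s j)) ∧
    ∀ j, (cosetMat j).adjugate * (k' j).val = k.val * (cosetMat (s j)).adjugate := by
  obtain ⟨s, k', h⟩ := coset_perm k
  refine ⟨s, k', fun j => ?_, fun j => ?_⟩
  · apply Units.ext
    have := congrArg (RingHom.mapMatrix (algebraMap ℤ_[2] ℚ_[2])) (h j)
    rw [map_mul, map_mul] at this
    exact this
  · have hj := h j
    set A := cosetMat j with hA
    set B := cosetMat (s j) with hB
    have hAd : A.det = 2 := det_cosetMat j
    have hBd : B.det = 2 := det_cosetMat (s j)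
    have e1 : A.adjugate * A = (2 : ℤ_[2]) • 1 := by rw [Matrix.adjugate_mul, hAd]
    have e2 : B * B.adjugate = (2 : ℤ_[2]) • 1 := by rw [Matrix.mul_adjugate, hBd]
    have : (2 : ℤ_[2]) • (A.adjugate * (k' j).val) = (2 : ℤ_[2]) • (k.val * B.adjugate) := by
      calc (2 : ℤ_[2]) • (A.adjugate * (k' j).val)
          = A.adjugate * ((k' j).val * B) * B.adjugate := by
            rw [Matrix.mul_assoc, Matrix.mul_assoc, e2]; simp
        _ = _ := by rw [← hj, ← Matrix.mul_assoc, e1]; simp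
    exact smul_right_injective _ (two_ne_zero (α := ℤ_[2])) this

section
variable {R : Type} [CommRing R] [Algebra ℤ_[2] R]

/-- The compact induction `I(V)` from `K ℚ₂ˣ` to `G` of a `K`-stable space `V` of polynomials, the scalar `2` acting
trivially on `V`: the functions `f : G → V` with `f(κ x) = κ · f(x)` for `κ` in `K ℚ₂ˣ` (that is, for `κ` in `K`
and for `κ = 2`) which are supported on finitely many cosets `K ℚ₂ˣ s`. -/
def compactInd (V : Submodule R (Poly R)) : Submodule R (G → Poly R) where
  carrier := {f | (∀ x, f x ∈ V) ∧ (∀ (k : K) x, f (ofK k * x) = polyAct R k.val (f x)) ∧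
    (∀ x, f (ϖ * x) = f x) ∧
    ∃ S : Finset G, ∀ x, f x ≠ 0 → ∃ s ∈ S, ∃ (n : ℤ) (k : K), x = ϖ ^ n * ofK k * s}
  zero_mem' := ⟨fun _ => V.zero_mem, by simp, by simp, ∅, by simp⟩
  add_mem' := by
    classical
    rintro f g ⟨f1, f2, f3, S, f4⟩ ⟨g1, g2, g3, S', g4⟩
    refine ⟨fun x => V.add_mem (f1 x) (g1 x), fun k x => by simp [f2, g2],
      fun x => by simp [f3, g3], S ∪ S', fun x hx => ?_⟩
    by_cases h : f x = 0
    · obtain ⟨s, hs, h'⟩ := g4 x (by intro h0; apply hx; simp [h, h0])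
      exact ⟨s, Finset.mem_union_right _ hs, h'⟩
    · obtain ⟨s, hs, h'⟩ := f4 x h
      exact ⟨s, Finset.mem_union_left _ hs, h'⟩
  smul_mem' := by
    rintro c f ⟨f1, f2, f3, S, f4⟩
    refine ⟨fun x => V.smul_mem c (f1 x), fun k x => by simp [f2], fun x => by simp [f3], S,
      fun x hx => f4 x ?_⟩
    intro h0; apply hx; simp [h0]

variable (R) in
/-- Right translation of functions on `G`: `(g · f)(x) = f(x g)`. -/
def translation : Representation R G (G → Poly R) where
  toFun g :=
    { toFun := fun f x => f (x * g)
      map_add' := fun _ _ => rfl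
      map_smul' := fun _ _ => rfl }
  map_one' := by ext f x; simp
  map_mul' g h := by ext f x; simp [mul_assoc]

/-- The action of `G` on `I(V)` by right translation. -/
def indRep (V : Submodule R (Poly R)) : Representation R G (compactInd V) :=
  (translation R).subrepresentation (compactInd V) (by
    rintro g f ⟨f1, f2, f3, S, f4⟩
    classical
    refine ⟨fun x => f1 _, fun k x => ?_, fun x => ?_, S.image (· * g⁻¹), fun x hx => ?_⟩
    · simp only [translation, MonoidHom.coe_mk, OneHom.coe_mk, LinearMap.coe_mk, AddHom.coe_mk]
      rw [mul_assoc, f2]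
    · simp only [translation, MonoidHom.coe_mk, OneHom.coe_mk, LinearMap.coe_mk, AddHom.coe_mk]
      rw [mul_assoc, f3]
    · obtain ⟨s, hs, n, k, h⟩ := f4 _ hx
      refine ⟨s * g⁻¹, Finset.mem_image_of_mem _ hs, n, k, ?_⟩
      rw [← mul_assoc, ← h]; simp)

variable (R) in
/-- `Sym^r R²`: homogeneous polynomials of degree `r`. For `R = F2bar` this is `V_r`. -/
abbrev sym (r : ℕ) : Submodule R (Poly R) := MvPolynomial.homogeneousSubmodule (Fin 2) R r

variable (R) in
/-- The Hecke operator as an operator on functions on `G`. Theorem `heckeFun_elem` below shows that on the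
elementary functions `[g, v]`, which span `I(Sym^r R²)`, it is given by
`T[g, v] = ∑_{μ = 0, 1} [g (2 μ; 0 1), v(X, 2Y - μX)] + [g (1 0; 0 2), v(2X, Y)]`. -/
def heckeFun : (G → Poly R) →ₗ[R] (G → Poly R) where
  toFun f x := ∑ j, polyAct R (cosetMat j).adjugate (f (cosetG j * x))
  map_add' f g := by ext1 x; simp [Finset.sum_add_distrib]
  map_smul' c f := by ext1 x; simp [Finset.smul_sum]

lemma heckeFun_apply (f : G → Poly R) (x : G) :
    heckeFun R f x = ∑ j, polyAct R (cosetMat j).adjugate (f (cosetG j * x)) := rfl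

lemma ϖ_zpow_comm (n : ℤ) (g : G) : ϖ ^ n * g = g * ϖ ^ n :=
  ((show Commute ϖ g from ϖ_comm g).zpow_left n).eq

lemma heckeFun_ofK (f : G → Poly R) (hf : ∀ (k : K) x, f (ofK k * x) = polyAct R k.val (f x))
    (k : K) (x : G) : heckeFun R f (ofK k * x) = polyAct R k.val (heckeFun R f x) := by
  obtain ⟨s, k', h1, h2⟩ := cosetG_mul k
  simp only [heckeFun, LinearMap.coe_mk, AddHom.coe_mk, map_sum]
  rw [← Equiv.sum_comp s (fun j => polyAct R k.val
    (polyAct R (cosetMat j).adjugate (f (cosetG j * x))))]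
  refine Finset.sum_congr rfl fun j _ => ?_
  rw [← mul_assoc, h1, mul_assoc, hf, ← polyAct_mul, h2, polyAct_mul]

lemma heckeFun_ϖ (f : G → Poly R) (hf : ∀ x, f (ϖ * x) = f x)
    (x : G) : heckeFun R f (ϖ * x) = heckeFun R f x := by
  simp only [heckeFun, LinearMap.coe_mk, AddHom.coe_mk]
  refine Finset.sum_congr rfl fun j _ => ?_
  rw [← mul_assoc, ← ϖ_comm, mul_assoc, hf]

lemma cosetG_inv_mul (j : Fin 3) (k : K) : ∃ (i : Fin 3) (k' : K),
    (cosetG j)⁻¹ * ofK k = ϖ ^ (-1 : ℤ) * ofK k' * cosetG i := by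
  -- the adjugate of each representative is an integral unit times a representative
  have key : ∃ (i : Fin 3) (u : K), ϖ * (cosetG j)⁻¹ = ofK u * cosetG i := by
    have aux : ∀ (i : Fin 3) (u : K), ϖ = ofK u * cosetG i * cosetG j →
        ϖ * (cosetG j)⁻¹ = ofK u * cosetG i := by
      intro i u h; rw [h]; simp
    fin_cases j
    · refine ⟨2, 1, aux _ _ ?_⟩
      ext a b
      fin_cases a <;> fin_cases b <;>
        simp [ϖ, cosetG, cosetMat, Matrix.GeneralLinearGroup.mkOfDetNeZero, Matrix.mul_apply] <;>
        exact (PadicInt.coe_natCast 2).symm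
    · refine ⟨2, Matrix.GeneralLinearGroup.mk'' !![1, -1; 0, 1] (by simp), aux _ _ ?_⟩
      ext a b
      fin_cases a <;> fin_cases b <;>
        simp [ϖ, ofK, cosetG, cosetMat, Matrix.GeneralLinearGroup.mkOfDetNeZero, Matrix.mul_apply,
          Matrix.GeneralLinearGroup.mk'', Matrix.nonsingInvUnit] <;>
        exact (PadicInt.coe_natCast 2).symm
    · refine ⟨0, 1, aux _ _ ?_⟩
      ext a b
      fin_cases a <;> fin_cases b <;>
        simp [ϖ, cosetG, cosetMat, Matrix.GeneralLinearGroup.mkOfDetNeZero, Matrix.mul_apply] <;>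
        exact (PadicInt.coe_natCast 2).symm
  obtain ⟨i, u, h⟩ := key
  obtain ⟨s, k', h1, -⟩ := cosetG_mul k
  refine ⟨s i, u * k' i, ?_⟩
  have : (cosetG j)⁻¹ = ϖ⁻¹ * (ofK u * cosetG i) := by rw [← h]; simp
  rw [this, map_mul, zpow_neg_one]
  simp only [mul_assoc]
  rw [h1]

variable (R) in
/-- The Hecke operator `T` on `I(Sym^r R²)`. -/
def hecke (r : ℕ) : Module.End R (compactInd (sym R r)) :=
  (heckeFun R).restrict (by
    rintro f ⟨f1, f2, f3, S, f4⟩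
    classical
    refine ⟨fun x => ?_, heckeFun_ofK f f2, heckeFun_ϖ f f3,
      (Finset.univ ×ˢ S).image (fun p : Fin 3 × G => cosetG p.1 * p.2), fun x hx => ?_⟩
    · rw [heckeFun_apply]
      exact Submodule.sum_mem _ fun j _ => polyAct_mem R r _ _ (f1 _)
    · rw [heckeFun_apply] at hx
      obtain ⟨j, -, hj⟩ := Finset.exists_ne_zero_of_sum_ne_zero hx
      have hj' : f (cosetG j * x) ≠ 0 := by intro h; apply hj; rw [h, map_zero]
      obtain ⟨s, hs, n, k, h⟩ := f4 _ hj'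
      obtain ⟨i, k', hk⟩ := cosetG_inv_mul j k
      refine ⟨cosetG i * s, Finset.mem_image.2 ⟨(i, s), by simp [hs], rfl⟩, n - 1, k', ?_⟩
      have hx' : x = (cosetG j)⁻¹ * (ϖ ^ n * ofK k * s) := by rw [← h]; simp
      calc x = ϖ ^ n * ((cosetG j)⁻¹ * ofK k) * s := by
              rw [hx', ← mul_assoc, ← mul_assoc, ← ϖ_zpow_comm]; simp only [mul_assoc]
        _ = _ := by rw [hk, sub_eq_add_neg, zpow_add]; simp only [mul_assoc])

lemma hecke_comm (r : ℕ) (g : G) (f : compactInd (sym R r)) :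
    hecke R r (indRep (sym R r) g f) = indRep (sym R r) g (hecke R r f) := by
  ext1
  funext x
  change heckeFun R (translation R g f.1) x = heckeFun R f.1 (x * g)
  simp only [heckeFun_apply, translation, MonoidHom.coe_mk, OneHom.coe_mk, LinearMap.coe_mk,
    AddHom.coe_mk, mul_assoc]

/-! ### Elementary functions and the formula for the Hecke operator -/

lemma ϖ_val (n : ℤ) : (ϖ ^ n).val = (2 : ℚ_[2]) ^ n • (1 : Matrix (Fin 2) (Fin 2) ℚ_[2]) := by
  have h : ∀ u : ℚ_[2]ˣ, (Units.map (algebraMap ℚ_[2] (Matrix (Fin 2) (Fin 2) ℚ_[2])).toMonoidHom u).val =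
      u.val • 1 := by intro u; simp [Algebra.algebraMap_eq_smul_one]
  have h2 : ϖ = Units.map (algebraMap ℚ_[2] (Matrix (Fin 2) (Fin 2) ℚ_[2])).toMonoidHom
      (Units.mk0 2 two_ne_zero) := by
    ext i j
    fin_cases i <;> fin_cases j <;> simp [ϖ, Matrix.GeneralLinearGroup.mkOfDetNeZero, Matrix.algebraMap_matrix_apply]
  rw [h2, ← map_zpow, h]; simp

lemma norm_det_ofK (k : K) : ‖(ofK k).val.det‖ = 1 := by
  have : (ofK k).val.det = algebraMap ℤ_[2] ℚ_[2] k.val.det := by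
    rw [RingHom.map_det]; rfl
  rw [this]
  have hd : IsUnit k.val.det := (Matrix.isUnit_iff_isUnit_det _).1 k.isUnit
  exact PadicInt.isUnit_iff.1 hd

lemma norm_det (n : ℤ) (k : K) : ‖(ϖ ^ n * ofK k).val.det‖ = ((1 / 4 : ℝ)) ^ n := by
  have : (ϖ ^ n * ofK k).val = (2 : ℚ_[2]) ^ n • (ofK k).val := by
    rw [Units.val_mul, ϖ_val]; simp
  have h2 : ‖(2 : ℚ_[2])‖ = 1 / 2 := by
    have := Padic.norm_p (p := 2); simpa using this
  rw [this, Matrix.det_smul, norm_mul, norm_det_ofK]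
  simp [h2]
  rw [← zpow_natCast, ← zpow_mul, mul_comm, zpow_mul]
  norm_num


lemma ofK_injective : Function.Injective ofK := by
  intro k k' h
  apply Units.ext
  ext i j
  have : (ofK k).val i j = (ofK k').val i j := by rw [h]
  exact Subtype.ext this

lemma decomp_unique {n m : ℤ} {k k' : K} (h : ϖ ^ n * ofK k = ϖ ^ m * ofK k') : k = k' := by
  have h1 := norm_det n k
  rw [h, norm_det] at h1
  have : m = n := zpow_right_injective₀ (by norm_num) (by norm_num) h1
  subst this
  exact ofK_injective (mul_left_cancel h)

open Classical in
/-- The elementary function `[g, v]`: it sends `x` to `(x g) · v` if `x g` is in `K ℚ₂ˣ` (that is, if `x` is in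
`K ℚ₂ˣ g⁻¹`), and to `0` otherwise. -/
def elemFn (g : G) (v : Poly R) : G → Poly R := fun x =>
  if h : ∃ (k : K) (n : ℤ), x * g = ϖ ^ n * ofK k then polyAct R h.choose.val v else 0

lemma elem_of {g x : G} {k : K} {n : ℤ} (h : x * g = ϖ ^ n * ofK k) (v : Poly R) :
    elemFn g v x = polyAct R k.val v := by
  have h' : ∃ (k : K) (n : ℤ), x * g = ϖ ^ n * ofK k := ⟨k, n, h⟩
  rw [elemFn, dif_pos h']
  obtain ⟨m, hm⟩ := h'.choose_spec
  rw [decomp_unique (hm.symm.trans h)]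

lemma elem_of_not {g x : G} (h : ¬ ∃ (k : K) (n : ℤ), x * g = ϖ ^ n * ofK k) (v : Poly R) :
    elemFn g v x = 0 := by
  rw [elemFn, dif_neg h]

lemma elem_add (g : G) (v w : Poly R) : elemFn g (v + w) = elemFn g v + elemFn g w := by
  funext x
  by_cases h : ∃ (k : K) (n : ℤ), x * g = ϖ ^ n * ofK k
  · obtain ⟨k, n, h⟩ := h; simp [elem_of h]
  · simp [elem_of_not h]

lemma elem_smul (g : G) (c : R) (v : Poly R) : elemFn g (c • v) = c • elemFn g v := by
  funext x
  by_cases h : ∃ (k : K) (n : ℤ), x * g = ϖ ^ n * ofK k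
  · obtain ⟨k, n, h⟩ := h; simp [elem_of h]
  · simp [elem_of_not h]

lemma elem_ofK_mul (g : G) (v : Poly R) (k : K) (x : G) :
    elemFn g v (ofK k * x) = polyAct R k.val (elemFn g v x) := by
  by_cases h : ∃ (k : K) (n : ℤ), x * g = ϖ ^ n * ofK k
  · obtain ⟨l, n, h⟩ := h
    have : ofK k * x * g = ϖ ^ n * ofK (k * l) := by
      rw [mul_assoc, h, ← mul_assoc, ← ϖ_zpow_comm, map_mul, mul_assoc]
    rw [elem_of this, elem_of h, ← polyAct_mul]; rfl
  · rw [elem_of_not h, elem_of_not, map_zero]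
    rintro ⟨l, n, h'⟩
    refine h ⟨k⁻¹ * l, n, ?_⟩
    rw [map_mul, ← mul_assoc, ϖ_zpow_comm, mul_assoc, ← h', map_inv]; group

lemma elem_ϖ_mul (g : G) (v : Poly R) (x : G) : elemFn g v (ϖ * x) = elemFn g v x := by
  by_cases h : ∃ (k : K) (n : ℤ), x * g = ϖ ^ n * ofK k
  · obtain ⟨l, n, h⟩ := h
    have : ϖ * x * g = ϖ ^ (1 + n) * ofK l := by
      rw [mul_assoc, h, zpow_one_add, mul_assoc]
    rw [elem_of this, elem_of h]
  · rw [elem_of_not h, elem_of_not]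
    rintro ⟨l, n, h'⟩
    refine h ⟨l, n - 1, ?_⟩
    rw [sub_eq_add_neg, add_comm, zpow_add, mul_assoc, ← h']; group

/-- Stability of a space of polynomials under the group `GL₂(ℤ₂)`. -/
def KStable (V : Submodule R (Poly R)) : Prop := ∀ (k : K), ∀ v ∈ V, polyAct R k.val v ∈ V

lemma elem_mem {V : Submodule R (Poly R)} (hV : KStable V) (g : G) {v : Poly R} (hv : v ∈ V) :
    elemFn g v ∈ compactInd V := by
  refine ⟨fun x => ?_, elem_ofK_mul g v, elem_ϖ_mul g v, {g⁻¹}, fun x hx => ?_⟩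
  · by_cases h : ∃ (k : K) (n : ℤ), x * g = ϖ ^ n * ofK k
    · obtain ⟨l, n, h⟩ := h; rw [elem_of h]; exact hV l v hv
    · rw [elem_of_not h]; exact V.zero_mem
  · by_contra hne
    apply hx
    apply elem_of_not
    rintro ⟨k, n, h⟩
    exact hne ⟨g⁻¹, by simp, n, k, by rw [← h]; simp⟩

lemma compactInd_induction {V : Submodule R (Poly R)} (hV : KStable V) (p : (G → Poly R) → Prop)
    (h0 : p 0) (hadd : ∀ f g, f ∈ compactInd V → g ∈ compactInd V → p f → p g → p (f + g))
    (helem : ∀ g, ∀ v ∈ V, p (elemFn g v)) (f : G → Poly R) (hf : f ∈ compactInd V) : p f := by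
  classical
  obtain ⟨S, hS⟩ := hf.2.2.2
  induction S using Finset.induction_on generalizing f with
  | empty =>
    have : f = 0 := by
      funext x
      by_contra hx
      obtain ⟨s, hs, -⟩ := hS x hx
      simp at hs
    rw [this]; exact h0
  | insert s S _ ih =>
    have he := elem_mem hV s⁻¹ (hf.1 s)
    have hfd := (compactInd V).sub_mem hf he
    have : f = (f - elemFn s⁻¹ (f s)) + elemFn s⁻¹ (f s) := by simp
    rw [this]
    refine hadd _ _ hfd he (ih _ hfd fun x hx => ?_) (helem _ _ (hf.1 s))
    by_cases h : ∃ (k : K) (n : ℤ), x * s⁻¹ = ϖ ^ n * ofK k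
    · obtain ⟨k, n, h⟩ := h
      exfalso
      apply hx
      have hx' : x = ϖ ^ n * (ofK k * s) := by rw [← mul_assoc, ← h]; simp
      have hz : ∀ (n : ℤ) y, f (ϖ ^ n * y) = f y := by
        intro n
        induction n with
        | zero => simp
        | succ n ih => intro y; rw [zpow_add_one, mul_assoc, ih, hf.2.2.1]
        | pred n ih =>
          intro y
          rw [zpow_sub_one, mul_assoc, ih, ← hf.2.2.1 (ϖ⁻¹ * y)]; simp
      simp only [Pi.sub_apply]
      rw [elem_of h, hx', hz, hf.2.1, sub_self]
    · have hx' : f x ≠ 0 := by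
        intro h0; apply hx; simp [h0, elem_of_not h]
      obtain ⟨t, ht, n, k, hk⟩ := hS x hx'
      rcases Finset.mem_insert.1 ht with rfl | ht
      · exact absurd ⟨k, n, by rw [hk]; simp⟩ h
      · exact ⟨t, ht, n, k, hk⟩

variable (R) in
lemma sym_stable (r : ℕ) : KStable (sym R r) := fun _ v hv => polyAct_mem R r _ v hv

end

section
variable {R : Type} [CommRing R] [Algebra ℤ_[2] R]

lemma elem_mul_ofK (g : G) (k : K) (v : Poly R) :
    elemFn (g * ofK k) v = elemFn g (polyAct R k.val v) := by
  funext x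
  by_cases h : ∃ (l : K) (n : ℤ), x * g = ϖ ^ n * ofK l
  · obtain ⟨l, n, h⟩ := h
    have : x * (g * ofK k) = ϖ ^ n * ofK (l * k) := by
      rw [← mul_assoc, h, mul_assoc, map_mul]
    rw [elem_of this, elem_of h, ← polyAct_mul]; rfl
  · rw [elem_of_not h, elem_of_not]
    rintro ⟨l, n, h'⟩
    refine h ⟨l * k⁻¹, n, ?_⟩
    rw [map_mul, ← mul_assoc, ← h', map_inv]; group

lemma elem_apply_mul (g h : G) (v : Poly R) (x : G) : elemFn g v (x * h) = elemFn (h * g) v x := by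
  have e : x * h * g = x * (h * g) := mul_assoc x h g
  unfold elemFn
  rw [e]

lemma elem_mul_ϖ (g : G) (v : Poly R) : elemFn (ϖ * g) v = elemFn g v := by
  funext x
  rw [← elem_apply_mul, ← ϖ_comm, elem_ϖ_mul]

lemma ϖ_zpow_invariant {A : Type} {f : G → A} (hf : ∀ x, f (ϖ * x) = f x) (n : ℤ) (y : G) :
    f (ϖ ^ n * y) = f y := by
  induction n generalizing y with
  | zero => simp
  | succ n ih => rw [zpow_add_one, mul_assoc, ih, hf]
  | pred n ih => rw [zpow_sub_one, mul_assoc, ih, ← hf (ϖ⁻¹ * y)]; simp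

/-- the right-hand side of the defining formula in terms of the standard representatives -/
def heckeSum (v : Poly R) : G → Poly R :=
  ∑ i, elemFn (ϖ * (cosetG i)⁻¹) (polyAct R (cosetMat i) v)

lemma heckeSum_apply (v : Poly R) (x : G) :
    heckeSum v x = ∑ i, elemFn (ϖ * (cosetG i)⁻¹) (polyAct R (cosetMat i) v) x := by
  simp [heckeSum]

lemma coset_zero (i : Fin 3) : ∃ k₁ k₂ : K, cosetG i = ofK k₁ * cosetG 0 * ofK k₂ := by
  fin_cases i
  · exact ⟨1, 1, by simp⟩
  · refine ⟨1, Matrix.GeneralLinearGroup.mk'' !![1, 1; 0, 1] (by simp), ?_⟩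
    ext a b
    fin_cases a <;> fin_cases b <;>
      simp [ofK, cosetG, cosetMat, Matrix.GeneralLinearGroup.mkOfDetNeZero, Matrix.mul_apply,
          Matrix.GeneralLinearGroup.mk'', Matrix.nonsingInvUnit]
  · refine ⟨Matrix.GeneralLinearGroup.mk'' !![0, 1; 1, 0] (by simp),
      Matrix.GeneralLinearGroup.mk'' !![0, 1; 1, 0] (by simp), ?_⟩
    ext a b
    fin_cases a <;> fin_cases b <;>
      simp [ofK, cosetG, cosetMat, Matrix.GeneralLinearGroup.mkOfDetNeZero, Matrix.mul_apply,
          Matrix.GeneralLinearGroup.mk'', Matrix.nonsingInvUnit]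

lemma norm_two : ‖(2 : ℚ_[2])‖ = 1 / 2 := by
  have := Padic.norm_p (p := 2); simpa using this

lemma det_cosetG (i : Fin 3) : (cosetG i).val.det = 2 := by
  have : (cosetG i).val.det = algebraMap ℤ_[2] ℚ_[2] (cosetMat i).det := by
    rw [RingHom.map_det]; rfl
  rw [this, det_cosetMat]; exact PadicInt.coe_natCast 2

lemma exponent_eq {z : G} {n : ℤ} {k : K} (h : z = ϖ ^ n * ofK k) (m : ℤ)
    (hz : ‖z.val.det‖ = (1 / 4 : ℝ) ^ m) : z = ϖ ^ m * ofK k := by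
  rw [h, norm_det] at hz
  have : n = m := zpow_right_injective₀ (by norm_num) (by norm_num) hz
  rw [← this, h]

lemma not_two_mul (x : ℤ_[2]) (h : (1 : ℚ_[2]) = 2 * x) : False := by
  have h1 := congrArg norm h
  rw [norm_mul, norm_two, norm_one] at h1
  have := PadicInt.norm_le_one x
  rw [PadicInt.norm_def] at this
  linarith

lemma heckeFun_elem_one (v : Poly R) : heckeFun R (elemFn 1 v) = heckeSum v := by
  -- covariance of both sides
  have lK : ∀ (v : Poly R) (k : K) x,
      heckeFun R (elemFn 1 v) (ofK k * x) = polyAct R k.val (heckeFun R (elemFn 1 v) x) :=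
    fun v k x => heckeFun_ofK _ (elem_ofK_mul 1 v) k x
  have lϖ : ∀ (v : Poly R) x, heckeFun R (elemFn 1 v) (ϖ * x) = heckeFun R (elemFn 1 v) x :=
    fun v x => heckeFun_ϖ _ (elem_ϖ_mul 1 v) x
  have rK : ∀ (v : Poly R) (k : K) x,
      heckeSum v (ofK k * x) = polyAct R k.val (heckeSum v x) := by
    intro v k x
    simp only [heckeSum_apply, map_sum, elem_ofK_mul]
  have rϖ : ∀ (v : Poly R) x, heckeSum v (ϖ * x) = heckeSum v x := by
    intro v x
    simp only [heckeSum_apply, elem_ϖ_mul]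
  have lR : ∀ (v : Poly R) (k : K) x,
      heckeFun R (elemFn 1 v) (x * ofK k) = heckeFun R (elemFn 1 (polyAct R k.val v)) x := by
    intro v k x
    have := elem_mul_ofK 1 k v
    simp only [heckeFun_apply, ← this]
    refine Finset.sum_congr rfl fun j _ => ?_
    rw [← mul_assoc, elem_apply_mul]; simp
  have rR : ∀ (v : Poly R) (k : K) x,
      heckeSum v (x * ofK k) = heckeSum (polyAct R k.val v) x := by
    intro v k x
    obtain ⟨s, k', h⟩ := coset_perm k⁻¹
    have hG : ∀ j, ofK k * (ϖ * (cosetG j)⁻¹) = ϖ * (cosetG (s j))⁻¹ * ofK (k' j)⁻¹ := by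
      intro j
      have h1 : cosetG j * ofK k⁻¹ = ofK (k' j) * cosetG (s j) := by
        apply Units.ext
        have := congrArg (RingHom.mapMatrix (algebraMap ℤ_[2] ℚ_[2])) (h j)
        rw [map_mul, map_mul] at this
        exact this
      have h2 := congrArg (fun z => z⁻¹) h1
      simp only [mul_inv_rev, ← map_inv, inv_inv] at h2
      rw [← mul_assoc, ← ϖ_comm, mul_assoc, h2, mul_assoc]
    have hM : ∀ j, ((k' j)⁻¹).val * cosetMat j = cosetMat (s j) * k.val := by
      intro j
      have e1 : ((k' j)⁻¹).val * (k' j).val = 1 := by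
        rw [← Units.val_mul]; simp
      have e2 : (k⁻¹).val * k.val = 1 := by
        rw [← Units.val_mul]; simp
      calc ((k' j)⁻¹).val * cosetMat j = ((k' j)⁻¹).val * (cosetMat j * (k⁻¹).val) * k.val := by
            simp only [Matrix.mul_assoc, e2, Matrix.mul_one]
        _ = _ := by
          rw [h j, ← Matrix.mul_assoc, e1, Matrix.one_mul]
    simp only [heckeSum_apply]
    rw [← Equiv.sum_comp s (fun i => elemFn (ϖ * (cosetG i)⁻¹)
      (polyAct R (cosetMat i) (polyAct R k.val v)) x)]
    refine Finset.sum_congr rfl fun j _ => ?_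
    rw [elem_apply_mul, hG, elem_mul_ofK, ← polyAct_mul, ← polyAct_mul, hM]
  -- the two sides agree at the representative of the double coset
  have base : ∀ v : Poly R, heckeFun R (elemFn 1 v) (cosetG 0) = heckeSum v (cosetG 0) := by
    intro v
    rw [heckeFun_apply, heckeSum_apply, Fin.sum_univ_three, Fin.sum_univ_three]
    have n4 : ∀ i j, ‖(cosetG i * cosetG j * 1).val.det‖ = (1 / 4 : ℝ) ^ (1 : ℤ) := by
      intro i j
      rw [mul_one, Units.val_mul, Matrix.det_mul, det_cosetG, det_cosetG, norm_mul, norm_two]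
      norm_num
    have n1 : ∀ j, ‖(cosetG 0 * (ϖ * (cosetG j)⁻¹)).val.det‖ = (1 / 4 : ℝ) ^ (1 : ℤ) := by
      intro j
      have e : (cosetG 0 * (ϖ * (cosetG j)⁻¹)) * cosetG j = cosetG 0 * ϖ := by group
      have e' := congrArg (fun z : G => ‖z.val.det‖) e
      have hϖ : ‖ϖ.val.det‖ = 1 / 4 := by
        have := norm_det 1 1; simpa using this
      simp only [Units.val_mul, Matrix.det_mul, det_cosetG, norm_mul, norm_two, hϖ] at e' ⊢
      rw [zpow_one]; linarith
    have v0 : elemFn 1 v (cosetG 0 * cosetG 0) = 0 := by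
      apply elem_of_not
      rintro ⟨k, n, h⟩
      have h1 := exponent_eq h 1 (n4 0 0)
      have h2 := congrArg (fun z : G => z.val 0 0) h1
      simp [ϖ, ofK, cosetG, cosetMat, Matrix.GeneralLinearGroup.mkOfDetNeZero,
        Matrix.mul_apply] at h2
      exact not_two_mul _ h2
    have v1 : elemFn 1 v (cosetG 1 * cosetG 0) = 0 := by
      apply elem_of_not
      rintro ⟨k, n, h⟩
      have h1 := exponent_eq h 1 (n4 1 0)
      have h2 := congrArg (fun z : G => z.val 0 0) h1
      simp [ϖ, ofK, cosetG, cosetMat, Matrix.GeneralLinearGroup.mkOfDetNeZero,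
        Matrix.mul_apply] at h2
      exact not_two_mul _ h2
    have e20 : cosetG 2 * cosetG 0 = ϖ := by
      ext a b
      fin_cases a <;> fin_cases b <;>
        simp [ϖ, cosetG, cosetMat, Matrix.GeneralLinearGroup.mkOfDetNeZero, Matrix.mul_apply] <;>
        exact PadicInt.coe_natCast 2
    have v2 : elemFn 1 v (cosetG 2 * cosetG 0) = v := by
      have : cosetG 2 * cosetG 0 * 1 = ϖ ^ (1 : ℤ) * ofK 1 := by rw [e20]; simp
      rw [elem_of this]; exact polyAct_one R v
    have cancel : ∀ j (k : K), cosetG 0 * (ϖ * (cosetG j)⁻¹) = ϖ ^ (1 : ℤ) * ofK k →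
        cosetG 0 = ofK k * cosetG j := by
      intro j k h
      have : ϖ * cosetG 0 = ϖ * (ofK k * cosetG j) := by
        rw [ϖ_comm]
        calc cosetG 0 * ϖ = (cosetG 0 * (ϖ * (cosetG j)⁻¹)) * cosetG j := by group
          _ = _ := by rw [h, zpow_one, mul_assoc]
      exact mul_left_cancel this
    have w0 : elemFn (ϖ * (cosetG 0)⁻¹) (polyAct R (cosetMat 0) v) (cosetG 0) =
        polyAct R (cosetMat 0) v := by
      have : cosetG 0 * (ϖ * (cosetG 0)⁻¹) = ϖ ^ (1 : ℤ) * ofK 1 := by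
        rw [← mul_assoc, ← ϖ_comm]; simp
      rw [elem_of this]; exact polyAct_one R _
    have w1 : elemFn (ϖ * (cosetG 1)⁻¹) (polyAct R (cosetMat 1) v) (cosetG 0) = 0 := by
      apply elem_of_not
      rintro ⟨k, n, h⟩
      have h1 := cancel 1 k (exponent_eq h 1 (n1 1))
      have h2 := congrArg (fun z : G => z.val 0 0) h1
      have h3 := congrArg (fun z : G => z.val 0 1) h1
      simp [ofK, cosetG, cosetMat, Matrix.GeneralLinearGroup.mkOfDetNeZero,
        Matrix.mul_apply] at h2 h3
      rw [← h2] at h3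
      refine not_two_mul (-(k.val 0 1)) ?_
      push_cast
      have h20 : ((2 : ℤ_[2]) : ℚ_[2]) = 2 := PadicInt.coe_natCast 2
      rw [h20] at h3
      linear_combination -h3
    have w2 : elemFn (ϖ * (cosetG 2)⁻¹) (polyAct R (cosetMat 2) v) (cosetG 0) = 0 := by
      apply elem_of_not
      rintro ⟨k, n, h⟩
      have h1 := cancel 2 k (exponent_eq h 1 (n1 2))
      have h2 := congrArg (fun z : G => z.val 0 0) h1
      simp [ofK, cosetG, cosetMat, Matrix.GeneralLinearGroup.mkOfDetNeZero,
        Matrix.mul_apply] at h2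
      refine not_two_mul (k.val 0 0) ?_
      have h20 : ((2 : ℤ_[2]) : ℚ_[2]) = 2 := PadicInt.coe_natCast 2
      rw [h20] at h2
      linear_combination h2
    rw [v0, v1, v2, w0, w1, w2]
    simp [cosetMat, Matrix.adjugate_fin_two]
  have onDouble : ∀ (v : Poly R) (m : ℤ) (k : K) (i : Fin 3),
      heckeFun R (elemFn 1 v) (ϖ ^ m * ofK k * cosetG i) = heckeSum v (ϖ ^ m * ofK k * cosetG i) := by
    intro v m k i
    obtain ⟨k₁, k₂, hi⟩ := coset_zero i
    rw [mul_assoc, ϖ_zpow_invariant (lϖ v), ϖ_zpow_invariant (rϖ v), lK, rK, hi, lR, rR, lK, rK,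
      base]
  funext y
  by_cases hy : ∃ (m : ℤ) (k : K) (i : Fin 3), y = ϖ ^ m * ofK k * cosetG i
  · obtain ⟨m, k, i, rfl⟩ := hy
    exact onDouble v m k i
  · have hl : heckeFun R (elemFn 1 v) y = 0 := by
      rw [heckeFun_apply]
      refine Finset.sum_eq_zero fun j _ => ?_
      rw [elem_of_not, map_zero]
      rintro ⟨k, n, h⟩
      obtain ⟨i, k', hk⟩ := cosetG_inv_mul j k
      refine hy ⟨n - 1, k', i, ?_⟩
      have hx' : y = (cosetG j)⁻¹ * (ϖ ^ n * ofK k) := by rw [← h]; simp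
      calc y = ϖ ^ n * ((cosetG j)⁻¹ * ofK k) := by
              rw [hx', ← mul_assoc, ← ϖ_zpow_comm, mul_assoc]
        _ = _ := by rw [hk, sub_eq_add_neg, zpow_add]; simp only [mul_assoc]
    have hr : heckeSum v y = 0 := by
      rw [heckeSum_apply]
      refine Finset.sum_eq_zero fun j _ => ?_
      apply elem_of_not
      rintro ⟨k, n, h⟩
      refine hy ⟨n - 1, k, j, ?_⟩
      have : ϖ * y = ϖ ^ n * ofK k * cosetG j := by
        rw [← h, ϖ_comm]; group
      rw [sub_eq_add_neg, add_comm, zpow_add, mul_assoc, mul_assoc, ← mul_assoc (ϖ ^ n), ← this]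
      simp
    rw [hl, hr]

/-- An upper triangular or diagonal matrix with nonzero determinant, as an element of `G`. -/
def matG (a b c d : ℚ_[2]) (h : a * d - b * c ≠ 0) : G :=
  Matrix.GeneralLinearGroup.mkOfDetNeZero !![a, b; c, d] (by rwa [Matrix.det_fin_two_of])


lemma coe_two : ((2 : ℤ_[2]) : ℚ_[2]) = 2 := PadicInt.coe_natCast 2

lemma mat_zero : matG 2 0 0 1 (by norm_num) = ϖ * (cosetG 0)⁻¹ := by
  rw [eq_mul_inv_iff_mul_eq]
  ext a b
  fin_cases a <;> fin_cases b <;>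
    simp [matG, ϖ, cosetG, cosetMat, Matrix.GeneralLinearGroup.mkOfDetNeZero, Matrix.mul_apply,
      coe_two]

lemma mat_one : matG 2 1 0 1 (by norm_num) = ϖ * (cosetG 1)⁻¹ *
    ofK (Matrix.GeneralLinearGroup.mk'' !![1, 1; 0, 1] (by simp)) := by
  have : cosetG 1 = ofK (Matrix.GeneralLinearGroup.mk'' !![1, 1; 0, 1] (by simp)) *
      (matG 2 1 0 1 (by norm_num))⁻¹ * ϖ := by
    rw [mul_assoc, ← ϖ_comm, ← mul_assoc, eq_mul_inv_iff_mul_eq]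
    ext a b
    fin_cases a <;> fin_cases b <;>
    simp [matG, ϖ, ofK, cosetG, cosetMat, Matrix.GeneralLinearGroup.mkOfDetNeZero,
        Matrix.mul_apply, Matrix.GeneralLinearGroup.mk'', Matrix.nonsingInvUnit, coe_two]
    norm_num
  rw [this]; group

lemma mat_two : matG 1 0 0 2 (by norm_num) = ϖ * (cosetG 2)⁻¹ := by
  rw [eq_mul_inv_iff_mul_eq]
  ext a b
  fin_cases a <;> fin_cases b <;>
    simp [matG, ϖ, cosetG, cosetMat, Matrix.GeneralLinearGroup.mkOfDetNeZero, Matrix.mul_apply,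
      coe_two]

open MvPolynomial

lemma C_two : (C (algebraMap ℤ_[2] R 2) : Poly R) = 2 := by rw [map_ofNat, map_ofNat]

lemma subst_zero (v : Poly R) : aeval ![X 0, 2 * X 1] v = polyAct R (cosetMat 0) v := by
  rw [polyAct]
  congr 2
  funext j
  fin_cases j <;> simp [cosetMat, Fin.sum_univ_two, C_two]

lemma subst_one (v : Poly R) : polyAct R !![1, 1; 0, 1] (aeval ![X 0, 2 * X 1 - X 0] v) =
    polyAct R (cosetMat 1) v := by
  have : (aeval ![X 0, 2 * X 1 - X 0] v : Poly R) = polyAct R !![1, -1; 0, 2] v := by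
    rw [polyAct]
    congr 2
    funext j
    fin_cases j <;> simp [Fin.sum_univ_two, C_two]
    ring
  rw [this, ← polyAct_mul]
  congr 2
  ext a b
  fin_cases a <;> fin_cases b <;> simp [cosetMat, Matrix.mul_apply]
  norm_num

lemma subst_two (v : Poly R) : aeval ![2 * X 0, X 1] v = polyAct R (cosetMat 2) v := by
  rw [polyAct]
  congr 2
  funext j
  fin_cases j <;> simp [cosetMat, Fin.sum_univ_two, C_two]

/-- The formula for `T` on elementary functions. -/
theorem heckeFun_elem (g : G) (v : Poly R) :
    heckeFun R (elemFn g v) =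
      elemFn (g * matG 2 0 0 1 (by norm_num)) (aeval ![X 0, 2 * X 1] v) +
      elemFn (g * matG 2 1 0 1 (by norm_num)) (aeval ![X 0, 2 * X 1 - X 0] v) +
      elemFn (g * matG 1 0 0 2 (by norm_num)) (aeval ![2 * X 0, X 1] v) := by
  have step : ∀ x, heckeFun R (elemFn g v) x = heckeFun R (elemFn 1 v) (x * g) := by
    intro x
    simp only [heckeFun_apply]
    refine Finset.sum_congr rfl fun j _ => ?_
    rw [← mul_assoc, elem_apply_mul 1 g, mul_one]
  have e1 : elemFn (g * matG 2 1 0 1 (by norm_num)) (aeval ![X 0, 2 * X 1 - X 0] v) =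
      elemFn (g * (ϖ * (cosetG 1)⁻¹)) (polyAct R (cosetMat 1) v) := by
    rw [mat_one, ← mul_assoc g, elem_mul_ofK, ← subst_one]; rfl
  funext x
  rw [step, heckeFun_elem_one, heckeSum_apply, Fin.sum_univ_three, e1, mat_zero, mat_two,
    subst_zero, subst_two]
  simp only [Pi.add_apply, elem_apply_mul]
end

/-! ## Coefficients -/

section
variable (R S : Type) [CommRing R] [CommRing S] [Algebra ℤ_[2] R] [Algebra ℤ_[2] S] [Algebra R S]
  [IsScalarTower ℤ_[2] R S]

lemma map_polyAct (M : Matrix (Fin 2) (Fin 2) ℤ_[2]) (v : Poly R) :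
    MvPolynomial.map (algebraMap R S) (polyAct R M v) =
      polyAct S M (MvPolynomial.map (algebraMap R S) v) := by
  induction v using MvPolynomial.induction_on with
  | C a => simp [MvPolynomial.algHom_C]
  | add p q hp hq => simp [hp, hq]
  | mul_X p i hp =>
    simp only [map_mul, hp, MvPolynomial.map_X]
    congr 1
    simp [polyAct, ← IsScalarTower.algebraMap_apply]

/-- Extension of coefficients `I(Sym^r R²) → I(Sym^r S²)`. -/
def coeffMap (r : ℕ) : compactInd (sym R r) →ₗ[R] compactInd (sym S r) where
  toFun f := ⟨fun x => MvPolynomial.map (algebraMap R S) (f.1 x),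
    fun x => MvPolynomial.IsHomogeneous.map (f.2.1 x) _,
    fun k x => by beta_reduce; rw [f.2.2.1, map_polyAct],
    fun x => by beta_reduce; rw [f.2.2.2.1],
    by
      obtain ⟨T, hT⟩ := f.2.2.2.2
      refine ⟨T, fun x hx => hT x ?_⟩
      intro h0; apply hx; beta_reduce; rw [h0, map_zero]⟩
  map_add' f g := by ext1; funext x; simp
  map_smul' c f := by
    ext1; funext x
    simp only [Submodule.coe_smul, Pi.smul_apply, RingHom.id_apply, MvPolynomial.smul_eq_C_mul,
      map_mul, MvPolynomial.map_C]
    rw [← MvPolynomial.smul_eq_C_mul, algebraMap_smul]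
    rfl

lemma coeffMap_indRep (r : ℕ) (g : G) (f : compactInd (sym R r)) :
    coeffMap R S r (indRep (sym R r) g f) = indRep (sym S r) g (coeffMap R S r f) := rfl
end

/-! ## The fields and rings -/

/-- The algebraic closure of `ℚ₂`, with the norm extending the one of `ℚ₂`. -/
abbrev Q2bar : Type := PadicAlgCl 2
/-- The valuation ring of `Q2bar`. -/
abbrev Z2bar : Type := (Valued.v : Valuation Q2bar ℝ≥0).valuationSubring
/-- The residue field of `Z2bar`, an algebraic closure of `𝔽₂`. -/
abbrev F2bar : Type := IsLocalRing.ResidueField Z2bar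

instance : Algebra ℤ_[2] Z2bar :=
  ((algebraMap ℤ_[2] Q2bar).codRestrict (Valued.v : Valuation Q2bar ℝ≥0).valuationSubring (by
    intro x
    rw [Valuation.mem_valuationSubring_iff, PadicAlgCl.valuation_def, ← NNReal.coe_le_coe]
    have : algebraMap ℤ_[2] Q2bar x = ((x : ℚ_[2]) : Q2bar) := rfl
    rw [this, coe_nnnorm, PadicAlgCl.norm_extends]
    exact PadicInt.norm_le_one x)).toAlgebra

instance : IsScalarTower ℤ_[2] Z2bar Q2bar := IsScalarTower.of_algebraMap_eq fun _ => rfl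

/-- The additive valuation of `Q2bar` with `v(2) = 1` and `v(0) = ∞`. -/
def val (x : Q2bar) : EReal := open Classical in if x = 0 then ⊤ else ((-Real.logb 2 ‖x‖ : ℝ) : EReal)

/-! ## Theta -/

/-- `(T - a) I(Sym^r Q2bar²) ∩ I(Sym^r Z2bar²)`, as a submodule of `I(Sym^r Z2bar²)`. -/
def relations (r : ℕ) (a : Q2bar) : Submodule Z2bar (compactInd (sym Z2bar r)) :=
  Submodule.comap (coeffMap Z2bar Q2bar r)
    ((LinearMap.range (hecke Q2bar r - a • (1 : Module.End Q2bar (compactInd (sym Q2bar r))))).restrictScalars Z2bar)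

/-- The lattice `Θ_{k,a}`, `k = r + 2`: the image of `I(Sym^r Z2bar²)` in `I(Sym^r Q2bar²) / (T - a)`. -/
abbrev Theta (r : ℕ) (a : Q2bar) : Type := compactInd (sym Z2bar r) ⧸ relations r a

/-- The action of `G` on `Θ_{k,a}`. -/
def thetaRep (r : ℕ) (a : Q2bar) : Representation Z2bar G (Theta r a) :=
  (indRep (sym Z2bar r)).quotient (relations r a) (by
    rintro g f ⟨h, hh⟩
    refine ⟨indRep (sym Q2bar r) g h, ?_⟩
    simp only [LinearMap.sub_apply, LinearMap.smul_apply, Module.End.one_apply] at hh ⊢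
    rw [hecke_comm, coeffMap_indRep, ← hh, map_sub, map_smul])

/-- The reduction `Θ_{k,a} ⊗ F2bar`. -/
abbrev ThetaBar (r : ℕ) (a : Q2bar) : Type := F2bar ⊗[Z2bar] Theta r a

/-- The action of `G` on the reduction of `Θ_{k,a}`. -/
def thetaBarRep (r : ℕ) (a : Q2bar) : Representation F2bar G (ThetaBar r a) where
  toFun g := (thetaRep r a g).baseChange F2bar
  map_one' := by rw [map_one]; exact LinearMap.baseChange_id
  map_mul' g h := by rw [map_mul]; exact LinearMap.baseChange_mul ..

lemma coeffMap_elem (g : G) (v : Poly Z2bar) (x : G) :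
    MvPolynomial.map (algebraMap Z2bar F2bar) (elemFn g v x) =
      elemFn g (MvPolynomial.map (algebraMap Z2bar F2bar) v) x := by
  by_cases h : ∃ (k : K) (n : ℤ), x * g = ϖ ^ n * ofK k
  · obtain ⟨k, n, h⟩ := h; rw [elem_of h, elem_of h, map_polyAct]
  · rw [elem_of_not h, elem_of_not h, map_zero]

lemma exists_sym_lift (r : ℕ) (v : Poly F2bar) (hv : v ∈ sym F2bar r) :
    ∃ w ∈ sym Z2bar r, MvPolynomial.map (algebraMap Z2bar F2bar) w = v := by
  choose l hl using IsLocalRing.residue_surjective (R := Z2bar)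
  refine ⟨∑ d ∈ v.support, MvPolynomial.monomial d (l (v.coeff d)), ?_, ?_⟩
  · refine Submodule.sum_mem _ fun d hd => ?_
    exact MvPolynomial.isHomogeneous_monomial _ (by
      rw [Finsupp.degree_eq_weight_one]
      exact hv (MvPolynomial.mem_support_iff.1 hd))
  · rw [map_sum]
    conv_rhs => rw [v.as_sum]
    refine Finset.sum_congr rfl fun d _ => ?_
    rw [MvPolynomial.map_monomial]
    congr 1
    exact hl _

lemma coeffMap_surjective (r : ℕ) : Function.Surjective (coeffMap Z2bar F2bar r) := by
  rintro ⟨f, hf⟩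
  suffices h : ∃ h ∈ compactInd (sym Z2bar r),
      (fun x => MvPolynomial.map (algebraMap Z2bar F2bar) (h x)) = f by
    obtain ⟨h, hh, e⟩ := h
    exact ⟨⟨h, hh⟩, Subtype.ext e⟩
  refine compactInd_induction (sym_stable F2bar r) (fun f => ∃ h ∈ compactInd (sym Z2bar r),
      (fun x => MvPolynomial.map (algebraMap Z2bar F2bar) (h x)) = f) ?_ ?_ ?_ f hf
  · exact ⟨0, Submodule.zero_mem _, by funext x; simp⟩
  · rintro _ _ - - ⟨h, hh, rfl⟩ ⟨h', hh', rfl⟩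
    exact ⟨h + h', Submodule.add_mem _ hh hh', by funext x; simp⟩
  · intro g v hv
    obtain ⟨w, hw, rfl⟩ := exists_sym_lift r v hv
    exact ⟨elemFn g w, elem_mem (sym_stable _ r) g hw, by funext x; exact coeffMap_elem g w x⟩

/-- Homogeneous polynomials of degree `r` all of whose coefficients are in the maximal ideal. -/
def symMax (r : ℕ) : Submodule Z2bar (Poly Z2bar) :=
  sym Z2bar r ⊓ LinearMap.ker (MvPolynomial.mapAlgHom (σ := Fin 2) (Algebra.ofId Z2bar F2bar)).toLinearMap

lemma mem_symMax (r : ℕ) (v : Poly Z2bar) : v ∈ symMax r ↔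
    v ∈ sym Z2bar r ∧ MvPolynomial.map (algebraMap Z2bar F2bar) v = 0 := Iff.rfl

lemma symMax_stable (r : ℕ) : KStable (symMax r) := by
  rintro k v hv
  rw [mem_symMax] at hv ⊢
  exact ⟨sym_stable _ r k v hv.1, by rw [map_polyAct, hv.2, map_zero]⟩

/-- The map sending `f` in `I(Sym^r Z2bar²)` to the class of `f` in `Θ_{k,a} ⊗ F2bar`. -/
def thetaBarMk (r : ℕ) (a : Q2bar) : compactInd (sym Z2bar r) →ₗ[Z2bar] ThetaBar r a :=
  (TensorProduct.mk Z2bar F2bar (Theta r a) 1) ∘ₗ (relations r a).mkQ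

lemma elem_monomial_sum (g : G) (v : Poly Z2bar) :
   elemFn g v = ∑ d ∈ v.support, v.coeff d • elemFn g (MvPolynomial.monomial d 1) := by
  have h0 : elemFn g (0 : Poly Z2bar) = 0 := by
    have := elem_smul g (0 : Z2bar) (0 : Poly Z2bar); simpa using this
  let φ : Poly Z2bar →ₗ[Z2bar] (G → Poly Z2bar) :=
    { toFun := elemFn g, map_add' := elem_add g, map_smul' := elem_smul g }
  change φ v = ∑ d ∈ v.support, v.coeff d • φ (MvPolynomial.monomial d 1)
  conv_lhs => rw [v.as_sum, map_sum]
  refine Finset.sum_congr rfl fun d _ => ?_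
  rw [← map_smul, MvPolynomial.smul_monomial, smul_eq_mul, mul_one]

lemma thetaBarMk_eq_zero (r : ℕ) (a : Q2bar) (f : compactInd (sym Z2bar r))
    (hf : coeffMap Z2bar F2bar r f = 0) : thetaBarMk r a f = 0 := by
  have hf' : f.1 ∈ compactInd (symMax r) := by
    refine ⟨fun x => ⟨f.2.1 x, ?_⟩, f.2.2⟩
    have := congrFun (congrArg Subtype.val hf) x
    exact this
  have key : ∀ (g : G) (d : Fin 2 →₀ ℕ) (hd : d.degree = r) (c : Z2bar) (hc : algebraMap Z2bar F2bar c = 0),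
      thetaBarMk r a (c • ⟨elemFn g (MvPolynomial.monomial d 1), elem_mem (sym_stable _ r) g
        (MvPolynomial.isHomogeneous_monomial _ hd)⟩) = 0 := by
    intro g d hd c hc
    rw [map_smul]
    change c • ((1 : F2bar) ⊗ₜ[Z2bar] _) = 0
    rw [TensorProduct.smul_tmul', Algebra.smul_def, hc, zero_mul, TensorProduct.zero_tmul]
  suffices h : ∃ h : f.1 ∈ compactInd (sym Z2bar r), thetaBarMk r a ⟨f.1, h⟩ = 0 by
    obtain ⟨_, h⟩ := h; exact h
  refine compactInd_induction (symMax_stable r)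
    (fun f => ∃ h : f ∈ compactInd (sym Z2bar r), thetaBarMk r a ⟨f, h⟩ = 0) ?_ ?_ ?_ f.1 hf'
  · exact ⟨Submodule.zero_mem _, map_zero (thetaBarMk r a)⟩
  · rintro f f' - - ⟨h, e⟩ ⟨h', e'⟩
    refine ⟨Submodule.add_mem _ h h', ?_⟩
    have := map_add (thetaBarMk r a) ⟨f, h⟩ ⟨f', h'⟩
    rw [e, e', add_zero] at this
    exact this
  · rintro g v hv
    rw [mem_symMax] at hv
    refine ⟨elem_mem (sym_stable _ r) g hv.1, ?_⟩
    have hd : ∀ d ∈ v.support, d.degree = r := fun d hd => by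
      rw [Finsupp.degree_eq_weight_one]
      exact hv.1 (MvPolynomial.mem_support_iff.1 hd)
    have : (⟨elemFn g v, elem_mem (sym_stable _ r) g hv.1⟩ : compactInd (sym Z2bar r)) =
        ∑ d : v.support, v.coeff d.1 • ⟨elemFn g (MvPolynomial.monomial d.1 1),
          elem_mem (sym_stable _ r) g (MvPolynomial.isHomogeneous_monomial _ (hd d.1 d.2))⟩ := by
      apply Subtype.ext
      rw [AddSubmonoidClass.coe_finsetSum]
      change elemFn g v = ∑ d : v.support, v.coeff d.1 • elemFn g (MvPolynomial.monomial d.1 1)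
      rw [Finset.sum_coe_sort v.support (fun d => v.coeff d • elemFn g (MvPolynomial.monomial d 1))]
      exact elem_monomial_sum g v
    rw [this, map_sum]
    refine Finset.sum_eq_zero fun d _ => key g d.1 (hd d.1 d.2) _ ?_
    have h := congrArg (MvPolynomial.coeff d.1) hv.2
    rwa [MvPolynomial.coeff_map, MvPolynomial.coeff_zero] at h

/-- The natural map `P : I(V_r) → Θ_{k,a} ⊗ F2bar`: the class of any lift to `I(Sym^r Z2bar²)`. By
`thetaBarMk_eq_zero` it does not depend on the lift; see `projP_coeffMap`. -/
def projP (r : ℕ) (a : Q2bar) : compactInd (sym F2bar r) →ₗ[F2bar] ThetaBar r a where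
  toFun f := thetaBarMk r a (coeffMap_surjective r f).choose
  map_add' f g := by
    rw [← map_add, ← sub_eq_zero, ← map_sub]
    apply thetaBarMk_eq_zero
    rw [map_sub, map_add, (coeffMap_surjective r f).choose_spec,
      (coeffMap_surjective r g).choose_spec, (coeffMap_surjective r (f + g)).choose_spec, sub_self]
  map_smul' c f := by
    obtain ⟨c', rfl⟩ := IsLocalRing.residue_surjective c
    have : ∀ y : ThetaBar r a, IsLocalRing.residue Z2bar c' • y = c' • y := fun y =>
      algebraMap_smul F2bar c' y
    rw [RingHom.id_apply, this, ← map_smul, ← sub_eq_zero, ← map_sub]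
    apply thetaBarMk_eq_zero
    rw [map_sub, map_smul, (coeffMap_surjective r f).choose_spec,
      (coeffMap_surjective r _).choose_spec, sub_eq_zero]
    exact algebraMap_smul F2bar c' f

lemma projP_coeffMap (r : ℕ) (a : Q2bar) (f : compactInd (sym Z2bar r)) :
    projP r a (coeffMap Z2bar F2bar r f) = thetaBarMk r a f := by
  change thetaBarMk r a _ = _
  rw [← sub_eq_zero, ← map_sub]
  apply thetaBarMk_eq_zero
  rw [map_sub, (coeffMap_surjective r _).choose_spec, sub_self]


lemma projP_indRep (r : ℕ) (a : Q2bar) (g : G) (f : compactInd (sym F2bar r)) :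
    projP r a (indRep (sym F2bar r) g f) = thetaBarRep r a g (projP r a f) := by
  obtain ⟨h, rfl⟩ := coeffMap_surjective r f
  rw [← coeffMap_indRep, projP_coeffMap, projP_coeffMap]
  rfl

/-! ## The factor coming from the subrepresentation `V_1` -/

open MvPolynomial

/-- `θ = X²Y - XY²`. -/
def theta : Poly F2bar := X 0 ^ 2 * X 1 - X 0 * X 1 ^ 2

/-- `V_r^{(n)}`, which is `θ^n V_{r - 3n}` if `3n ≤ r` and `0` otherwise. -/
def filtration (r n : ℕ) : Submodule F2bar (Poly F2bar) :=
  if 3 * n ≤ r then (sym F2bar (r - 3 * n)).map (LinearMap.mulLeft F2bar (theta ^ n)) else ⊥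

/-- The linear map `aX + bY ↦ θ (a X^{r-3} + b Y^{r-3})`. Modulo `V_r^{(2)}` it is the `K`-equivariant injection of
`V_1` into `V_r^{(1)} / V_r^{(2)}`. -/
def inclV1 (r : ℕ) : Poly F2bar →ₗ[F2bar] Poly F2bar where
  toFun v := theta * (coeff (Finsupp.single 0 1) v • X 0 ^ (r - 3) +
    coeff (Finsupp.single 1 1) v • X 1 ^ (r - 3))
  map_add' v w := by simp only [coeff_add, add_smul]; ring
  map_smul' c v := by
    simp only [coeff_smul, smul_eq_mul, mul_smul, ← smul_add, mul_smul_comm, RingHom.id_apply]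

/-- `f'` in `I(V_r^{(1)})` and `f` in `I(V_1)` have the same image in `I(V_r^{(1)} / V_r^{(2)})`. -/
def Lifts (r : ℕ) (f' : compactInd (sym F2bar r)) (f : compactInd (sym F2bar 1)) : Prop :=
  f'.1 ∈ compactInd (filtration r 1) ∧ ∀ x, f'.1 x - inclV1 r (f.1 x) ∈ filtration r 2

/-- The preimage in `I(V_r^{(1)})` of the subspace `I(V_1)` of `I(V_r^{(1)} / V_r^{(2)})`. -/
def partV1 (r : ℕ) : Submodule F2bar (compactInd (sym F2bar r)) where
  carrier := {f' | ∃ f, Lifts r f' f}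
  zero_mem' := ⟨0, Submodule.zero_mem _, fun x => by simp⟩
  add_mem' := by
    rintro f' h' ⟨f, hf, hf2⟩ ⟨h, hh, hh2⟩
    refine ⟨f + h, Submodule.add_mem _ hf hh, fun x => ?_⟩
    have := Submodule.add_mem _ (hf2 x) (hh2 x)
    rw [← add_sub_add_comm, ← map_add] at this
    exact this
  smul_mem' := by
    rintro c f' ⟨f, hf, hf2⟩
    refine ⟨c • f, Submodule.smul_mem _ c hf, fun x => ?_⟩
    have := Submodule.smul_mem _ c (hf2 x)
    rw [smul_sub, ← map_smul] at this
    exact this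

/-- The factor `F'_2`: the image of `I(V_1)` in `Θ_{k,a} ⊗ F2bar` (in fact in the image of `I(V_r^{(1)})`). -/
def factorF2 (r : ℕ) (a : Q2bar) : Submodule F2bar (ThetaBar r a) := (partV1 r).map (projP r a)

/-- The action of `G` on `F'_2`. -/
def factorF2Rep (r : ℕ) (a : Q2bar) : Representation F2bar G (factorF2 r a) :=
  (thetaBarRep r a).subrepresentation (factorF2 r a) (by
    rintro g _ ⟨f', ⟨f, hf, hf2⟩, rfl⟩
    refine ⟨indRep _ g f', ⟨indRep _ g f, ?_, fun x => hf2 (x * g)⟩, projP_indRep r a g f'⟩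
    exact (indRep (filtration r 1) g ⟨f'.1, hf⟩).2)

/-- The quotient `I(V_1) / (q(T))`. -/
abbrev HeckeCoker (q : Polynomial F2bar) : Type :=
  compactInd (sym F2bar 1) ⧸ LinearMap.range (Polynomial.aeval (hecke F2bar 1) q)

/-- The action of `G` on `I(V_1) / (q(T))`. -/
def heckeCokerRep (q : Polynomial F2bar) : Representation F2bar G (HeckeCoker q) :=
  (indRep (sym F2bar 1)).quotient _ (by
    rintro g _ ⟨f, rfl⟩
    have h : Commute (indRep (sym F2bar 1) g) (hecke F2bar 1) :=
      LinearMap.ext fun f => (hecke_comm 1 g f).symm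
    have h' : Commute (indRep (sym F2bar 1) g) (Polynomial.aeval (hecke F2bar 1) q) := by
      induction q using Polynomial.induction_on' with
      | add p q hp hq => rw [map_add]; exact hp.add_right hq
      | monomial n c =>
        rw [Polynomial.aeval_monomial]
        exact (Algebra.commute_algebraMap_right c _).mul_right (h.pow_right n)
    exact ⟨indRep _ g f, (LinearMap.congr_fun h'.eq f).symm⟩)

/-- `F'_2` is a quotient of `I(V_1) / (q(T))` through the natural map: there is a surjective `G`-equivariant map
`π : I(V_1) / (q(T)) → F'_2` under which the class of `f` goes to `P f'` whenever `f'` in `I(V_r^{(1)})` represents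
the image of `f` in `I(V_r^{(1)} / V_r^{(2)})`. -/
def IsNaturalQuotient (r : ℕ) (a : Q2bar) (q : Polynomial F2bar) : Prop :=
  ∃ π : HeckeCoker q →ₗ[F2bar] factorF2 r a,
    Function.Surjective π ∧
    (∀ g y, π (heckeCokerRep q g y) = factorF2Rep r a g (π y)) ∧
    ∀ f f', Lifts r f' f → (π (Submodule.Quotient.mk f) : ThetaBar r a) = projP r a f'

/-- `α = (a² - 2² binom(r, 2)) / (2a)`. -/
def alpha (r : ℕ) (a : Q2bar) : Q2bar := (a ^ 2 - 2 ^ 2 * (r.choose 2 : Q2bar)) / (2 * a)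

end ModTwo

end

open ModTwo

noncomputable section

namespace ModTwo

open scoped NNReal TensorProduct
open MvPolynomial

/-! ## Norms -/

/-! Write r = 2N + 2 and a = 2u with |u| = 1. Functions on G are considered modulo (T - a), and a
class is measured by the size of the coefficients of a representative (`Small`). An integral class
of size less than 1 dies in the reduction (`thetaBarMk_eq_zero_of_small`), so a relation in F'_2 is
an estimate over the field. The size bound is kept as a parameter ρ, so that an estimate may be
divided by a scalar such as α or N.

The map from I(V_1) is G-equivariant, commutes with nothing else that needs checking, and [1, X]
generates I(V_1). Hence it is enough to show that q(T)[1, X] goes to 0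
(`isNaturalQuotient_of_elemX_one`). The class [h, X] is lifted to E(h) = [h, X^(r-1) Y - X^(r-2)
Y²]. That P kills I(V_r^(2)) holds because T sends θ² into multiples of 4, while |4| < |a|
(`small_br_thetaInt_sq_mul`).

The relation comes from `brZ`, the sum of [h, X^(r-2) Y²] and a⁻¹ [h (1 0; 0 2), Y^r]. Applying T to
both parts expresses `brZ` at h by a times `brZ` at h (2 0; 0 1), plus explicit errors (`brZ_eq`).
Since |a| < 1, iteration shows that `brZ` itself is small (`brZ_small`). Now take the third
difference of `brZ` over the unipotents (1 l; 0 1), l = -1, 0, 1, 2. The part from X^(r-2) Y² is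
quadratic in l and vanishes. The part from Y^r is a third difference of (Y + 2lX)^r, which is highly
divisible by 2 (`third_difference_pow`). Expanding the same third difference twice by `brZ_eq` and
dividing by 4 leaves a relation among the classes of X^(r-2) Y² and X^(r-1) Y at the cosets that
occur in T and T² (`exists_small_relation`).

Expanding T on X^(r-1) Y and X^(r-2) Y² also gives that u E(h) is congruent to a sum of two classes
of X^(r-1) Y (`small_brE`). With it the relation becomes, up to size max(|α|, |N|), the vanishing of
α (E + T²E - u TE) + N TE (`brE_relation`). If |N| ≤ |α|, division by α gives T² - c₀T + 1; if |α| <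
|N|, division by N gives T. These are the two cases, since t - 1 = v(N). -/

lemma norm_two_Q2bar : ‖(2 : Q2bar)‖ = 1 / 2 := by
  have h := PadicAlgCl.norm_extends 2 (2 : ℚ_[2])
  have : ((2 : ℚ_[2]) : Q2bar) = 2 := map_ofNat (algebraMap ℚ_[2] Q2bar) 2
  rwa [this, norm_two] at h

lemma norm_coe_le_one (x : Z2bar) : ‖(x : Q2bar)‖ ≤ 1 := by
  have := (Valuation.mem_valuationSubring_iff _ _).1 x.2
  rwa [PadicAlgCl.valuation_def, ← NNReal.coe_le_coe, coe_nnnorm, NNReal.coe_one] at this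

lemma mem_Z2bar {x : Q2bar} (hx : ‖x‖ ≤ 1) :
    x ∈ (Valued.v : Valuation Q2bar ℝ≥0).valuationSubring := by
  rw [Valuation.mem_valuationSubring_iff, PadicAlgCl.valuation_def, ← NNReal.coe_le_coe,
    coe_nnnorm, NNReal.coe_one]
  exact hx

lemma residue_eq_zero_iff (x : Z2bar) : algebraMap Z2bar F2bar x = 0 ↔ ‖(x : Q2bar)‖ < 1 := by
  rw [IsLocalRing.ResidueField.algebraMap_eq, IsLocalRing.residue_eq_zero_iff,
    IsLocalRing.mem_maximalIdeal, mem_nonunits_iff]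
  constructor
  · intro h
    refine lt_of_le_of_ne (norm_coe_le_one x) fun h1 => h ?_
    have hx : (x : Q2bar) ≠ 0 := by rw [← norm_ne_zero_iff, h1]; exact one_ne_zero
    refine IsUnit.of_mul_eq_one ⟨(x : Q2bar)⁻¹, mem_Z2bar (by rw [norm_inv, h1, inv_one])⟩ ?_
    exact Subtype.ext (mul_inv_cancel₀ hx)
  · rintro h ⟨u, rfl⟩
    have h1 : ‖(u : Z2bar).1 * ((u⁻¹ : Z2barˣ) : Z2bar).1‖ = 1 := by
      have : (u : Z2bar).1 * ((u⁻¹ : Z2barˣ) : Z2bar).1 = 1 := congrArg Subtype.val u.mul_inv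
      rw [this, norm_one]
    rw [norm_mul] at h1
    have := norm_coe_le_one ((u⁻¹ : Z2barˣ) : Z2bar)
    nlinarith [norm_nonneg (u : Z2bar).1]

lemma norm_intCast_le_one (k : ℤ) : ‖(k : Q2bar)‖ ≤ 1 := by
  have := norm_coe_le_one (k : Z2bar)
  simpa using this

lemma norm_natCast_le_one (k : ℕ) : ‖(k : Q2bar)‖ ≤ 1 := by
  have := norm_coe_le_one (k : Z2bar)
  simpa using this

lemma norm_add_lt {ρ : ℝ} {x y : Q2bar} (hx : ‖x‖ < ρ) (hy : ‖y‖ < ρ) : ‖x + y‖ < ρ :=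
  (IsUltrametricDist.norm_add_le_max x y).trans_lt (max_lt hx hy)

/-! ## The quotient by the image of `T - a` and its lattices -/

/-- The functions from `G` to polynomials modulo `(T - a) I(Sym^r Q2bar²)`. -/
abbrev Ambient (r : ℕ) (a : Q2bar) : Type :=
  (G → Poly Q2bar) ⧸
    (compactInd (sym Q2bar r)).map (heckeFun Q2bar - a • (LinearMap.id : (G → Poly Q2bar) →ₗ[Q2bar] _))

section
variable {r : ℕ} {a : Q2bar}

/-- The classes of the functions all of whose values have coefficients of norm less than `ρ`. -/
def Small (ρ : ℝ) (v : Ambient r a) : Prop :=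
  ∃ f : G → Poly Q2bar, Submodule.Quotient.mk f = v ∧ ∀ x d, ‖coeff d (f x)‖ < ρ

lemma Small.add {ρ : ℝ} {v w : Ambient r a} (hv : Small ρ v) (hw : Small ρ w) :
    Small ρ (v + w) := by
  obtain ⟨f, rfl, hf⟩ := hv
  obtain ⟨g, rfl, hg⟩ := hw
  exact ⟨f + g, rfl, fun x d => by
    rw [Pi.add_apply, coeff_add]; exact norm_add_lt (hf x d) (hg x d)⟩

lemma Small.smul {ρ σ : ℝ} {v : Ambient r a} (hv : Small ρ v) {c : Q2bar} (hσ : 0 < σ)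
    (hc : ‖c‖ * ρ ≤ σ) : Small σ (c • v) := by
  obtain ⟨f, rfl, hf⟩ := hv
  refine ⟨c • f, rfl, fun x d => ?_⟩
  rw [Pi.smul_apply, coeff_smul, smul_eq_mul, norm_mul]
  rcases eq_or_ne c 0 with rfl | h
  · simpa
  · exact (mul_lt_mul_of_pos_left (hf x d) (norm_pos_iff.2 h)).trans_le hc

lemma Small.pos {ρ : ℝ} {v : Ambient r a} (hv : Small ρ v) : 0 < ρ := by
  obtain ⟨f, -, hf⟩ := hv
  exact (norm_nonneg _).trans_lt (hf 1 0)

lemma Small.mono {ρ σ : ℝ} {v : Ambient r a} (hv : Small ρ v) (h : ρ ≤ σ) : Small σ v := by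
  have := hv.smul (c := 1) (hv.pos.trans_le h) (by simpa using h)
  rwa [one_smul] at this

lemma Small.unit_smul {ρ : ℝ} {v : Ambient r a} (hv : Small ρ v) {c : Q2bar} (hc : ‖c‖ ≤ 1) :
    Small ρ (c • v) :=
  hv.smul hv.pos (mul_le_of_le_one_left hv.pos.le hc)

lemma Small.neg {ρ : ℝ} {v : Ambient r a} (hv : Small ρ v) : Small ρ (-v) := by
  have := hv.unit_smul (c := -1) (by simp)
  rwa [neg_one_smul] at this

lemma Small.sub {ρ : ℝ} {v w : Ambient r a} (hv : Small ρ v) (hw : Small ρ w) :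
    Small ρ (v - w) := by
  rw [sub_eq_add_neg]; exact hv.add hw.neg

/-- This is how estimates are divided: by a for θ², by u in `brE_relation`, and by α or N at the
end. -/
lemma Small.of_smul {ρ : ℝ} {v : Ambient r a} {c : Q2bar} (hc : c ≠ 0)
    (hv : Small (‖c‖ * ρ) (c • v)) : Small ρ v := by
  have hc' : 0 < ‖c‖ := norm_pos_iff.2 hc
  have hρ : 0 < ρ := pos_of_mul_pos_right hv.pos hc'.le
  have := hv.smul (c := c⁻¹) hρ (by rw [norm_inv, inv_mul_cancel_left₀ hc'.ne'])
  rwa [inv_smul_smul₀ hc] at this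

variable (r a) in
/-- The class of the elementary function `[h, w]`. -/
def br (h : G) : Poly Z2bar →+ Ambient r a where
  toFun w := Submodule.Quotient.mk (elemFn h (map (algebraMap Z2bar Q2bar) w))
  map_zero' := by
    have h0 : elemFn h (0 : Poly Q2bar) = 0 := by
      have := elem_smul h (0 : Q2bar) (0 : Poly Q2bar); simpa using this
    rw [map_zero, h0]; rfl
  map_add' v w := by rw [map_add, elem_add]; rfl

lemma br_apply (h : G) (w : Poly Z2bar) : br r a h w =
    Submodule.Quotient.mk (elemFn h (map (algebraMap Z2bar Q2bar) w)) := rfl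

lemma br_smul (h : G) (c : Z2bar) (w : Poly Z2bar) :
    br r a h (c • w) = (c : Q2bar) • br r a h w := by
  rw [br_apply, br_apply, ← Submodule.Quotient.mk_smul, ← elem_smul, smul_eq_C_mul, map_mul, map_C,
    smul_eq_C_mul]
  rfl

lemma br_intCast_mul (h : G) (k : ℤ) (w : Poly Z2bar) :
    br r a h (k * w) = (k : Q2bar) • br r a h w := by
  have : (k : Poly Z2bar) * w = (k : Z2bar) • w := by rw [smul_eq_C_mul, map_intCast]
  rw [this, br_smul]; simp

lemma br_natCast_mul (h : G) (k : ℕ) (w : Poly Z2bar) :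
    br r a h (k * w) = (k : Q2bar) • br r a h w := by
  have := br_intCast_mul (r := r) (a := a) h k w
  simpa using this

lemma br_ofK (h : G) (k : K) (w : Poly Z2bar) :
    br r a (h * ofK k) w = br r a h (polyAct Z2bar k.val w) := by
  rw [br_apply, br_apply, elem_mul_ofK, map_polyAct]

lemma br_ϖ (h : G) (w : Poly Z2bar) : br r a (h * ϖ) w = br r a h w := by
  rw [br_apply, br_apply, ← ϖ_comm, elem_mul_ϖ]

lemma norm_coeff_map_le (w : Poly Z2bar) (d) :
    ‖coeff d (map (algebraMap Z2bar Q2bar) w)‖ ≤ 1 := by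
  rw [coeff_map]; exact norm_coe_le_one _

lemma elemFn_map (h : G) (w : Poly Z2bar) (x : G) :
    elemFn h (map (algebraMap Z2bar Q2bar) w) x = map (algebraMap Z2bar Q2bar) (elemFn h w x) := by
  by_cases hx : ∃ (k : K) (n : ℤ), x * h = ϖ ^ n * ofK k
  · obtain ⟨k, n, hx⟩ := hx; rw [elem_of hx, elem_of hx, map_polyAct]
  · rw [elem_of_not hx, elem_of_not hx, map_zero]

lemma small_smul_br (h : G) (w : Poly Z2bar) {c : Q2bar} {ρ : ℝ} (hc : ‖c‖ < ρ) :
    Small ρ (c • br r a h w) := by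
  refine ⟨c • elemFn h (map (algebraMap Z2bar Q2bar) w), rfl, fun x d => ?_⟩
  rw [Pi.smul_apply, coeff_smul, smul_eq_mul, norm_mul, elemFn_map]
  exact (mul_le_of_le_one_right (norm_nonneg _) (norm_coeff_map_le _ _)).trans_lt hc

/-- The matrix `(2 0; 0 1)`. -/
def ga : G := matG 2 0 0 1 (by norm_num)
/-- The matrix `(2 1; 0 1)`. -/
def gb : G := matG 2 1 0 1 (by norm_num)
/-- The matrix `(1 0; 0 2)`. -/
def gc : G := matG 1 0 0 2 (by norm_num)

lemma br_hecke (h : G) (w : Poly Z2bar) (hw : w.IsHomogeneous r) : a • br r a h w =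
    br r a (h * ga) (aeval ![X 0, 2 * X 1] w) + br r a (h * gb) (aeval ![X 0, 2 * X 1 - X 0] w) +
      br r a (h * gc) (aeval ![2 * X 0, X 1] w) := by
  have hm : ∀ v : Fin 2 → Poly Z2bar, map (algebraMap Z2bar Q2bar) (aeval v w) =
      aeval (fun i => map (algebraMap Z2bar Q2bar) (v i)) (map (algebraMap Z2bar Q2bar) w) := by
    intro v
    rw [aeval_def, aeval_def, eval₂_map, hom_eval₂]
    congr 1
    ext c : 1
    simp [algebraMap_eq]
  have hT := heckeFun_elem h (map (algebraMap Z2bar Q2bar) w)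
  simp only [br_apply]
  symm
  rw [hm, hm, hm]
  have e0 : (fun i => map (algebraMap Z2bar Q2bar) ((![X 0, 2 * X 1] : Fin 2 → Poly Z2bar) i)) =
      ![X 0, 2 * X 1] := by funext i; fin_cases i <;> simp
  have e1 : (fun i => map (algebraMap Z2bar Q2bar) ((![X 0, 2 * X 1 - X 0] : Fin 2 → Poly Z2bar) i)) =
      ![X 0, 2 * X 1 - X 0] := by funext i; fin_cases i <;> simp
  have e2 : (fun i => map (algebraMap Z2bar Q2bar) ((![2 * X 0, X 1] : Fin 2 → Poly Z2bar) i)) =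
      ![2 * X 0, X 1] := by funext i; fin_cases i <;> simp
  rw [e0, e1, e2, ← Submodule.Quotient.mk_smul, ← Submodule.Quotient.mk_add,
    ← Submodule.Quotient.mk_add, Submodule.Quotient.eq]
  refine ⟨elemFn h (map (algebraMap Z2bar Q2bar) w), elem_mem (sym_stable _ r) h (hw.map _), ?_⟩
  simp only [LinearMap.sub_apply, LinearMap.smul_apply, LinearMap.id_apply]
  rw [hT]
  rfl
end

/-- An integral element whose class in the quotient by `T - a` is small is killed in the reduction. -/
lemma thetaBarMk_eq_zero_of_small {r : ℕ} {a : Q2bar} (f : compactInd (sym Z2bar r))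
    (hf : Small 1 (Submodule.Quotient.mk (coeffMap Z2bar Q2bar r f).1 : Ambient r a)) :
    thetaBarMk r a f = 0 := by
  obtain ⟨e, he, hs⟩ := hf
  rw [Submodule.Quotient.eq] at he
  obtain ⟨F, hF, hFe⟩ := he
  -- `Small` does not ask its representative to be equivariant or compactly supported. Here this is
  -- automatic, as it differs from an element of the induction by an element of the image of T - a.
  have hdef : e = (coeffMap Z2bar Q2bar r f + (hecke Q2bar r ⟨F, hF⟩ - a • ⟨F, hF⟩) : compactInd (sym Q2bar r)).1 := by
    have : e = (coeffMap Z2bar Q2bar r f).1 + (e - (coeffMap Z2bar Q2bar r f).1) := by abel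
    rw [this, ← hFe]; rfl
  have hmem : e ∈ compactInd (sym Q2bar r) := by rw [hdef]; exact Subtype.property _
  have inj : Function.Injective (map (σ := Fin 2) (algebraMap Z2bar Q2bar)) :=
    map_injective _ Subtype.val_injective
  have lift : ∀ x, ∃ w : Poly Z2bar, map (algebraMap Z2bar Q2bar) w = e x := by
    intro x
    rw [← Set.mem_range, MvPolynomial.mem_range_map_iff_coeffs_subset]
    intro c hc
    obtain ⟨d, -, rfl⟩ := mem_coeffs_iff.1 hc
    exact ⟨⟨_, mem_Z2bar (hs x d).le⟩, rfl⟩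
  choose w hw using lift
  have hwmem : w ∈ compactInd (sym Z2bar r) := by
    refine ⟨fun x => ?_, fun k x => ?_, fun x => ?_, ?_⟩
    · have := hmem.1 x
      rw [← hw] at this
      exact IsHomogeneous.of_map Subtype.val_injective this
    · apply inj; rw [map_polyAct, hw, hw, hmem.2.1]
    · apply inj; rw [hw, hw, hmem.2.2.1]
    · obtain ⟨S, hS⟩ := hmem.2.2.2
      exact ⟨S, fun x hx => hS x fun h0 => hx (inj (by rw [hw, h0, map_zero]))⟩
  have h1 : thetaBarMk r a ⟨w, hwmem⟩ = 0 := by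
    apply thetaBarMk_eq_zero
    apply Subtype.ext
    funext x
    change map (algebraMap Z2bar F2bar) (w x) = 0
    ext d
    rw [coeff_map, coeff_zero, residue_eq_zero_iff]
    have := hs x d
    rwa [← hw, coeff_map] at this
  have h2 : thetaBarMk r a (f - ⟨w, hwmem⟩) = 0 := by
    have hrel : f - (⟨w, hwmem⟩ : compactInd (sym Z2bar r)) ∈ relations r a := by
      refine ⟨-⟨F, hF⟩, ?_⟩
      rw [map_neg, map_sub]
      have hw' : coeffMap Z2bar Q2bar r ⟨w, hwmem⟩ = ⟨e, hmem⟩ := Subtype.ext (funext hw)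
      rw [hw', neg_eq_iff_eq_neg, neg_sub]
      exact Subtype.ext hFe
    change (1 : F2bar) ⊗ₜ[Z2bar] (relations r a).mkQ _ = 0
    rw [Submodule.mkQ_apply, (Submodule.Quotient.mk_eq_zero _).2 hrel, TensorProduct.tmul_zero]
  rwa [map_sub, h1, sub_zero] at h2

/-! ## Binomial expansions modulo powers of two -/

/-- Squaring doubles the exponent and gains one factor 2 in the error. The error is a polynomial in
v, so that its values at arguments congruent modulo 2 are congruent modulo 2. -/
lemma exists_add_four_mul_pow {A : Type} [CommRing A] (p : A) (k o : ℕ) (ho : 1 ≤ o) :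
    ∃ W : Polynomial A, ∀ v, (p + 4 * v) ^ (2 ^ k * o) = p ^ (2 ^ k * o) +
      4 * (2 ^ k * o : ℕ) * p ^ (2 ^ k * o - 1) * v + 2 ^ (k + 3) * W.eval v := by
  induction k with
  | zero =>
    obtain ⟨W, hW⟩ := Polynomial.powAddExpansion (Polynomial.C p) (4 * Polynomial.X) o
    refine ⟨2 * W * Polynomial.X ^ 2, fun v => ?_⟩
    have := congrArg (Polynomial.eval v) hW
    simp only [Polynomial.eval_add, Polynomial.eval_mul, Polynomial.eval_pow, Polynomial.eval_C,
      Polynomial.eval_X, Polynomial.eval_natCast, Polynomial.eval_ofNat] at this ⊢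
    rw [pow_zero, one_mul, this]
    ring
  | succ k ih =>
    obtain ⟨W, hW⟩ := ih
    set N := 2 ^ k * o with hN
    have hN1 : 1 ≤ N := Nat.mul_pos (by positivity) ho
    obtain ⟨M, hM⟩ := Nat.exists_eq_add_of_le' hN1
    have hN2 : 2 ^ (k + 1) * o = N + N := by rw [hN]; ring
    -- Squaring the sum of main term, linear term and error, these are, after division by 2^(k+4),
    -- the square of the linear term, the two cross terms with the old error, and the square of the
    -- old error.
    refine ⟨Polynomial.C (2 ^ k * (o : A) ^ 2 * p ^ (2 * M)) * Polynomial.X ^ 2 +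
      Polynomial.C (p ^ N) * W + 4 * (N : Polynomial A) * Polynomial.C (p ^ M) * Polynomial.X * W +
      2 ^ (k + 2) * W ^ 2, fun v => ?_⟩
    have e1 : N + N - 1 = N + M := by omega
    have e2 : N - 1 = M := by omega
    have e3 : p ^ (N + M) = p ^ N * p ^ M := pow_add _ _ _
    have hNc : (N : A) = 2 ^ k * o := by rw [hN]; push_cast; ring
    rw [hN2, pow_add, hW v, e1, e2, e3]
    simp only [Polynomial.eval_add, Polynomial.eval_mul, Polynomial.eval_pow, Polynomial.eval_C,
      Polynomial.eval_X, Polynomial.eval_natCast, Polynomial.eval_ofNat]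
    push_cast
    rw [hNc]
    ring

section
variable {A : Type} [CommRing A] (x y : A) (k o : ℕ) (ho : 1 ≤ o)
include ho

/-- The exponent is r = 2N + 2 with N = 2^k o. One W serves all z whose squares have the same p,
which lets powers of different z be compared through v alone. -/
lemma exists_even_pow (p : A) : ∃ W : Polynomial A, ∀ z v : A, z ^ 2 = p + 4 * v →
    z ^ (2 * (2 ^ k * o) + 2) = p ^ (2 ^ k * o) * (p + 4 * v) +
      4 * (2 ^ k * o) * (p ^ (2 ^ k * o) * v + 4 * p ^ (2 ^ k * o - 1) * v ^ 2) +
        2 ^ (k + 3) * (W.eval v * (p + 4 * v)) := by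
  obtain ⟨W, hW⟩ := exists_add_four_mul_pow p k o ho
  refine ⟨W, fun z v h => ?_⟩
  have hN : ((2 ^ k * o : ℕ) : A) = 2 ^ k * o := by push_cast; ring
  obtain ⟨M, hM⟩ := Nat.exists_eq_add_of_le' (Nat.mul_pos (by positivity : 0 < 2 ^ k) ho)
  rw [pow_add, pow_mul, h, hW v, hN, hM]
  simp only [Nat.add_sub_cancel]
  ring

/-- The third difference of `(y + 2 λ x)^r`. -/
lemma third_difference_pow : ∃ W, (y - 2 * x) ^ (2 * (2 ^ k * o) + 2) -
    3 * y ^ (2 * (2 ^ k * o) + 2) + 3 * (y + 2 * x) ^ (2 * (2 ^ k * o) + 2) -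
    (y + 4 * x) ^ (2 * (2 ^ k * o) + 2) = 2 ^ (k + 4) * W := by
  obtain ⟨W, hW⟩ := exists_even_pow k o ho (y ^ 2)
  -- (y + 2λx)² = y² + 4v with v = λxy + λ²x², so terms linear in v have zero third difference. The
  -- errors 2^(k+3) W(v) gain the missing factor 2 because v at -1 and 1, and v at 0 and 2, are
  -- congruent modulo 2.
  obtain ⟨l, hl⟩ := Polynomial.sub_dvd_eval_sub (-(x * y) + x ^ 2) (x * y + x ^ 2) W
  obtain ⟨l', hl'⟩ := Polynomial.sub_dvd_eval_sub (2 * x * y + 4 * x ^ 2) 0 W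
  rw [hW (y - 2 * x) (-(x * y) + x ^ 2) (by ring), hW y 0 (by ring),
    hW (y + 2 * x) (x * y + x ^ 2) (by ring), hW (y + 4 * x) (2 * x * y + 4 * x ^ 2) (by ring),
    sub_eq_iff_eq_add.1 hl, sub_eq_iff_eq_add.1 hl']
  generalize W.eval (x * y + x ^ 2) = w₁
  generalize W.eval 0 = w₀
  generalize (y ^ 2) ^ (2 ^ k * o) = P
  generalize (y ^ 2) ^ (2 ^ k * o - 1) = Q
  refine ⟨o * Q * ((-(x * y) + x ^ 2) ^ 2 + 3 * (x * y + x ^ 2) ^ 2 - (2 * x * y + 4 * x ^ 2) ^ 2) +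
    y ^ 2 * (2 * w₁ - x * y * l - 2 * w₀ - (x * y + 2 * x ^ 2) * l') +
    2 * ((-(x * y) + x ^ 2) * (w₁ - 2 * x * y * l) + 3 * (x * y + x ^ 2) * w₁ -
      (2 * x * y + 4 * x ^ 2) * (w₀ + (2 * x * y + 4 * x ^ 2) * l')), ?_⟩
  ring

/-- With (2y ∓ x)² = x² + 4(y² ∓ xy) the leading terms cancel. The second identity is the translate
of the first under y ↦ x + y. The two values of v differ by 2xy, so the two errors agree modulo 2,
which is recorded by W and W + 2V. -/
lemma exists_remainder : ∃ W V : A,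
    x ^ (2 * (2 ^ k * o)) * (2 * y - x) ^ 2 - (2 * y - x) ^ (2 * (2 ^ k * o) + 2) =
      -(4 * (2 ^ k * o)) * (x ^ (2 * (2 ^ k * o)) * y ^ 2 - x ^ (2 * (2 ^ k * o) + 1) * y) +
        2 ^ (k + 3) * W ∧
    x ^ (2 * (2 ^ k * o)) * (2 * y + x) ^ 2 - (2 * y + x) ^ (2 * (2 ^ k * o) + 2) =
      -(4 * (2 ^ k * o)) * (x ^ (2 * (2 ^ k * o)) * y ^ 2 + x ^ (2 * (2 ^ k * o) + 1) * y) +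
        2 ^ (k + 3) * (W + 2 * V) := by
  obtain ⟨W, hW⟩ := exists_even_pow k o ho (x ^ 2)
  obtain ⟨l, hl⟩ := Polynomial.sub_dvd_eval_sub (y ^ 2 + x * y) (y ^ 2 - x * y) W
  rw [hW (2 * y - x) (y ^ 2 - x * y) (by ring), hW (2 * y + x) (y ^ 2 + x * y) (by ring),
    sub_eq_iff_eq_add.1 hl, pow_succ x (2 * (2 ^ k * o)), pow_mul x 2 (2 ^ k * o)]
  generalize W.eval (y ^ 2 - x * y) = w
  generalize (x ^ 2) ^ (2 ^ k * o) = P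
  generalize (x ^ 2) ^ (2 ^ k * o - 1) = Q
  refine ⟨-(2 * o * Q * (y ^ 2 - x * y) ^ 2 + w * (x ^ 2 + 4 * (y ^ 2 - x * y))),
    -(4 * o * Q * x * y ^ 3 + x * y * l * (x ^ 2 + 4 * (y ^ 2 + x * y)) + 4 * w * x * y),
    ?_, ?_⟩ <;> ring
end

/-! ## Unipotent matrices -/

/-- The matrix `(1 λ; 0 1)` in `K`. -/
def unip (l : ℤ) : K := Matrix.GeneralLinearGroup.mk'' !![1, (l : ℤ_[2]); 0, 1] (by simp)

lemma unip_val (l : ℤ) : (unip l).val = !![1, (l : ℤ_[2]); 0, 1] := rfl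

/-- The matrix `(1 λ; 0 1)` in `G`. -/
def nG (l : ℤ) : G := ofK (unip l)

lemma nG_val (l : ℤ) : (nG l).val = !![1, (l : ℚ_[2]); 0, 1] := by
  ext i j
  fin_cases i <;> fin_cases j <;> simp [nG, ofK, unip_val]

lemma ga_val : ga.val = !![2, 0; 0, 1] := rfl
lemma gb_val : gb.val = !![2, 1; 0, 1] := rfl
lemma gc_val : gc.val = !![1, 0; 0, 2] := rfl
lemma ϖ_val_one : ϖ.val = !![2, 0; 0, 2] := rfl

lemma nG_zero : nG 0 = 1 := by
  apply Units.ext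
  rw [nG_val, Units.val_one, Matrix.one_fin_two]; simp

lemma nG_mul (j l : ℤ) : nG j * nG l = nG (j + l) := by
  apply Units.ext
  rw [Units.val_mul, nG_val, nG_val, nG_val]
  simp [add_comm]

lemma ga_mul_nG (l : ℤ) : ga * nG l = nG (2 * l) * ga := by
  apply Units.ext
  rw [Units.val_mul, Units.val_mul, nG_val, nG_val, ga_val]
  simp

lemma nG_mul_gc (l : ℤ) : nG l * gc = gc * nG (2 * l) := by
  apply Units.ext
  rw [Units.val_mul, Units.val_mul, nG_val, nG_val, gc_val]
  simp [mul_comm]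

lemma ga_mul_gc : ga * gc = ϖ := by
  apply Units.ext
  rw [Units.val_mul, ga_val, gc_val, ϖ_val_one]
  simp

lemma gb_eq : gb = nG 1 * ga := by
  apply Units.ext
  rw [Units.val_mul, ga_val, gb_val, nG_val]
  simp

/-- Up to a unipotent of K on the right, `nG l * ga` depends only on l modulo 2; the next lemma is
the analogue modulo 4. -/
lemma nG_mul_ga {l i j : ℤ} (h : l = 2 * j + i) : nG l * ga = nG i * ga * nG j := by
  rw [mul_assoc, ga_mul_nG, ← mul_assoc, nG_mul, add_comm, h]

lemma nG_mul_ga_mul_ga {l i j : ℤ} (h : l = 4 * j + i) :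
    nG l * ga * ga = nG i * ga * ga * nG j := by
  rw [nG_mul_ga (show l = 2 * (2 * j) + i by rw [h]; ring), mul_assoc, ← ga_mul_nG, ← mul_assoc]

section
variable {r : ℕ} {a : Q2bar}

lemma polyAct_unip_X0 (l : ℤ) : polyAct Z2bar (unip l).val (X 0) = X 0 := by
  simp [polyAct, unip_val, Fin.sum_univ_two]

lemma polyAct_unip_X1 (l : ℤ) : polyAct Z2bar (unip l).val (X 1) = (l : Poly Z2bar) * X 0 + X 1 := by
  simp [polyAct, unip_val, Fin.sum_univ_two]

lemma br_nG (h : G) (l : ℤ) (w : Poly Z2bar) :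
    br r a (h * nG l) w = br r a h (polyAct Z2bar (unip l).val w) := br_ofK h _ w

lemma hecke_br (h : G) (w : Poly Z2bar) (hw : w.IsHomogeneous r) : a • br r a h w =
    br r a (h * ga) (aeval ![X 0, 2 * X 1] w) +
      br r a (h * nG 1 * ga) (aeval ![X 0, 2 * X 1 - X 0] w) +
      br r a (h * gc) (aeval ![2 * X 0, X 1] w) := by
  rw [br_hecke h w hw, gb_eq, ← mul_assoc]
end

/-! ## The classes of monomials -/

section
variable (N : ℕ) (a : Q2bar)

/-- The class of `[h, X^{r-2} Y^2]`, where `r = 2N + 2`. -/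
def brM (h : G) : Ambient (2 * N + 2) a := br (2 * N + 2) a h (X 0 ^ (2 * N) * X 1 ^ 2)
/-- The class of `[h, X^{r-1} Y]`, where `r = 2N + 2`. -/
def brL (h : G) : Ambient (2 * N + 2) a := br (2 * N + 2) a h (X 0 ^ (2 * N + 1) * X 1)
/-- The class of `[h, X^r]`, where `r = 2N + 2`. -/
def brO (h : G) : Ambient (2 * N + 2) a := br (2 * N + 2) a h (X 0 ^ (2 * N + 2))
/-- The class of `[h, Y^r]`, where `r = 2N + 2`. -/
def brY (h : G) : Ambient (2 * N + 2) a := br (2 * N + 2) a h (X 1 ^ (2 * N + 2))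

variable {N a}

lemma br_quad (h : G) (w : Poly Z2bar) (c₂ c₁ c₀ : ℤ)
    (hw : w = (c₂ : Poly Z2bar) * (X 0 ^ (2 * N) * X 1 ^ 2) +
      (c₁ : Poly Z2bar) * (X 0 ^ (2 * N + 1) * X 1) + (c₀ : Poly Z2bar) * X 0 ^ (2 * N + 2)) :
    br (2 * N + 2) a h w = (c₂ : Q2bar) • brM N a h + (c₁ : Q2bar) • brL N a h +
      (c₀ : Q2bar) • brO N a h := by
  rw [hw, map_add, map_add, br_intCast_mul, br_intCast_mul, br_intCast_mul]; rfl

/-- The dependence on l is quadratic, hence killed by third differences. -/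
lemma brM_nG (h : G) (l : ℤ) : brM N a (h * nG l) =
    brM N a h + (2 * l : Q2bar) • brL N a h + (l ^ 2 : Q2bar) • brO N a h := by
  rw [brM, br_nG, br_quad h _ 1 (2 * l) (l ^ 2)]
  · push_cast; rw [one_smul]
  · simp only [map_mul, map_pow, polyAct_unip_X0, polyAct_unip_X1]
    push_cast; ring

lemma homog_M : (X 0 ^ (2 * N) * X 1 ^ 2 : Poly Z2bar).IsHomogeneous (2 * N + 2) :=
  (isHomogeneous_X_pow _ _).mul (isHomogeneous_X_pow _ _)
lemma homog_L : (X 0 ^ (2 * N + 1) * X 1 : Poly Z2bar).IsHomogeneous (2 * N + 2) :=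
  (isHomogeneous_X_pow _ _).mul (isHomogeneous_X _ _)
lemma homog_O (i : Fin 2) : (X i ^ (2 * N + 2) : Poly Z2bar).IsHomogeneous (2 * N + 2) :=
  isHomogeneous_X_pow _ _

lemma hecke_M (h : G) : a • brM N a h = (4 : Q2bar) • brM N a (h * ga) +
    br (2 * N + 2) a (h * nG 1 * ga) (X 0 ^ (2 * N) * (2 * X 1 - X 0) ^ 2) +
      (2 ^ (2 * N) : Q2bar) • brM N a (h * gc) := by
  rw [brM, hecke_br h _ homog_M]
  simp only [map_mul, map_pow, aeval_X, Matrix.cons_val_zero, Matrix.cons_val_one]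
  have e1 : (X 0 ^ (2 * N) * (2 * X 1) ^ 2 : Poly Z2bar) =
    ((4 : ℕ) : Poly Z2bar) * (X 0 ^ (2 * N) * X 1 ^ 2) := by push_cast; ring
  have e2 : ((2 * X 0) ^ (2 * N) * X 1 ^ 2 : Poly Z2bar) =
    ((2 ^ (2 * N) : ℕ) : Poly Z2bar) * (X 0 ^ (2 * N) * X 1 ^ 2) := by push_cast; ring
  rw [e1, e2, br_natCast_mul, br_natCast_mul]
  push_cast
  rfl

lemma hecke_Y (h : G) : a • brY N a h = (2 ^ (2 * N + 2) : Q2bar) • brY N a (h * ga) +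
    br (2 * N + 2) a (h * nG 1 * ga) ((2 * X 1 - X 0) ^ (2 * N + 2)) + brY N a (h * gc) := by
  rw [brY, hecke_br h _ (homog_O 1)]
  simp only [map_pow, aeval_X, Matrix.cons_val_zero, Matrix.cons_val_one]
  have e1 : ((2 * X 1) ^ (2 * N + 2) : Poly Z2bar) =
    ((2 ^ (2 * N + 2) : ℕ) : Poly Z2bar) * X 1 ^ (2 * N + 2) := by push_cast; ring
  rw [e1, br_natCast_mul]
  push_cast
  rfl

lemma hecke_O (h : G) : a • brO N a h = brO N a (h * ga) + brO N a (h * nG 1 * ga) +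
    (2 ^ (2 * N + 2) : Q2bar) • brO N a (h * gc) := by
  rw [brO, hecke_br h _ (homog_O 0)]
  simp only [map_pow, aeval_X, Matrix.cons_val_zero]
  have e1 : ((2 * X 0) ^ (2 * N + 2) : Poly Z2bar) =
    ((2 ^ (2 * N + 2) : ℕ) : Poly Z2bar) * X 0 ^ (2 * N + 2) := by push_cast; ring
  rw [e1, br_natCast_mul]
  push_cast
  rfl

lemma hecke_L (h : G) : a • brL N a h = (2 : Q2bar) • brL N a (h * ga) +
    ((2 : Q2bar) • brL N a (h * nG 1 * ga) - brO N a (h * nG 1 * ga)) +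
    (2 ^ (2 * N + 1) : Q2bar) • brL N a (h * gc) := by
  rw [brL, hecke_br h _ homog_L]
  simp only [map_mul, map_pow, aeval_X, Matrix.cons_val_zero, Matrix.cons_val_one]
  have e1 : (X 0 ^ (2 * N + 1) * (2 * X 1) : Poly Z2bar) =
    ((2 : ℕ) : Poly Z2bar) * (X 0 ^ (2 * N + 1) * X 1) := by push_cast; ring
  have e2 : ((2 * X 0) ^ (2 * N + 1) * X 1 : Poly Z2bar) =
    ((2 ^ (2 * N + 1) : ℕ) : Poly Z2bar) * (X 0 ^ (2 * N + 1) * X 1) := by push_cast; ring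
  rw [e1, e2, br_natCast_mul, br_natCast_mul, br_quad (h * nG 1 * ga) _ 0 2 (-1)]
  · push_cast
    rw [zero_smul, zero_add, neg_one_smul, ← sub_eq_add_neg]
    rfl
  · push_cast; ring

/-! ## Elements that become small -/

lemma norm_a {u : Q2bar} (hu : ‖u‖ = 1) : ‖2 * u‖ = 1 / 2 := by
  rw [norm_mul, hu, mul_one, norm_two_Q2bar]

lemma norm_two_pow (k : ℕ) : ‖(2 : Q2bar) ^ k‖ = (1 / 2) ^ k := by rw [norm_pow, norm_two_Q2bar]

lemma small_smul_of_two_mul {ρ : ℝ} (hρ : 0 < ρ) {c : Q2bar} (hc : ‖c‖ ≤ ρ) (h : G) (w : Poly Z2bar) :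
    Small ρ ((2 * c) • br r a h w : Ambient r a) := by
  refine small_smul_br h w ?_
  rw [norm_mul, norm_two_Q2bar]
  linarith

/-- Adding the T-expansions of X^r and X^(r-1) Y cancels the class of X^r at the coset with μ = 1.
The one with μ = 0 remains alone, every other term having a factor a or 2. -/
lemma small_brO {u : Q2bar} (ha : a = 2 * u) (hu : ‖u‖ = 1) (h : G) : Small 1 (brO N a h) := by
  have e : h = h * ga⁻¹ * ga := by group
  have hO := hecke_O (N := N) (a := a) (h * ga⁻¹)
  have hL := hecke_L (N := N) (a := a) (h * ga⁻¹)
  rw [← e] at hO hL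
  have key : brO N a h = (a • brO N a (h * ga⁻¹) + a • brL N a (h * ga⁻¹)) + (-2 : Q2bar) • brL N a h
      + (-2 : Q2bar) • brL N a (h * ga⁻¹ * nG 1 * ga)
      + (-2 ^ (2 * N + 2) : Q2bar) • brO N a (h * ga⁻¹ * gc)
      + (-2 ^ (2 * N + 1) : Q2bar) • brL N a (h * ga⁻¹ * gc) := by
    rw [hO, hL]; module
  have ha' : ‖a‖ < 1 := by rw [ha, norm_a hu]; norm_num
  have h2 : ‖(-2 : Q2bar)‖ < 1 := by rw [norm_neg, norm_two_Q2bar]; norm_num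
  have hp : ∀ m : ℕ, ‖(-2 ^ (m + 1) : Q2bar)‖ < 1 := fun m => by
    rw [norm_neg, norm_two_pow]; exact pow_lt_one₀ (by norm_num) (by norm_num) (by omega)
  rw [key]
  exact (((((small_smul_br _ _ ha').add (small_smul_br _ _ ha')).add (small_smul_br _ _ h2)).add
    (small_smul_br _ _ h2)).add (small_smul_br _ _ (hp _))).add (small_smul_br _ _ (hp _))

/-- The reduction of `(a / 2) [h, θ X^{r-3}]`. -/
lemma small_brE (hN : 1 ≤ N) {u : Q2bar} (ha : a = 2 * u) (hu : ‖u‖ = 1) (h : G) :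
    Small 1 (u • (brL N a h - brM N a h) - brL N a (h * ga) - brL N a (h * nG 1 * ga)) := by
  have hL := hecke_L (N := N) (a := a) h
  have hM := hecke_M (N := N) (a := a) h
  rw [br_quad (h * nG 1 * ga) _ 4 (-4) 1 (by push_cast; ring)] at hM
  push_cast at hM
  -- Since u = a/2, the T-expansions are halved. Each contributes -1/2 of the class of X^r, and
  -- these add up to an integral multiple.
  have key : u • (brL N a h - brM N a h) - brL N a (h * ga) - brL N a (h * nG 1 * ga) =
      (-2 : Q2bar) • brM N a (h * ga) + (-2 : Q2bar) • brM N a (h * nG 1 * ga) +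
      (2 : Q2bar) • brL N a (h * nG 1 * ga) + (-1 : Q2bar) • brO N a (h * nG 1 * ga) +
      (2 ^ (2 * N) : Q2bar) • brL N a (h * gc) + (-2 ^ (2 * N - 1) : Q2bar) • brM N a (h * gc) := by
    have e : u • (brL N a h - brM N a h) = (2⁻¹ : Q2bar) • (a • brL N a h - a • brM N a h) := by
      rw [ha]; module
    obtain ⟨M, rfl⟩ := Nat.exists_eq_add_of_le' hN
    rw [e, hL, hM, show 2 * (M + 1) - 1 = 2 * M + 1 by omega]
    module
  have h2 : ‖(2 : Q2bar)‖ < 1 := by rw [norm_two_Q2bar]; norm_num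
  have h2' : ‖(-2 : Q2bar)‖ < 1 := by rwa [norm_neg]
  have hp : ∀ m : ℕ, 1 ≤ m → ‖(2 ^ m : Q2bar)‖ < 1 := fun m hm => by
    rw [norm_two_pow]; exact pow_lt_one₀ (by norm_num) (by norm_num) (by omega)
  have hp' : ‖(-2 ^ (2 * N - 1) : Q2bar)‖ < 1 := by rw [norm_neg]; exact hp _ (by omega)
  rw [key]
  exact (((((small_smul_br _ _ h2').add (small_smul_br _ _ h2')).add (small_smul_br _ _ h2)).add
    ((small_brO ha hu _).unit_smul (by simp))).add (small_smul_br _ _ (hp _ (by omega)))).add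
    (small_smul_br _ _ hp')

/-- The class of `a⁻¹ [h (1 0; 0 2), Y^r] + [h, X^{r-2} Y²]`. -/
def brZ (N : ℕ) (a : Q2bar) (h : G) : Ambient (2 * N + 2) a := a⁻¹ • brY N a (h * gc) + brM N a h

/-- As `ga * gc` is the central `ϖ`, the Y^r part of a `brZ N a (h * ga)` is `brY N a h`. Its
T-expansion contains a⁻¹ `brY N a (h * gc)`, which is exactly the Y^r part of the left side. -/
lemma brZ_eq (ha : a ≠ 0) (h : G) : brZ N a h = a • brZ N a (h * ga) +
    (4 * a⁻¹ - a) • brM N a (h * ga) +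
    a⁻¹ • br (2 * N + 2) a (h * nG 1 * ga)
      (X 0 ^ (2 * N) * (2 * X 1 - X 0) ^ 2 - (2 * X 1 - X 0) ^ (2 * N + 2)) +
    (2 ^ (2 * N) * a⁻¹) • brM N a (h * gc) - (2 ^ (2 * N + 2) * a⁻¹) • brY N a (h * ga) := by
  have h1 : brM N a h = a⁻¹ • (a • brM N a h) := by rw [inv_smul_smul₀ ha]
  have h2 : a • brZ N a (h * ga) = brY N a h + a • brM N a (h * ga) := by
    rw [brZ, smul_add, smul_inv_smul₀ ha, mul_assoc, ga_mul_gc]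
    congr 1
    exact br_ϖ h _
  have h3 : brY N a h = a⁻¹ • (a • brY N a h) := by rw [inv_smul_smul₀ ha]
  rw [brZ, h1, h2, h3, hecke_M, hecke_Y, map_sub]
  module

end

lemma norm_natCast_of_odd {o : ℕ} (ho : Odd o) : ‖(o : Q2bar)‖ = 1 := by
  obtain ⟨j, rfl⟩ := ho
  have h : ‖(2 * j : Q2bar)‖ < 1 := by
    rw [norm_mul, norm_two_Q2bar]
    linarith [norm_natCast_le_one j]
  push_cast
  have h1 : ‖(1 : Q2bar)‖ = 1 := norm_one
  rw [IsUltrametricDist.norm_add_eq_max_of_norm_ne_norm (by rw [h1]; exact h.ne), h1]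
  exact max_eq_right h.le

/-! ### Smallness of `brZ` and its third difference -/

section
variable {N : ℕ} {a u : Q2bar} {k o : ℕ} {ρ : ℝ}

lemma four_mul_inv_sub (ha : a = 2 * u) (hu : ‖u‖ = 1) :
    4 * a⁻¹ - a = 2 * ((1 - u ^ 2) * u⁻¹) := by
  have hu0 : u ≠ 0 := norm_ne_zero_iff.1 (by rw [hu]; exact one_ne_zero)
  rw [ha]; field_simp; ring

lemma two_mul_add_one_le (hN : N = 2 ^ k * o) (ho : 1 ≤ o) : k + 1 ≤ N := by
  have : k < 2 ^ k := Nat.lt_two_pow_self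
  have : 2 ^ k ≤ N := by rw [hN]; exact Nat.le_mul_of_pos_right _ ho
  omega

lemma norm_two_pow_mul_inv_lt (hN : N = 2 ^ k * o) (ho : 1 ≤ o) (ha : a = 2 * u) (hu : ‖u‖ = 1)
    (hk : (1 / 2 : ℝ) ^ k ≤ ρ) {m : ℕ} (hm : 2 * N ≤ m) : ‖2 ^ m * a⁻¹‖ < ρ := by
  have h1 := two_mul_add_one_le hN ho
  rw [norm_mul, norm_inv, ha, norm_a hu, norm_two_pow]
  obtain ⟨j, rfl⟩ : ∃ j, m = k + 2 + j := ⟨m - (k + 2), by omega⟩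
  have : (1 / 2 : ℝ) ^ j ≤ 1 := pow_le_one₀ (by norm_num) (by norm_num)
  rw [pow_add, pow_add]
  have : 0 < (1 / 2 : ℝ) ^ k := by positivity
  nlinarith

/-- All errors in `brZ_eq` are below ρ: 4/a - a is 2(1 - u²)/u, the polynomial remainder is
divisible by 2^(k+2), losing only one factor 2 to a⁻¹, and 2N ≥ k + 2. -/
lemma brZ_sub_small (hN : N = 2 ^ k * o) (ho : 1 ≤ o) (ha : a = 2 * u) (hu : ‖u‖ = 1)
    (hk : (1 / 2 : ℝ) ^ k ≤ ρ) (hρ : ‖1 - u ^ 2‖ ≤ ρ) (h : G) :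
    Small ρ (brZ N a h - a • brZ N a (h * ga)) := by
  have ha0 : a ≠ 0 := norm_ne_zero_iff.1 (by rw [ha, norm_a hu]; norm_num)
  have hk0 : 0 < (1 / 2 : ℝ) ^ k := by positivity
  have hρ0 : 0 < ρ := hk0.trans_le hk
  obtain ⟨W, V, hW, -⟩ := exists_remainder (X 0 : Poly Z2bar) (X 1) k o ho
  rw [← hN] at hW
  have hR : (X 0 ^ (2 * N) * (2 * X 1 - X 0) ^ 2 - (2 * X 1 - X 0) ^ (2 * N + 2) : Poly Z2bar) =
      ((2 ^ (k + 2) : ℕ) : Poly Z2bar) *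
        (2 * W - (o : Poly Z2bar) * (X 0 ^ (2 * N) * X 1 ^ 2 - X 0 ^ (2 * N + 1) * X 1)) := by
    rw [hW]; push_cast; ring
  rw [sub_eq_iff_eq_add'.2 ((brZ_eq ha0 h).trans (by rw [add_assoc, add_assoc, add_sub_assoc])),
    four_mul_inv_sub ha hu, hR, br_natCast_mul, smul_smul]
  rw [← add_assoc]
  refine Small.sub (((small_smul_of_two_mul hρ0 ?_ _ _).add (small_smul_br _ _ ?_)).add
    (small_smul_br _ _ ?_)) (small_smul_br _ _ ?_)
  · rw [norm_mul, norm_inv, hu, inv_one, mul_one]; exact hρ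
  · push_cast
    rw [norm_mul, norm_inv, ha, norm_a hu, norm_two_pow, pow_add]
    nlinarith
  · exact norm_two_pow_mul_inv_lt hN ho ha hu hk le_rfl
  · exact norm_two_pow_mul_inv_lt hN ho ha hu hk (by omega)

/-- A contraction argument along h, h `ga`, h `ga`², and so on: each step multiplies the unknown
term by a, of norm 1/2, and adds an error below ρ. -/
lemma brZ_small (hN : N = 2 ^ k * o) (ho : 1 ≤ o) (ha : a = 2 * u) (hu : ‖u‖ = 1)
    (hk : (1 / 2 : ℝ) ^ k ≤ ρ) (hρ : ‖1 - u ^ 2‖ ≤ ρ) (h : G) : Small ρ (brZ N a h) := by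
  have hna : ‖a‖ = 1 / 2 := by rw [ha, norm_a hu]
  have hρ0 : 0 < ρ := lt_of_lt_of_le (by positivity) hk
  -- The constant 4 is a crude strict bound to start from, since |a⁻¹| = 2.
  have key : ∀ j : ℕ, ∀ h : G, Small (max ρ (4 * (1 / 2) ^ j)) (brZ N a h) := by
    intro j
    induction j with
    | zero =>
      intro h
      refine Small.mono (ρ := 4) (Small.add (small_smul_br _ _ ?_) ?_) (by simp)
      · rw [norm_inv, hna]; norm_num
      · have := small_smul_br (r := 2 * N + 2) (a := a) h (X 0 ^ (2 * N) * X 1 ^ 2) (c := 1)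
          (ρ := 4) (by rw [norm_one]; norm_num)
        rwa [one_smul] at this
    | succ j ih =>
      intro h
      have e : brZ N a h = (brZ N a h - a • brZ N a (h * ga)) + a • brZ N a (h * ga) := by abel
      rw [e]
      refine ((brZ_sub_small hN ho ha hu hk hρ h).mono (le_max_left _ _)).add
        ((ih _).smul (lt_max_of_lt_left hρ0) ?_)
      rw [hna, mul_max_of_nonneg _ _ (by norm_num), pow_succ]
      exact max_le_max (by linarith) (by linarith)
  obtain ⟨j, hj⟩ := exists_pow_lt_of_lt_one (show 0 < ρ / 4 by positivity)
    (show (1 / 2 : ℝ) < 1 by norm_num)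
  have := key j h
  rwa [max_eq_left (by linarith)] at this

/-- The third difference of a function at `-1, 0, 1, 2`. -/
def thirdDiff {M : Type} [AddCommGroup M] [Module Q2bar M] (f : ℤ → M) : M :=
  f (-1) - (3 : Q2bar) • f 0 + (3 : Q2bar) • f 1 - f 2

lemma nG_gc (l : ℤ) (w : Poly Z2bar) :
    br (2 * N + 2) a (nG l * gc) w = br _ a gc (polyAct Z2bar (unip (2 * l)).val w) := by
  rw [nG_mul_gc, br_nG]

/-- The X^(r-2) Y² part is quadratic in l and drops out. Moving `nG l` past `gc` turns Y^r into (Y +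
2lX)^r, to which `third_difference_pow` applies. -/
lemma thirdDiff_brZ (hN : N = 2 ^ k * o) (ho : 1 ≤ o) : ∃ W : Poly Z2bar,
    thirdDiff (fun l => brZ N a (nG l)) = (2 ^ (k + 4) * a⁻¹) • br (2 * N + 2) a gc W := by
  obtain ⟨W, hW⟩ := third_difference_pow (X 0 : Poly Z2bar) (X 1) k o ho
  refine ⟨W, ?_⟩
  rw [← hN] at hW
  have hY : ∀ l : ℤ, brY N a (nG l * gc) =
      br (2 * N + 2) a gc ((((2 * l : ℤ) : Poly Z2bar) * X 0 + X 1) ^ (2 * N + 2)) := by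
    intro l
    rw [brY, nG_gc, map_pow, polyAct_unip_X1]
  have hM : ∀ l : ℤ, brM N a (nG l) =
      brM N a 1 + (2 * l : Q2bar) • brL N a 1 + (l ^ 2 : Q2bar) • brO N a 1 := by
    intro l
    have := brM_nG (N := N) (a := a) 1 l
    rwa [one_mul] at this
  have hS := congrArg (br (2 * N + 2) a gc) hW
  have e3 : (3 : Poly Z2bar) = ((3 : ℕ) : Poly Z2bar) := by norm_num
  have e2 : (2 ^ (k + 4) : Poly Z2bar) = ((2 ^ (k + 4) : ℕ) : Poly Z2bar) := by push_cast; rfl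
  rw [map_sub, map_add, map_sub, e3, e2, br_natCast_mul, br_natCast_mul, br_natCast_mul] at hS
  push_cast at hS
  have p1 : ((2 * (-1) : ℤ) : Poly Z2bar) * X 0 + X 1 = X 1 - 2 * X 0 := by push_cast; ring
  have p2 : ((2 * 0 : ℤ) : Poly Z2bar) * X 0 + X 1 = X 1 := by push_cast; ring
  have p3 : ((2 * 1 : ℤ) : Poly Z2bar) * X 0 + X 1 = X 1 + 2 * X 0 := by push_cast; ring
  have p4 : ((2 * 2 : ℤ) : Poly Z2bar) * X 0 + X 1 = X 1 + 4 * X 0 := by push_cast; ring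
  simp only [thirdDiff, brZ, hY, hM, p1, p2, p3, p4]
  push_cast
  linear_combination (norm := module) a⁻¹ • hS

/-- One step of the expansion of the third difference. -/
lemma thirdDiff_brZ_step (ha : a ≠ 0) (g : ℤ → G) : thirdDiff (fun l => brZ N a (g l)) =
    a • thirdDiff (fun l => brZ N a (g l * ga)) +
    (4 * a⁻¹ - a) • thirdDiff (fun l => brM N a (g l * ga)) +
    a⁻¹ • thirdDiff (fun l => br (2 * N + 2) a (g l * nG 1 * ga)
      (X 0 ^ (2 * N) * (2 * X 1 - X 0) ^ 2 - (2 * X 1 - X 0) ^ (2 * N + 2))) +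
    (2 ^ (2 * N) * a⁻¹) • thirdDiff (fun l => brM N a (g l * gc)) -
    (2 ^ (2 * N + 2) * a⁻¹) • thirdDiff (fun l => brY N a (g l * ga)) := by
  simp only [thirdDiff]
  rw [brZ_eq ha (g (-1)), brZ_eq ha (g 0), brZ_eq ha (g 1), brZ_eq ha (g 2)]
  module

end

/-! ### Third differences collected on the cosets of `T` and `T²` -/

section
variable {N : ℕ} {a u : Q2bar} {k o : ℕ} {ρ : ℝ}

lemma thirdDiff_brM_gc : thirdDiff (fun l => brM N a (nG l * gc)) = 0 := by
  simp only [thirdDiff, nG_mul_gc, brM_nG]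
  push_cast
  module

lemma thirdDiff_brM_ga_gc : thirdDiff (fun l => brM N a (nG l * ga * gc)) = 0 := by
  have e : ∀ l : ℤ, brM N a (nG l * ga * gc) =
      brM N a 1 + (2 * l : Q2bar) • brL N a 1 + (l ^ 2 : Q2bar) • brO N a 1 := by
    intro l
    rw [mul_assoc, ga_mul_gc, ← brM_nG, one_mul]
    exact br_ϖ _ _
  simp only [thirdDiff, e]
  push_cast
  module

/-- The four terms fall on two cosets, according to the parity of l. -/
lemma thirdDiff_brM_ga : thirdDiff (fun l => brM N a (nG l * ga)) =
    (4 : Q2bar) • (brM N a (nG 1 * ga) - brM N a ga) -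
      (2 : Q2bar) • (brL N a (nG 1 * ga) + brL N a ga) +
      (brO N a (nG 1 * ga) - brO N a ga) := by
  have e1 : nG (-1) * ga = nG 1 * ga * nG (-1) := nG_mul_ga (by norm_num)
  have e2 : nG 2 * ga = ga * nG 1 := by
    rw [nG_mul_ga (show (2 : ℤ) = 2 * 1 + 0 by norm_num), nG_zero, one_mul]
  simp only [thirdDiff, e1, e2, nG_zero, one_mul, brM_nG]
  push_cast
  module

lemma thirdDiff_brM_ga_ga : thirdDiff (fun l => brM N a (nG l * ga * ga)) =
    brM N a (nG 3 * ga * ga) - (2 : Q2bar) • brL N a (nG 3 * ga * ga) + brO N a (nG 3 * ga * ga) -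
      (3 : Q2bar) • brM N a (nG 0 * ga * ga) + (3 : Q2bar) • brM N a (nG 1 * ga * ga) -
      brM N a (nG 2 * ga * ga) := by
  have e1 : nG (-1) * ga * ga = nG 3 * ga * ga * nG (-1) := nG_mul_ga_mul_ga (by norm_num)
  simp only [thirdDiff, e1, brM_nG]
  push_cast
  module

/-- The polynomial `X^{r-2} (2Y - X)² - (2Y - X)^r` with `r = 2N + 2`. -/
def remPoly (N : ℕ) : Poly Z2bar :=
  X 0 ^ (2 * N) * (2 * X 1 - X 0) ^ 2 - (2 * X 1 - X 0) ^ (2 * N + 2)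

/-- The translate by `nG 1` is also needed, because cosets repeat with a unipotent shift when third
differences are collected. -/
lemma br_remPoly (hN : N = 2 ^ k * o) (ho : 1 ≤ o) : ∃ W V : Poly Z2bar, ∀ h : G,
    br (2 * N + 2) a h (remPoly N) = (-(4 * N) : Q2bar) • (brM N a h - brL N a h) +
      (2 ^ (k + 3) : Q2bar) • br (2 * N + 2) a h W ∧
    br (2 * N + 2) a (h * nG 1) (remPoly N) = (-(4 * N) : Q2bar) • (brM N a h + brL N a h) +
      (2 ^ (k + 3) : Q2bar) • (br (2 * N + 2) a h W + (2 : Q2bar) • br (2 * N + 2) a h V) := by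
  obtain ⟨W, V, hW, hV⟩ := exists_remainder (X 0 : Poly Z2bar) (X 1) k o ho
  refine ⟨W, V, fun h => ?_⟩
  have hc : (-(4 * (2 ^ k * o)) : Poly Z2bar) = ((-(4 * N) : ℤ) : Poly Z2bar) := by
    rw [hN]; push_cast; ring
  have h2 : (2 ^ (k + 3) : Poly Z2bar) = ((2 ^ (k + 3) : ℕ) : Poly Z2bar) := by push_cast; ring
  have h2' : (2 : Poly Z2bar) = ((2 : ℕ) : Poly Z2bar) := by norm_num
  rw [hc, ← hN, h2] at hW hV
  constructor
  · rw [remPoly, hW, map_add, br_intCast_mul, br_natCast_mul, map_sub]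
    push_cast
    rfl
  · have e : polyAct Z2bar (unip 1).val (remPoly N) =
        X 0 ^ (2 * N) * (2 * X 1 + X 0) ^ 2 - (2 * X 1 + X 0) ^ (2 * N + 2) := by
      have e1 : (2 * (((1 : ℤ) : Poly Z2bar) * X 0 + X 1) - X 0 : Poly Z2bar) = 2 * X 1 + X 0 := by
        push_cast; ring
      simp only [remPoly, map_sub, map_mul, map_pow, map_ofNat, polyAct_unip_X0, polyAct_unip_X1, e1]
    have e2 : br (2 * N + 2) a h (2 * V) = (2 : Q2bar) • br (2 * N + 2) a h V := by
      rw [h2', br_natCast_mul]; push_cast; rfl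
    rw [br_nG, e, hV, map_add, br_intCast_mul, br_natCast_mul, map_add, map_add, e2]
    push_cast
    rfl

/-- On each of the two cosets a remainder and its translate meet with weights 1 and 3 up to sign.
Their errors agree modulo 2, so the total gains a factor 2. This is needed because the result is
later multiplied by a⁻¹. -/
lemma thirdDiff_remPoly_ga (hN : N = 2 ^ k * o) (ho : 1 ≤ o) : ∃ W W' : Poly Z2bar,
    thirdDiff (fun l => br (2 * N + 2) a (nG l * nG 1 * ga) (remPoly N)) =
      (-(8 * N) : Q2bar) • (brL N a ga + brL N a (nG 1 * ga)) +
      (2 ^ (k + 4) : Q2bar) • (br (2 * N + 2) a ga W + br (2 * N + 2) a (nG 1 * ga) W') := by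
  obtain ⟨W, V, h⟩ := br_remPoly (a := a) hN ho
  have e0 : nG (-1) * nG 1 * ga = ga := by rw [nG_mul]; norm_num [nG_zero]
  have e1 : nG 0 * nG 1 * ga = nG 1 * ga := by rw [nG_zero, one_mul]
  have e2 : nG 1 * nG 1 * ga = ga * nG 1 := by
    rw [nG_mul, nG_mul_ga (show (1 + 1 : ℤ) = 2 * 1 + 0 by norm_num), nG_zero, one_mul]
  have e3 : nG 2 * nG 1 * ga = nG 1 * ga * nG 1 := by
    rw [nG_mul]; exact nG_mul_ga (by norm_num)
  -- The terms with o absorb the contribution 16N of X^(r-2) Y², as 16N = 2^(k+4) o.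
  refine ⟨2 • W + 3 • V - o • (X 0 ^ (2 * N) * X 1 ^ 2),
    -(2 • W) - V + o • (X 0 ^ (2 * N) * X 1 ^ 2), ?_⟩
  simp only [thirdDiff, e0, e1, e2, e3, (h ga).1, (h ga).2, (h (nG 1 * ga)).1,
    (h (nG 1 * ga)).2, map_add, map_sub, map_nsmul, map_neg]
  simp only [← Nat.cast_smul_eq_nsmul Q2bar]
  change _ = (-(8 * N) : Q2bar) • (brL N a ga + brL N a (nG 1 * ga)) + (2 ^ (k + 4) : Q2bar) •
    (_ + _ - (o : Q2bar) • brM N a ga + (_ - _ + (o : Q2bar) • brM N a (nG 1 * ga)))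
  have hc : (N : Q2bar) = 2 ^ k * o := by rw [hN]; push_cast; ring
  rw [hc]
  push_cast
  module

/-- The precision 2^(k+3) is enough here: in the second expansion the factor a⁻¹ is compensated by
the a of the first. -/
lemma thirdDiff_remPoly_ga_ga (hN : N = 2 ^ k * o) (ho : 1 ≤ o) : ∃ W V : Poly Z2bar,
    thirdDiff (fun l => br (2 * N + 2) a (nG l * ga * nG 1 * ga) (remPoly N)) =
      (-(4 * N) : Q2bar) • (brM N a (nG 1 * ga * ga) - brL N a (nG 1 * ga * ga) -
        (3 : Q2bar) • (brM N a (nG 2 * ga * ga) - brL N a (nG 2 * ga * ga)) +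
        (3 : Q2bar) • (brM N a (nG 3 * ga * ga) - brL N a (nG 3 * ga * ga)) -
        (brM N a (nG 0 * ga * ga) + brL N a (nG 0 * ga * ga))) +
      (2 ^ (k + 3) : Q2bar) • (br (2 * N + 2) a (nG 1 * ga * ga) W -
        (3 : Q2bar) • br (2 * N + 2) a (nG 2 * ga * ga) W +
        (3 : Q2bar) • br (2 * N + 2) a (nG 3 * ga * ga) W -
        br (2 * N + 2) a (nG 0 * ga * ga) V) := by
  obtain ⟨W, V, h⟩ := br_remPoly (a := a) hN ho
  have e : ∀ l : ℤ, nG l * ga * nG 1 * ga = nG (l + 2) * ga * ga := by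
    intro l
    rw [← nG_mul_ga (show l + 2 = 2 * 1 + l by ring)]
  have e0 : nG (-1 + 2) * ga * ga = nG 1 * ga * ga := by norm_num
  have e1 : nG (0 + 2) * ga * ga = nG 2 * ga * ga := by norm_num
  have e2 : nG (1 + 2) * ga * ga = nG 3 * ga * ga := by norm_num
  have e3 : nG (2 + 2) * ga * ga = nG 0 * ga * ga * nG 1 := nG_mul_ga_mul_ga (by norm_num)
  refine ⟨W, W + 2 • V, ?_⟩
  simp only [thirdDiff, e, e0, e1, e2, e3, (h (nG 0 * ga * ga)).2, (h (nG 1 * ga * ga)).1,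
    (h (nG 2 * ga * ga)).1, (h (nG 3 * ga * ga)).1, map_add, map_nsmul]
  simp only [← Nat.cast_smul_eq_nsmul Q2bar]
  push_cast
  module

end

/-! ### The relation between `E`, `TE` and `T²E` -/

section
variable {N : ℕ} {a u : Q2bar} {k o : ℕ} {ρ : ℝ}

lemma Small.thirdDiff {f : ℤ → Ambient (2 * N + 2) a} (h : ∀ l, Small ρ (f l)) :
    Small ρ (thirdDiff f) := by
  have h3 : ‖(3 : Q2bar)‖ ≤ 1 := by
    have := norm_natCast_le_one 3; push_cast at this; exact this
  exact (((h _).sub ((h _).unit_smul h3)).add ((h _).unit_smul h3)).sub (h _)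

/-- The class of `[h, θ X^{r-3}]`, where `r = 2N + 2`. -/
def brE (N : ℕ) (a : Q2bar) (h : G) : Ambient (2 * N + 2) a := brL N a h - brM N a h

/-- The relation coming from the third difference of `brZ`. -/
lemma exists_small_relation (hN : N = 2 ^ k * o) (ho : 1 ≤ o) (ha : a = 2 * u) (hu : ‖u‖ = 1)
    (hk : (1 / 2 : ℝ) ^ k ≤ ρ) (hρ : ‖1 - u ^ 2‖ ≤ ρ) :
    Small ρ ((u ^ 2 - 1) • thirdDiff (fun l => brM N a (nG l * ga * ga)) +
      (N : Q2bar) • (brM N a (nG 1 * ga * ga) - brL N a (nG 1 * ga * ga) -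
        (3 : Q2bar) • (brM N a (nG 2 * ga * ga) - brL N a (nG 2 * ga * ga)) +
        (3 : Q2bar) • (brM N a (nG 3 * ga * ga) - brL N a (nG 3 * ga * ga)) -
        (brM N a (nG 0 * ga * ga) + brL N a (nG 0 * ga * ga))) +
      ((u ^ 2 - 1) * u⁻¹ * 2⁻¹) • thirdDiff (fun l => brM N a (nG l * ga)) +
      (N * u⁻¹) • (brL N a ga + brL N a (nG 1 * ga))) := by
  subst ha
  have hu0 : u ≠ 0 := norm_ne_zero_iff.1 (by rw [hu]; exact one_ne_zero)
  have ha0 : 2 * u ≠ 0 := norm_ne_zero_iff.1 (by rw [norm_a hu]; norm_num)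
  have hk0 : 0 < (1 / 2 : ℝ) ^ k := by positivity
  have hρ0 : 0 < ρ := hk0.trans_le hk
  have hai : (2 * u)⁻¹ = u⁻¹ * 2⁻¹ := by rw [mul_inv, mul_comm]
  obtain ⟨W, h0⟩ := thirdDiff_brZ (a := 2 * u) hN ho
  obtain ⟨W1, W1', hR1⟩ := thirdDiff_remPoly_ga (a := 2 * u) hN ho
  obtain ⟨W2, W2', hR2⟩ := thirdDiff_remPoly_ga_ga (a := 2 * u) hN ho
  have h1 := thirdDiff_brZ_step (N := N) ha0 nG
  have h2 := thirdDiff_brZ_step (N := N) ha0 (fun l => nG l * ga)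
  simp only [← remPoly.eq_def] at h1 h2
  rw [thirdDiff_brM_gc, hR1, h0] at h1
  rw [thirdDiff_brM_ga_gc, hR2] at h2
  have hw : u * u⁻¹ = 1 := mul_inv_cancel₀ hu0
  rw [h2, hai] at h1
  set Z := thirdDiff (fun l => brZ N (2 * u) (nG l * ga * ga))
  set Y := thirdDiff (fun l => brY N (2 * u) (nG l * ga))
  set Y' := thirdDiff (fun l => brY N (2 * u) (nG l * ga * ga))
  set M := thirdDiff (fun l => brM N (2 * u) (nG l * ga * ga))
  set M' := thirdDiff (fun l => brM N (2 * u) (nG l * ga))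
  set S2 := br (2 * N + 2) (2 * u) (nG 1 * ga * ga) W2 -
        (3 : Q2bar) • br (2 * N + 2) (2 * u) (nG 2 * ga * ga) W2 +
        (3 : Q2bar) • br (2 * N + 2) (2 * u) (nG 3 * ga * ga) W2 -
        br (2 * N + 2) (2 * u) (nG 0 * ga * ga) W2'
  set S1 := br (2 * N + 2) (2 * u) ga W1 + br (2 * N + 2) (2 * u) (nG 1 * ga) W1'
  set B := brM N (2 * u) (nG 1 * ga * ga) - brL N (2 * u) (nG 1 * ga * ga) -
        (3 : Q2bar) • (brM N (2 * u) (nG 2 * ga * ga) - brL N (2 * u) (nG 2 * ga * ga)) +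
        (3 : Q2bar) • (brM N (2 * u) (nG 3 * ga * ga) - brL N (2 * u) (nG 3 * ga * ga)) -
        (brM N (2 * u) (nG 0 * ga * ga) + brL N (2 * u) (nG 0 * ga * ga))
  -- A quarter of the identity obtained by inserting the second expansion into the first. The right
  -- side collects what is below ρ; there a²/4 = u² multiplies the third difference of `brZ`, which
  -- is small by `brZ_small`.
  have key : (u ^ 2 - 1) • M + (N : Q2bar) • B + ((u ^ 2 - 1) * u⁻¹ * 2⁻¹) • M' +
      (N * u⁻¹) • (brL N (2 * u) ga + brL N (2 * u) (nG 1 * ga)) =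
      (-(2 ^ (k + 1) * u⁻¹)) • br (2 * N + 2) (2 * u) gc W + (u ^ 2) • Z + (2 ^ (k + 1) : Q2bar) • S2 +
      (2 ^ (k + 1) * u⁻¹) • S1 - (2 ^ (2 * N) : Q2bar) • Y' - (2 ^ (2 * N) * (2 * u)⁻¹) • Y := by
    rw [hai]
    linear_combination (norm := module) (1 / 4 : Q2bar) • h1 + hw • M - (N * hw) • B +
      (u / 2 * hw) • M' + (2 ^ (k + 1) * hw) • S2 - (2 ^ (2 * N) * hw) • Y'
  have h3 : ‖(3 : Q2bar)‖ ≤ 1 := by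
    have := norm_natCast_le_one 3; push_cast at this; exact this
  have hk1 : ‖(2 ^ (k + 1) : Q2bar)‖ < ρ := by rw [norm_two_pow, pow_succ]; linarith
  have hk1' : ‖2 ^ (k + 1) * u⁻¹‖ < ρ := by rw [norm_mul, norm_inv, hu, inv_one, mul_one]; exact hk1
  have hN1 : ‖2 ^ (2 * N) * (2 * u)⁻¹‖ < ρ := norm_two_pow_mul_inv_lt hN ho rfl hu hk le_rfl
  have hN2 : ‖(2 ^ (2 * N) : Q2bar)‖ < ρ := by
    have : (2 ^ (2 * N) : Q2bar) = 2 * u * (2 ^ (2 * N) * (2 * u)⁻¹) := by field_simp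
    rw [this, norm_mul, norm_a hu]
    linarith [norm_nonneg (2 ^ (2 * N) * (2 * u)⁻¹)]
  have hu2 : ‖u ^ 2‖ ≤ 1 := by rw [norm_pow, hu, one_pow]
  rw [key]
  refine Small.sub (Small.sub (Small.add (Small.add (Small.add ?_ ?_) ?_) ?_) ?_) ?_
  · exact small_smul_br _ _ (by rwa [norm_neg])
  · exact (Small.thirdDiff fun l => brZ_small hN ho rfl hu hk hρ _).unit_smul hu2
  · simp only [S2, smul_add, smul_sub, smul_comm (2 ^ (k + 1) : Q2bar) (3 : Q2bar)]
    exact (((small_smul_br _ _ hk1).sub ((small_smul_br _ _ hk1).unit_smul h3)).add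
      ((small_smul_br _ _ hk1).unit_smul h3)).sub (small_smul_br _ _ hk1)
  · rw [smul_add]
    exact (small_smul_br _ _ hk1').add (small_smul_br _ _ hk1')
  · have : (2 ^ (2 * N) : Q2bar) • Y' =
        thirdDiff (fun l => (2 ^ (2 * N) : Q2bar) • brY N (2 * u) (nG l * ga * ga)) := by
      simp only [Y', thirdDiff]; module
    rw [this]
    exact Small.thirdDiff fun l => small_smul_br _ _ hN2
  · have : (2 ^ (2 * N) * (2 * u)⁻¹) • Y =
        thirdDiff (fun l => (2 ^ (2 * N) * (2 * u)⁻¹) • brY N (2 * u) (nG l * ga)) := by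
      simp only [Y, thirdDiff]; module
    rw [this]
    exact Small.thirdDiff fun l => small_smul_br _ _ hN1

/-- The class of `T [1, θ X^{r-3}]`, where `r = 2N + 2`. -/
def brTE (N : ℕ) (a : Q2bar) : Ambient (2 * N + 2) a := brE N a ga + brE N a (nG 1 * ga)

/-- The class of `T² [1, θ X^{r-3}]`, where `r = 2N + 2`. -/
def brTTE (N : ℕ) (a : Q2bar) : Ambient (2 * N + 2) a := brE N a (nG 0 * ga * ga) +
  brE N a (nG 1 * ga * ga) + brE N a (nG 2 * ga * ga) + brE N a (nG 3 * ga * ga)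

/-- The hypothesis on α is its definition, as binom(r, 2) = (1 + N)(1 + 2N). Taking ρ to be the
larger of |α| and |N| gives the two cases of the theorem. -/
lemma brE_relation (hN : N = 2 ^ k * o) (ho : Odd o) (ha : a = 2 * u) (hu : ‖u‖ = 1) {α : Q2bar}
    (hα : u * α = u ^ 2 - (1 + N) * (1 + 2 * N)) (hNρ : ‖(N : Q2bar)‖ ≤ ρ) (hαρ : ‖α‖ ≤ ρ) :
    Small ρ (α • (brE N a 1 + brTTE N a - u • brTE N a) + (N : Q2bar) • brTE N a) := by
  have hu0 : u ≠ 0 := norm_ne_zero_iff.1 (by rw [hu]; exact one_ne_zero)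
  have ho1 : 1 ≤ o := ho.pos
  have hN1 : 1 ≤ N := by have := two_mul_add_one_le hN ho1; omega
  have hk : (1 / 2 : ℝ) ^ k ≤ ρ := by
    have : ‖(N : Q2bar)‖ = (1 / 2) ^ k := by
      rw [hN]; push_cast; rw [norm_mul, norm_two_pow, norm_natCast_of_odd ho, mul_one]
    rwa [← this]
  have hρ0 : 0 < ρ := lt_of_lt_of_le (by positivity) hk
  have hadd : ∀ x y : Q2bar, ‖x‖ ≤ ρ → ‖y‖ ≤ ρ → ‖x + y‖ ≤ ρ := fun x y hx hy =>
    (IsUltrametricDist.norm_add_le_max x y).trans (max_le hx hy)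
  have hmul : ∀ c x : Q2bar, ‖c‖ ≤ 1 → ‖x‖ ≤ ρ → ‖c * x‖ ≤ ρ := fun c x hc hx => by
    rw [norm_mul]; exact (mul_le_of_le_one_left (norm_nonneg _) hc).trans hx
  have hint : ∀ m : ℤ, ‖(m : Q2bar)‖ ≤ 1 := norm_intCast_le_one
  have hNn : ‖(N : Q2bar)‖ ≤ 1 := norm_natCast_le_one N
  have hwn : ‖u⁻¹‖ = 1 := by rw [norm_inv, hu, inv_one]
  have hw : u * u⁻¹ = 1 := mul_inv_cancel₀ hu0
  -- coefficients
  have hcomb : ∀ (l m n : ℤ), ‖(l * u * α + m * N + n * N * N : Q2bar)‖ ≤ ρ := by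
    intro l m n
    refine hadd _ _ (hadd _ _ (hmul _ _ ?_ hαρ) (hmul _ _ (hint m) hNρ)) (hmul _ _ ?_ hNρ)
    · rw [norm_mul, hu, mul_one]; exact hint l
    · rw [norm_mul]; exact mul_le_one₀ (hint n) (norm_nonneg _) hNn
  -- The definition of α gives u² - 1 = uα + 3N + 2N², so the bounds on α and N also supply the
  -- bound required by `brZ_small`.
  have hγ : ‖u ^ 2 - 1‖ ≤ ρ := by
    have : u ^ 2 - 1 = ((1 : ℤ) * u * α + (3 : ℤ) * N + (2 : ℤ) * N * N : Q2bar) := by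
      push_cast; linear_combination -hα
    rw [this]; exact hcomb 1 3 2
  have hρ : ‖1 - u ^ 2‖ ≤ ρ := by rwa [norm_sub_rev]
  have hrel := exists_small_relation hN ho1 ha hu hk hρ
  rw [thirdDiff_brM_ga_ga, thirdDiff_brM_ga] at hrel
  have e0 := small_brE hN1 ha hu (1 : G)
  have eA := small_brE hN1 ha hu (ga : G)
  have eB := small_brE hN1 ha hu (nG 1 * ga : G)
  rw [one_mul, one_mul] at e0
  have v2 : ga * nG 1 * ga = nG 2 * ga * ga := by rw [ga_mul_nG]; norm_num
  have v3 : nG 1 * ga * nG 1 * ga = nG 3 * ga * ga := by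
    rw [← nG_mul_ga (show (3 : ℤ) = 2 * 1 + 1 by norm_num)]
  have v0 : ga * ga = nG 0 * ga * ga := by rw [nG_zero, one_mul]
  rw [v2, v0] at eA
  rw [v3] at eB
  -- The relation contains this difference with coefficient (u² - 1)/(2u), so `small_brO` does not
  -- suffice. Half of the T-expansion of [1, X^r] recovers the lost factor 2.
  have hO : Small 1 ((2⁻¹ : Q2bar) • (brO N a (nG 1 * ga) - brO N a ga)) := by
    have h := hecke_O (N := N) (a := a) 1
    simp only [one_mul] at h
    have e : (2⁻¹ : Q2bar) • (brO N a (nG 1 * ga) - brO N a ga) = u • brO N a 1 - brO N a ga -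
        (2 ^ (2 * N + 1) : Q2bar) • brO N a gc := by
      linear_combination (norm := (rw [ha]; module)) (-2⁻¹ : Q2bar) • h
    rw [e]
    refine (((small_brO ha hu _).unit_smul hu.le).sub (small_brO ha hu _)).sub
      (small_smul_br _ _ ?_)
    rw [norm_two_pow]; exact pow_lt_one₀ (by norm_num) (by norm_num) (by omega)
  refine Small.of_smul (c := u) hu0 ?_
  rw [hu, one_mul]
  have hγ' : u ^ 2 - 1 = u * α + 3 * N + 2 * N * N := by linear_combination -hα
  obtain ⟨β, hβ⟩ : ∃ β : Q2bar, β = (N : Q2bar) := ⟨_, rfl⟩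
  rw [← hβ] at hrel hα hγ' hNρ hNn hcomb ⊢
  set w := u⁻¹
  simp only [brTE, brTTE, brE] at e0 eA eB ⊢
  set M0 := brM N a (nG 0 * ga * ga) with hM0
  set M1 := brM N a (nG 1 * ga * ga) with hM1
  set M2 := brM N a (nG 2 * ga * ga) with hM2
  set M3 := brM N a (nG 3 * ga * ga) with hM3
  set L0 := brL N a (nG 0 * ga * ga) with hL0
  set L1 := brL N a (nG 1 * ga * ga) with hL1
  set L2 := brL N a (nG 2 * ga * ga) with hL2
  set L3 := brL N a (nG 3 * ga * ga) with hL3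
  set MA := brM N a ga with hMA
  set MB := brM N a (nG 1 * ga) with hMB
  set LA := brL N a ga with hLA
  set LB := brL N a (nG 1 * ga) with hLB
  set d := (2⁻¹ : Q2bar) • (brO N a (nG 1 * ga) - brO N a ga) with hd
  set R := (u ^ 2 - 1) • (M3 - (2 : Q2bar) • L3 + brO N a (nG 3 * ga * ga) - (3 : Q2bar) • M0 +
        (3 : Q2bar) • M1 - M2) + β • (M1 - L1 - (3 : Q2bar) • (M2 - L2) +
        (3 : Q2bar) • (M3 - L3) - (M0 + L0)) + ((u ^ 2 - 1) * w * 2⁻¹) •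
        ((4 : Q2bar) • (MB - MA) - (2 : Q2bar) • (LB + LA) + (brO N a (nG 1 * ga) - brO N a ga)) +
        (β * w) • (LA + LB) with hR
  set f0 := u • (brL N a 1 - brM N a 1) - LA - LB with hf0
  set fA := u • (LA - MA) - L0 - L2 with hfA
  set fB := u • (LB - MB) - L1 - L3 with hfB
  -- Up to even multiples of quantities bounded by ρ, signs do not matter and u² - 1 is uα + β. So
  -- `R` becomes uα ΣM + β ΣL + α(`LA` + `LB`), apart from classes of X^r. On the left, `f0`, `fA`
  -- and `fB` replace u times the classes E by sums of L, which gives the same expression. The even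
  -- coefficients are listed explicitly.
  have key : u • (α • (brL N a 1 - brM N a 1 + (L0 - M0 + (L1 - M1) + (L2 - M2) + (L3 - M3)) -
      u • (LA - MA + (LB - MB))) + β • (LA - MA + (LB - MB))) =
      R + (2 * (((1 : ℤ) : Q2bar) * u * α + ((5 : ℤ) : Q2bar) * β + ((3 : ℤ) : Q2bar) * β * β)) • M0
      + (2 * (((-2 : ℤ) : Q2bar) * u * α + ((-5 : ℤ) : Q2bar) * β + ((-3 : ℤ) : Q2bar) * β * β)) • M1
      + (2 * (((0 : ℤ) : Q2bar) * u * α + ((3 : ℤ) : Q2bar) * β + ((1 : ℤ) : Q2bar) * β * β)) • M2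
      + (2 * (((-1 : ℤ) : Q2bar) * u * α + ((-3 : ℤ) : Q2bar) * β + ((-1 : ℤ) : Q2bar) * β * β)) • M3
      + (2 * β) • L0 + (2 * β) • L1 + (2 * (-1 * β)) • L2 + (2 * (u ^ 2 - 1 + 2 * β)) • L3
      + (2 * (α + (1 + β) * w * β)) • LA + (2 * (α + (1 + β) * w * β)) • LB
      + (2 * (w * (u ^ 2 - 1))) • MA + (2 * (-w * (u ^ 2 - 1))) • MB
      - (u ^ 2 - 1) • brO N a (nG 3 * ga * ga) - (w * (u ^ 2 - 1)) • d
      + α • f0 + (β - u * α) • fA + (β - u * α) • fB := by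
    rw [hd, hf0, hfA, hfB, hR]
    push_cast
    linear_combination (norm := module) (3 * hγ') • M0 - (3 * hγ') • M1 + hγ' • M2 - hγ' • M3 +
      (w * hγ' + α * hw) • (LA + LB)
  rw [key]
  have hu1 : ‖u‖ ≤ 1 := hu.le
  have h2n : ‖(2 : Q2bar)‖ ≤ 1 := by rw [norm_two_Q2bar]; norm_num
  have hL : ‖α + (1 + β) * w * β‖ ≤ ρ := by
    refine hadd _ _ hαρ (hmul _ _ ?_ hNρ)
    rw [norm_mul, hwn, mul_one]
    have := norm_natCast_le_one (1 + N)
    push_cast at this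
    rwa [hβ]
  have hwγ : ‖w * (u ^ 2 - 1)‖ ≤ ρ := hmul _ _ hwn.le hγ
  have hwγ' : ‖-w * (u ^ 2 - 1)‖ ≤ ρ := hmul _ _ (by rw [norm_neg]; exact hwn.le) hγ
  have hone : ∀ {v : Ambient (2 * N + 2) a} {c : Q2bar}, Small 1 v → ‖c‖ ≤ ρ → Small ρ (c • v) :=
    fun hv hc => hv.smul hρ0 (by rwa [mul_one])
  have hβα : ‖β - u * α‖ ≤ ρ := by
    rw [sub_eq_add_neg, ← neg_mul]
    exact hadd _ _ hNρ (hmul _ _ (by rw [norm_neg]; exact hu1) hαρ)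
  have hs : ∀ {c : Q2bar}, ‖c‖ ≤ ρ → ∀ h w, Small ρ ((2 * c) • br (2 * N + 2) a h w) :=
    fun hc h w => small_smul_of_two_mul hρ0 hc h w
  refine ((((((((((((((((hrel.add (hs ?_ _ _)).add (hs ?_ _ _)).add (hs ?_ _ _)).add
    (hs ?_ _ _)).add (hs ?_ _ _)).add (hs ?_ _ _)).add (hs ?_ _ _)).add (hs ?_ _ _)).add
    (hs ?_ _ _)).add (hs ?_ _ _)).add (hs ?_ _ _)).add (hs ?_ _ _)).sub
    (hone (small_brO ha hu _) hγ)).sub (hone hO hwγ)).add (hone e0 hαρ)).add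
    (hone eA hβα)).add (hone eB hβα)
  · exact hcomb _ _ _
  · exact hcomb _ _ _
  · exact hcomb _ _ _
  · exact hcomb _ _ _
  · exact hNρ
  · exact hNρ
  · exact hmul _ _ (by simp) hNρ
  · exact hadd _ _ hγ (hmul _ _ h2n hNρ)
  · exact hL
  · exact hL
  · exact hwγ
  · exact hwγ'

end

/-! ## The action of `K` modulo `2` -/

lemma two_eq_zero : (2 : F2bar) = 0 := by
  have h := (residue_eq_zero_iff 2).2 (by
    have : ((2 : Z2bar) : Q2bar) = 2 := rfl
    rw [this, norm_two_Q2bar]; norm_num)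
  rwa [map_ofNat] at h

lemma two_eq_zero_poly : (2 : Poly F2bar) = 0 := by
  have := congrArg (C (σ := Fin 2)) two_eq_zero
  rwa [map_ofNat, map_zero] at this

/-- Thus K acts modulo 2 through matrices with entries 0 and 1, and invariance can be checked by
cases. -/
lemma algebraMap_eq_zero_or_one (x : ℤ_[2]) :
    algebraMap ℤ_[2] F2bar x = 0 ∨ algebraMap ℤ_[2] F2bar x = 1 := by
  obtain ⟨n, hn, hx⟩ := PadicInt.exists_mem_range (p := 2) x
  rw [PadicInt.maximalIdeal_eq_span_p, Ideal.mem_span_singleton] at hx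
  obtain ⟨y, hy⟩ := hx
  have : algebraMap ℤ_[2] F2bar x = n := by
    rw [sub_eq_iff_eq_add.1 hy, map_add, map_mul, map_natCast, map_natCast]
    rw [Nat.cast_ofNat, two_eq_zero, zero_mul, zero_add]
  rw [this]
  interval_cases n
  · left; simp
  · right; simp

lemma polyAct_X (M : Matrix (Fin 2) (Fin 2) ℤ_[2]) (j : Fin 2) : polyAct F2bar M (X j) =
    C (algebraMap ℤ_[2] F2bar (M 0 j)) * X 0 + C (algebraMap ℤ_[2] F2bar (M 1 j)) * X 1 := by
  simp [polyAct, Fin.sum_univ_two]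

lemma det_ne_zero (k : K) : algebraMap ℤ_[2] F2bar (k.val 0 0) * algebraMap ℤ_[2] F2bar (k.val 1 1) -
    algebraMap ℤ_[2] F2bar (k.val 0 1) * algebraMap ℤ_[2] F2bar (k.val 1 0) ≠ 0 := by
  have hd : IsUnit k.val.det := (Matrix.isUnit_iff_isUnit_det _).1 k.isUnit
  have := (hd.map (algebraMap ℤ_[2] F2bar)).ne_zero
  rwa [Matrix.det_fin_two, map_sub, map_mul, map_mul] at this

/-- Modulo 2, θ = XY(X + Y) is the product of the three nonzero linear forms over the field of two
elements, which are permuted. -/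
lemma polyAct_theta (k : K) : polyAct F2bar k.val theta = theta := by
  have hd := det_ne_zero k
  have h2 := two_eq_zero_poly
  simp only [theta, map_sub, map_mul, map_pow, polyAct_X]
  rcases algebraMap_eq_zero_or_one (k.val 0 0) with h00 | h00 <;>
  rcases algebraMap_eq_zero_or_one (k.val 0 1) with h01 | h01 <;>
  rcases algebraMap_eq_zero_or_one (k.val 1 0) with h10 | h10 <;>
  rcases algebraMap_eq_zero_or_one (k.val 1 1) with h11 | h11 <;>
  simp only [h00, h01, h10, h11, mul_zero, mul_one, sub_self, not_true, ne_eq] at hd <;>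
  simp only [h00, h01, h10, h11, map_zero, map_one, zero_mul, one_mul, zero_add, add_zero] <;>
  grind

lemma homog_theta_pow (n : ℕ) : (theta ^ n).IsHomogeneous (3 * n) := by
  have h : theta.IsHomogeneous 3 := ((isHomogeneous_X_pow 0 2).mul (isHomogeneous_X _ 1)).sub
    ((isHomogeneous_X _ 0).mul (isHomogeneous_X_pow 1 2))
  exact h.pow n

lemma mem_filtration {r n : ℕ} (h : 3 * n ≤ r) {v : Poly F2bar} :
    v ∈ filtration r n ↔ ∃ w ∈ sym F2bar (r - 3 * n), theta ^ n * w = v := by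
  rw [filtration, if_pos h]; rfl

lemma filtration_le_sym (r n : ℕ) : filtration r n ≤ sym F2bar r := by
  intro v hv
  by_cases h : 3 * n ≤ r
  · obtain ⟨w, hw, rfl⟩ := (mem_filtration h).1 hv
    have := (homog_theta_pow n).mul ((mem_homogeneousSubmodule _ _).1 hw)
    rwa [Nat.add_sub_cancel' h] at this
  · rw [filtration, if_neg h, Submodule.mem_bot] at hv
    rw [hv]; exact Submodule.zero_mem _

lemma filtration_stable (r n : ℕ) : KStable (filtration r n) := by
  intro k v hv
  by_cases h : 3 * n ≤ r
  · obtain ⟨w, hw, rfl⟩ := (mem_filtration h).1 hv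
    rw [map_mul, map_pow, polyAct_theta]
    exact (mem_filtration h).2 ⟨_, sym_stable _ _ k w hw, rfl⟩
  · rw [filtration, if_neg h, Submodule.mem_bot] at hv
    rw [hv, map_zero]; exact Submodule.zero_mem _

/-- In characteristic 2 the left side vanishes on X = 0, Y = 0 and X = Y. Only odd exponents are
needed, as r - 3 is odd. -/
lemma exists_add_pow_sub (n : ℕ) : ∃ Q ∈ sym F2bar (2 * n),
    (X 0 + X 1) ^ (2 * n + 3) - X 0 ^ (2 * n + 3) - X 1 ^ (2 * n + 3) = theta * Q := by
  have h2 := two_eq_zero_poly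
  induction n with
  | zero =>
    refine ⟨1, isHomogeneous_one _ _, ?_⟩
    rw [theta]
    linear_combination (X 0 ^ 2 * X 1 + 2 * X 0 * X 1 ^ 2) * h2
  | succ n ih =>
    obtain ⟨Q, hQ, e⟩ := ih
    -- After multiplication by (X + Y)² the remainder is X²Y²(X^(2n+1) - Y^(2n+1)) modulo 2, and S
    -- is the last factor divided by X - Y.
    let S : Poly F2bar := ∑ i ∈ Finset.range (2 * n + 1), X 0 ^ i * X 1 ^ (2 * n + 1 - 1 - i)
    have hS : S.IsHomogeneous (2 * n) := by
      refine IsHomogeneous.sum _ _ _ fun i hi => ?_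
      have := Finset.mem_range.1 hi
      have h := (isHomogeneous_X_pow (R := F2bar) (0 : Fin 2) i).mul
        (isHomogeneous_X_pow (R := F2bar) (1 : Fin 2) (2 * n + 1 - 1 - i))
      rwa [show i + (2 * n + 1 - 1 - i) = 2 * n by omega] at h
    have hS' : S * (X 0 - X 1) = X 0 ^ (2 * n + 1) - X 1 ^ (2 * n + 1) :=
      (Commute.all _ _).geom_sum₂_mul _
    have hX : (X 0 + X 1 : Poly F2bar).IsHomogeneous 1 := (isHomogeneous_X _ _).add (isHomogeneous_X _ _)
    refine ⟨(X 0 + X 1) ^ 2 * Q + X 0 * X 1 * S, ?_, ?_⟩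
    · rw [mul_add, add_comm (2 * n)]
      refine IsHomogeneous.add ?_ ?_
      · exact (hX.pow 2).mul hQ
      · exact ((isHomogeneous_X _ _).mul (isHomogeneous_X _ _)).mul hS
    · rw [theta] at e ⊢
      linear_combination (X 0 + X 1) ^ 2 * e - X 0 ^ 2 * X 1 ^ 2 * hS' +
        (X 0 * X 1 * (X 0 ^ (2 * n + 3) + X 1 ^ (2 * n + 3)) + X 0 ^ 2 * X 1 ^ (2 * n + 3)) * h2

lemma inclV1_mem {r : ℕ} (hr : 3 ≤ r) (v : Poly F2bar) : inclV1 r v ∈ filtration r 1 := by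
  refine (mem_filtration (by omega)).2 ⟨_, ?_, by rw [pow_one]; rfl⟩
  exact Submodule.add_mem _ (Submodule.smul_mem _ _ (isHomogeneous_X_pow _ _))
    (Submodule.smul_mem _ _ (isHomogeneous_X_pow _ _))

lemma inclV1_linear (r : ℕ) (c d : F2bar) : inclV1 r (C c * X 0 + C d * X 1) =
    theta * (c • X 0 ^ (r - 3) + d • X 1 ^ (r - 3)) := by
  have h01 : (Finsupp.single 0 1 : Fin 2 →₀ ℕ) ≠ Finsupp.single 1 1 := by
    intro h; have := DFunLike.congr_fun h 0; simp at this
  simp [inclV1, coeff_C_mul, coeff_X, h01, h01.symm]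

lemma eq_linear {v : Poly F2bar} (hv : v ∈ sym F2bar 1) : ∃ c d, v = C c * X 0 + C d * X 1 := by
  rw [sym, homogeneousSubmodule_one_eq_span_X, show Set.range (X : Fin 2 → Poly F2bar) = {X 0, X 1} by
    ext; simp [eq_comm]] at hv
  obtain ⟨c, d, rfl⟩ := Submodule.mem_span_pair.1 hv
  exact ⟨c, d, by rw [smul_eq_C_mul, smul_eq_C_mul]⟩

/-- Since θ is invariant, the defect is θ times the failure of the power r - 3 to be additive, which
`exists_add_pow_sub` makes a second multiple of θ. -/
lemma inclV1_equivariant {N : ℕ} (hN : 2 ≤ N) (k : K) {v : Poly F2bar} (hv : v ∈ sym F2bar 1) :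
    polyAct F2bar k.val (inclV1 (2 * N + 2) v) - inclV1 (2 * N + 2) (polyAct F2bar k.val v) ∈
      filtration (2 * N + 2) 2 := by
  obtain ⟨n, rfl⟩ := Nat.exists_eq_add_of_le' hN
  have hm : 2 * (n + 2) + 2 - 3 = 2 * n + 3 := by omega
  have key : ∀ c d : ℤ_[2], ∃ Q ∈ sym F2bar (2 * n),
      (C (algebraMap ℤ_[2] F2bar c) * X 0 + C (algebraMap ℤ_[2] F2bar d) * X 1) ^ (2 * n + 3) -
      (C (algebraMap ℤ_[2] F2bar c) * X 0 ^ (2 * n + 3) +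
        C (algebraMap ℤ_[2] F2bar d) * X 1 ^ (2 * n + 3)) = theta * Q := by
    intro c d
    rcases algebraMap_eq_zero_or_one c with hc | hc <;>
    rcases algebraMap_eq_zero_or_one d with hd | hd
    · exact ⟨0, Submodule.zero_mem _, by simp [hc, hd]⟩
    · exact ⟨0, Submodule.zero_mem _, by simp [hc, hd]⟩
    · exact ⟨0, Submodule.zero_mem _, by simp [hc, hd]⟩
    · obtain ⟨Q, hQ, e⟩ := exists_add_pow_sub n
      refine ⟨Q, hQ, ?_⟩
      rw [← e, hc, hd, C_1]; ring
  obtain ⟨x, y, rfl⟩ := eq_linear hv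
  obtain ⟨Q, hQ, e⟩ := key (k.val 0 0) (k.val 1 0)
  obtain ⟨Q', hQ', e'⟩ := key (k.val 0 1) (k.val 1 1)
  rw [mem_filtration (by omega)]
  refine ⟨x • Q + y • Q', ?_, ?_⟩
  · rw [show 2 * (n + 2) + 2 - 3 * 2 = 2 * n by omega]
    exact Submodule.add_mem _ (Submodule.smul_mem _ _ hQ) (Submodule.smul_mem _ _ hQ')
  · have hlin : polyAct F2bar k.val (C x * X 0 + C y * X 1) =
        C (x * algebraMap ℤ_[2] F2bar (k.val 0 0) + y * algebraMap ℤ_[2] F2bar (k.val 0 1)) * X 0 +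
        C (x * algebraMap ℤ_[2] F2bar (k.val 1 0) + y * algebraMap ℤ_[2] F2bar (k.val 1 1)) * X 1 := by
      simp only [map_add, map_mul, polyAct_X, ← algebraMap_eq, AlgHom.commutes]
      ring
    have hC : ∀ c, polyAct F2bar k.val (C c) = C c := fun c => (polyAct F2bar k.val).commutes c
    rw [hlin, inclV1_linear, inclV1_linear, hm]
    simp only [map_mul, map_add, map_pow, polyAct_theta, polyAct_X, smul_eq_C_mul, hC]
    linear_combination (-theta * C x) * e - (theta * C y) * e'

/-! ## Vanishing of `P` on `I(V_r^{(2)})` -/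

section
variable {r : ℕ} {a u : Q2bar}

/-- The lift `X²Y - XY²` of `theta`. -/
def thetaInt : Poly Z2bar := X 0 ^ 2 * X 1 - X 0 * X 1 ^ 2

lemma map_thetaInt : map (algebraMap Z2bar F2bar) thetaInt = theta := by
  simp [thetaInt, theta]

lemma homog_thetaInt : thetaInt.IsHomogeneous 3 :=
  ((isHomogeneous_X_pow 0 2).mul (isHomogeneous_X _ 1)).sub
    ((isHomogeneous_X _ 0).mul (isHomogeneous_X_pow 1 2))

/-- Each substitution in T makes θ divisible by 2, hence θ² by 4. Dividing by a still leaves a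
factor of norm 1/2. -/
lemma small_br_thetaInt_sq_mul (ha : a = 2 * u) (hu : ‖u‖ = 1) (h : G) {w : Poly Z2bar}
    (hw : (thetaInt ^ 2 * w).IsHomogeneous r) : Small 1 (br r a h (thetaInt ^ 2 * w)) := by
  have ha' : ‖a‖ = 1 / 2 := by rw [ha, norm_a hu]
  have h4 : ∀ (g : G) (p q : Poly Z2bar), p = ((4 : ℤ) : Poly Z2bar) * q →
      Small (1 / 2) (br r a g p) := by
    intro g p q e
    rw [e, br_intCast_mul]
    refine small_smul_br _ _ ?_
    have : ((4 : ℤ) : Q2bar) = 2 ^ 2 := by norm_num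
    rw [this, norm_two_pow]; norm_num
  refine Small.of_smul (c := a) (norm_ne_zero_iff.1 (by rw [ha']; norm_num)) ?_
  rw [ha', mul_one, hecke_br h _ hw]
  simp only [map_mul, map_pow, map_sub, thetaInt, aeval_X, Matrix.cons_val_zero, Matrix.cons_val_one]
  refine ((h4 _ _ ((X 0 * X 1 * (X 0 - 2 * X 1)) ^ 2 * aeval ![X 0, 2 * X 1] w) ?_).add
    (h4 _ _ ((X 0 * (2 * X 1 - X 0) * (X 0 - X 1)) ^ 2 * aeval ![X 0, 2 * X 1 - X 0] w) ?_)).add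
    (h4 _ _ ((X 0 * X 1 * (2 * X 0 - X 1)) ^ 2 * aeval ![2 * X 0, X 1] w) ?_) <;>
  push_cast <;> ring

lemma projP_eq_zero_of_filtration (ha : a = 2 * u) (hu : ‖u‖ = 1) (f : compactInd (sym F2bar r))
    (hf : f.1 ∈ compactInd (filtration r 2)) : projP r a f = 0 := by
  suffices h : ∃ h : f.1 ∈ compactInd (sym F2bar r), projP r a ⟨f.1, h⟩ = 0 by
    obtain ⟨_, h⟩ := h; exact h
  refine compactInd_induction (filtration_stable r 2)
    (fun f => ∃ h : f ∈ compactInd (sym F2bar r), projP r a ⟨f, h⟩ = 0) ?_ ?_ ?_ f.1 hf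
  · exact ⟨Submodule.zero_mem _, map_zero (projP r a)⟩
  · rintro f f' - - ⟨h, e⟩ ⟨h', e'⟩
    refine ⟨Submodule.add_mem _ h h', ?_⟩
    have := map_add (projP r a) ⟨f, h⟩ ⟨f', h'⟩
    rw [e, e', add_zero] at this
    exact this
  · intro g v hv
    refine ⟨elem_mem (sym_stable _ r) g (filtration_le_sym r 2 hv), ?_⟩
    have hlift : ∃ w : Poly Z2bar, (thetaInt ^ 2 * w).IsHomogeneous r ∧
        map (algebraMap Z2bar F2bar) (thetaInt ^ 2 * w) = v := by
      by_cases h : 3 * 2 ≤ r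
      · obtain ⟨w, hw, rfl⟩ := (mem_filtration h).1 hv
        obtain ⟨w', hw', rfl⟩ := exists_sym_lift _ w hw
        refine ⟨w', ?_, by rw [map_mul, map_pow, map_thetaInt]⟩
        have := (homog_thetaInt.pow 2).mul ((mem_homogeneousSubmodule _ _).1 hw')
        rwa [Nat.add_sub_cancel' h] at this
      · rw [filtration, if_neg h, Submodule.mem_bot] at hv
        exact ⟨0, by rw [mul_zero]; exact isHomogeneous_zero _ _ _, by rw [hv, mul_zero, map_zero]⟩
    obtain ⟨w, hw, rfl⟩ := hlift
    have e : (⟨elemFn g (map (algebraMap Z2bar F2bar) (thetaInt ^ 2 * w)),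
        elem_mem (sym_stable _ r) g (filtration_le_sym r 2 hv)⟩ : compactInd (sym F2bar r)) =
        coeffMap Z2bar F2bar r ⟨elemFn g (thetaInt ^ 2 * w), elem_mem (sym_stable _ r) g hw⟩ :=
      Subtype.ext (funext fun x => (coeffMap_elem g _ x).symm)
    rw [e, projP_coeffMap]
    apply thetaBarMk_eq_zero_of_small
    have := small_br_thetaInt_sq_mul ha hu g hw
    rw [br_apply] at this
    convert this using 2
    funext x
    exact (elemFn_map g _ x).symm
end

/-! ## The natural map -/

section
variable {r : ℕ} {a : Q2bar}

lemma Lifts.add {f f' h h'} (hf : Lifts r f' f) (hh : Lifts r h' h) : Lifts r (f' + h') (f + h) := by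
  refine ⟨Submodule.add_mem _ hf.1 hh.1, fun x => ?_⟩
  have := Submodule.add_mem _ (hf.2 x) (hh.2 x)
  rw [← add_sub_add_comm, ← map_add] at this
  exact this

lemma Lifts.smul {f f'} (hf : Lifts r f' f) (c : F2bar) : Lifts r (c • f') (c • f) := by
  refine ⟨Submodule.smul_mem _ c hf.1, fun x => ?_⟩
  have := Submodule.smul_mem _ c (hf.2 x)
  rw [smul_sub, ← map_smul] at this
  exact this

lemma Lifts.indRep {f f'} (hf : Lifts r f' f) (g : G) :
    Lifts r (indRep (sym F2bar r) g f') (indRep (sym F2bar 1) g f) :=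
  ⟨(ModTwo.indRep (filtration r 1) g ⟨f'.1, hf.1⟩).2, fun x => hf.2 (x * g)⟩

variable (r) in
lemma inclV1_mem_sym (hr : 3 ≤ r) (v : Poly F2bar) : inclV1 r v ∈ sym F2bar r :=
  filtration_le_sym r 1 (inclV1_mem hr v)

lemma lifts_elemFn (hr : 6 ≤ r) (heven : Even r) (g : G) {v : Poly F2bar} (hv : v ∈ sym F2bar 1)
    {w : Poly F2bar} (hw : w = inclV1 r v) (hw' : w ∈ sym F2bar r) :
    Lifts r ⟨elemFn g w, elem_mem (sym_stable _ r) g hw'⟩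
      ⟨elemFn g v, elem_mem (sym_stable _ 1) g hv⟩ := by
  subst hw
  refine ⟨elem_mem (filtration_stable r 1) g (inclV1_mem (by omega) v), fun x => ?_⟩
  by_cases h : ∃ (k : K) (n : ℤ), x * g = ϖ ^ n * ofK k
  · obtain ⟨k, n, h⟩ := h
    simp only [elem_of h]
    obtain ⟨M, rfl⟩ := heven
    obtain ⟨N, rfl⟩ := Nat.exists_eq_add_of_le' (show 1 ≤ M by omega)
    have := inclV1_equivariant (N := N) (by omega) k hv
    rwa [show 2 * N + 2 = N + 1 + (N + 1) by ring] at this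
  · simp only [elem_of_not h, map_zero, sub_self]
    exact Submodule.zero_mem _

lemma exists_lifts (hr : 6 ≤ r) (heven : Even r) (f : compactInd (sym F2bar 1)) :
    ∃ f', Lifts r f' f := by
  obtain ⟨f, hf⟩ := f
  refine compactInd_induction (sym_stable F2bar 1)
    (fun f => ∀ h : f ∈ compactInd (sym F2bar 1), ∃ f', Lifts r f' ⟨f, h⟩) ?_ ?_ ?_ f hf hf
  · intro _
    exact ⟨0, Submodule.zero_mem _, fun x => by simp⟩
  · intro f h hf hh ihf ihh _
    obtain ⟨f', e⟩ := ihf hf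
    obtain ⟨h', e'⟩ := ihh hh
    refine ⟨f' + h', ?_⟩
    rw [← AddMemClass.mk_add_mk _ _ _ hf hh]
    exact e.add e'
  · intro g v hv _
    have hw : inclV1 r v ∈ sym F2bar r := inclV1_mem_sym r (by omega) v
    exact ⟨_, lifts_elemFn hr heven g hv rfl hw⟩

/-- Two lifts of the same function have the same image under `P`, if `P` kills `I(V_r^{(2)})`. -/
lemma projP_eq_of_lifts (hkill : ∀ f : compactInd (sym F2bar r),
    f.1 ∈ compactInd (filtration r 2) → projP r a f = 0) {f f' h'} (hf : Lifts r f' f)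
    (hh : Lifts r h' f) : projP r a f' = projP r a h' := by
  rw [← sub_eq_zero, ← map_sub]
  refine hkill _ ⟨fun x => ?_, (f' - h').2.2⟩
  have := Submodule.sub_mem _ (hf.2 x) (hh.2 x)
  rwa [sub_sub_sub_cancel_right] at this

/-- The natural map `I(V_1) → Θ_{k,a} ⊗ F2bar`. -/
def naturalMap (hr : 6 ≤ r) (heven : Even r) (hkill : ∀ f : compactInd (sym F2bar r),
    f.1 ∈ compactInd (filtration r 2) → projP r a f = 0) :
    compactInd (sym F2bar 1) →ₗ[F2bar] ThetaBar r a where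
  toFun f := projP r a (exists_lifts hr heven f).choose
  map_add' f h := by
    rw [← map_add]
    exact projP_eq_of_lifts hkill (exists_lifts hr heven _).choose_spec
      ((exists_lifts hr heven f).choose_spec.add (exists_lifts hr heven h).choose_spec)
  map_smul' c f := by
    rw [RingHom.id_apply, ← map_smul]
    exact projP_eq_of_lifts hkill (exists_lifts hr heven _).choose_spec
      ((exists_lifts hr heven f).choose_spec.smul c)

variable (hr : 6 ≤ r) (heven : Even r) (hkill : ∀ f : compactInd (sym F2bar r),
    f.1 ∈ compactInd (filtration r 2) → projP r a f = 0)

lemma naturalMap_eq {f f'} (hf : Lifts r f' f) : naturalMap hr heven hkill f = projP r a f' :=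
  projP_eq_of_lifts hkill (exists_lifts hr heven _).choose_spec hf

lemma naturalMap_indRep (g : G) (f : compactInd (sym F2bar 1)) :
    naturalMap hr heven hkill (indRep _ g f) = thetaBarRep r a g (naturalMap hr heven hkill f) := by
  obtain ⟨f', hf⟩ := exists_lifts hr heven f
  rw [naturalMap_eq hr heven hkill hf, naturalMap_eq hr heven hkill (hf.indRep g), projP_indRep]

lemma isNaturalQuotient_of_comp_eq_zero {q : Polynomial F2bar}
    (h : ∀ f, naturalMap hr heven hkill (Polynomial.aeval (hecke F2bar 1) q f) = 0) :
    IsNaturalQuotient r a q := by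
  have hmem : ∀ f, naturalMap hr heven hkill f ∈ factorF2 r a := fun f => by
    obtain ⟨f', hf⟩ := exists_lifts hr heven f
    rw [naturalMap_eq hr heven hkill hf]
    exact ⟨f', ⟨f, hf⟩, rfl⟩
  let φ : compactInd (sym F2bar 1) →ₗ[F2bar] factorF2 r a :=
    (naturalMap hr heven hkill).codRestrict _ hmem
  refine ⟨Submodule.liftQ (τ₁₂ := RingHom.id F2bar) (M₂ := factorF2 r a) _ φ ?_, ?_, ?_, ?_⟩
  · rintro _ ⟨f, rfl⟩
    exact Subtype.ext (h f)
  · rintro ⟨_, f', ⟨f, hf⟩, rfl⟩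
    exact ⟨Submodule.Quotient.mk f, Subtype.ext (naturalMap_eq hr heven hkill hf)⟩
  · intro g y
    obtain ⟨f, rfl⟩ := Submodule.Quotient.mk_surjective _ y
    exact Subtype.ext (naturalMap_indRep hr heven hkill g f)
  · intro f f' hf
    exact naturalMap_eq hr heven hkill hf
end

/-! ## The functions `[g, X]` in `I(V_1)` and their lifts -/

section
variable {r : ℕ} {a : Q2bar}

variable (r a) in
/-- The class in the quotient by `T - a` of an integral function. -/
def toAmbient : compactInd (sym Z2bar r) →+ Ambient r a where
  toFun f := Submodule.Quotient.mk (coeffMap Z2bar Q2bar r f).1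
  map_zero' := by rw [map_zero]; rfl
  map_add' f h := by rw [map_add]; rfl

lemma toAmbient_smul (c : Z2bar) (f : compactInd (sym Z2bar r)) :
    toAmbient r a (c • f) = (c : Q2bar) • toAmbient r a f := by
  change Submodule.Quotient.mk (coeffMap Z2bar Q2bar r (c • f)).1 = _
  rw [map_smul]; rfl

lemma toAmbient_elemFn (g : G) (w : Poly Z2bar) (h : elemFn g w ∈ compactInd (sym Z2bar r)) :
    toAmbient r a ⟨elemFn g w, h⟩ = br r a g w := by
  rw [br_apply]
  change Submodule.Quotient.mk _ = _
  congr 1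
  funext x
  exact (elemFn_map g w x).symm

lemma residue_smul_thetaBarMk (c : Z2bar) (f : compactInd (sym Z2bar r)) :
    IsLocalRing.residue Z2bar c • thetaBarMk r a f = thetaBarMk r a (c • f) := by
  rw [map_smul]
  exact algebraMap_smul F2bar c _

/-- The function `[g, X]` in `I(V_1)`. -/
def elemX (g : G) : compactInd (sym F2bar 1) :=
  ⟨elemFn g (X 0), elem_mem (sym_stable _ 1) g (isHomogeneous_X _ _)⟩

lemma indRep_elemX (g h : G) : indRep (sym F2bar 1) g (elemX h) = elemX (g * h) :=
  Subtype.ext (funext fun x => elem_apply_mul h g (X 0) x)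

/-- The third term of T carries 2X, which is 0 in characteristic 2. -/
lemma hecke_elemX (g : G) : hecke F2bar 1 (elemX g) = elemX (g * ga) + elemX (g * nG 1 * ga) := by
  apply Subtype.ext
  change heckeFun F2bar (elemFn g (X 0)) = elemFn (g * ga) (X 0) + elemFn (g * nG 1 * ga) (X 0)
  have h0 : elemFn (g * gc) (0 : Poly F2bar) = 0 := by
    have := elem_smul (g * gc) (0 : F2bar) (0 : Poly F2bar); simpa using this
  rw [heckeFun_elem, mul_assoc g, ← gb_eq]
  simp only [aeval_X, Matrix.cons_val_zero]
  have h2 : (2 * X 0 : Poly F2bar) = 0 := by rw [two_eq_zero_poly, zero_mul]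
  rw [h2]
  change _ + _ + elemFn (g * gc) (0 : Poly F2bar) = _
  rw [h0, add_zero]; rfl

/-- The matrix exchanging X and Y lies in K, so every [g, Y] is some [g', X]. -/
lemma eq_zero_of_elemX {M : Type} [AddCommGroup M] [Module F2bar M]
    (L : compactInd (sym F2bar 1) →ₗ[F2bar] M) (h : ∀ g, L (elemX g) = 0) : L = 0 := by
  ext ⟨f, hf⟩
  refine compactInd_induction (sym_stable F2bar 1)
    (fun f => ∀ h : f ∈ compactInd (sym F2bar 1), L ⟨f, h⟩ = 0) ?_ ?_ ?_ f hf hf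
  · exact fun _ => map_zero L
  · intro f h hf hh ihf ihh _
    rw [← AddMemClass.mk_add_mk _ _ _ hf hh, map_add, ihf, ihh, add_zero]
  · intro g v hv _
    obtain ⟨c, d, rfl⟩ := eq_linear hv
    let k : K := Matrix.GeneralLinearGroup.mk'' !![0, 1; 1, 0] (by simp)
    have hk : polyAct F2bar k.val (X 0) = X 1 := by
      have hval : k.val = !![0, 1; 1, 0] := rfl
      rw [polyAct_X, hval]; simp
    have e : (⟨elemFn g (C c * X 0 + C d * X 1), ‹_›⟩ : compactInd (sym F2bar 1)) =
        c • elemX g + d • elemX (g * ofK k) := by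
      apply Subtype.ext
      change _ = c • elemFn g (X 0) + d • elemFn (g * ofK k) (X 0)
      rw [elem_mul_ofK, hk, ← elem_smul, ← elem_smul, ← elem_add, smul_eq_C_mul, smul_eq_C_mul]
    rw [e, map_add, map_smul, map_smul, h, h, smul_zero, smul_zero, add_zero]

lemma aeval_hecke_indRep (q : Polynomial F2bar) (g : G) (f : compactInd (sym F2bar 1)) :
    Polynomial.aeval (hecke F2bar 1) q (indRep (sym F2bar 1) g f) =
      indRep (sym F2bar 1) g (Polynomial.aeval (hecke F2bar 1) q f) := by
  have h : Commute (hecke F2bar 1) (indRep (sym F2bar 1) g) := LinearMap.ext (hecke_comm 1 g)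
  induction q using Polynomial.induction_on' with
  | add p q hp hq => simp only [map_add, LinearMap.add_apply, hp, hq]
  | monomial n c =>
    rw [Polynomial.aeval_monomial]
    exact LinearMap.congr_fun
      ((Algebra.commute_algebraMap_left c _).mul_left (h.pow_left n)).eq f

lemma isNaturalQuotient_of_elemX_one (hr : 6 ≤ r) (heven : Even r)
    (hkill : ∀ f : compactInd (sym F2bar r), f.1 ∈ compactInd (filtration r 2) → projP r a f = 0)
    {q : Polynomial F2bar}
    (h : naturalMap hr heven hkill (Polynomial.aeval (hecke F2bar 1) q (elemX 1)) = 0) :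
    IsNaturalQuotient r a q := by
  refine isNaturalQuotient_of_comp_eq_zero hr heven hkill (LinearMap.congr_fun
    (eq_zero_of_elemX (naturalMap hr heven hkill ∘ₗ Polynomial.aeval (hecke F2bar 1) q) ?_))
  intro g
  rw [LinearMap.comp_apply, ← mul_one g, ← indRep_elemX, aeval_hecke_indRep, naturalMap_indRep, h,
    map_zero]
end

/-! ### Integral lifts of `[g, X]` and the two cases -/

section
variable {N : ℕ} {a u : Q2bar}

/-- The integral lift `[g, X^{2N+1} Y - X^{2N} Y²]` of `[g, θ X^{2N-1}]`. -/
def elemE (N : ℕ) (g : G) : compactInd (sym Z2bar (2 * N + 2)) :=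
  ⟨elemFn g (X 0 ^ (2 * N + 1) * X 1 - X 0 ^ (2 * N) * X 1 ^ 2),
    elem_mem (sym_stable _ _) g (homog_L.sub homog_M)⟩

lemma toAmbient_elemE (g : G) : toAmbient (2 * N + 2) a (elemE N g) = brE N a g := by
  rw [elemE, toAmbient_elemFn, map_sub]; rfl

lemma inclV1_X (hN : 1 ≤ N) : inclV1 (2 * N + 2) (X 0) =
    map (algebraMap Z2bar F2bar) (X 0 ^ (2 * N + 1) * X 1 - X 0 ^ (2 * N) * X 1 ^ 2) := by
  obtain ⟨n, rfl⟩ := Nat.exists_eq_add_of_le' hN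
  have := inclV1_linear (2 * (n + 1) + 2) 1 0
  rw [map_one, map_zero, one_mul, zero_mul, add_zero, one_smul, zero_smul, add_zero,
    show 2 * (n + 1) + 2 - 3 = 2 * n + 1 by omega] at this
  rw [this, theta]
  simp only [map_sub, map_mul, map_pow, map_X]
  ring

lemma naturalMap_elemX (hr : 6 ≤ 2 * N + 2) (heven : Even (2 * N + 2))
    (hkill : ∀ f : compactInd (sym F2bar (2 * N + 2)),
      f.1 ∈ compactInd (filtration (2 * N + 2) 2) → projP (2 * N + 2) a f = 0) (g : G) :
    naturalMap hr heven hkill (elemX g) = thetaBarMk (2 * N + 2) a (elemE N g) := by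
  have hw : map (algebraMap Z2bar F2bar) (X 0 ^ (2 * N + 1) * X 1 - X 0 ^ (2 * N) * X 1 ^ 2) ∈
      sym F2bar (2 * N + 2) := (homog_L.sub homog_M).map _
  rw [← projP_coeffMap]
  refine (naturalMap_eq hr heven hkill
    (lifts_elemFn hr heven g (isHomogeneous_X _ _) (inclV1_X (by omega)).symm hw)).trans ?_
  congr 1
  exact Subtype.ext (funext fun x => (coeffMap_elem g _ x).symm)

lemma hecke_elemX_one : hecke F2bar 1 (elemX 1) = elemX ga + elemX (nG 1 * ga) := by
  rw [hecke_elemX, one_mul, one_mul]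

lemma hecke_hecke_elemX_one : hecke F2bar 1 (hecke F2bar 1 (elemX 1)) =
    elemX (nG 0 * ga * ga) + elemX (nG 1 * ga * ga) + elemX (nG 2 * ga * ga) +
      elemX (nG 3 * ga * ga) := by
  have v2 : ga * nG 1 * ga = nG 2 * ga * ga := by rw [ga_mul_nG]; norm_num
  have v3 : nG 1 * ga * nG 1 * ga = nG 3 * ga * ga := by
    rw [← nG_mul_ga (show (3 : ℤ) = 2 * 1 + 1 by norm_num)]
  have v0 : ga * ga = nG 0 * ga * ga := by rw [nG_zero, one_mul]
  rw [hecke_elemX_one, map_add, hecke_elemX, hecke_elemX, v2, v3, v0]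
  abel

/-- The case in which the relation is divided by `α`. -/
lemma isNaturalQuotient_quadratic (hN : 2 ≤ N) (ha : a = 2 * u) (hu : ‖u‖ = 1) {α : Q2bar}
    (hα : u * α = u ^ 2 - (1 + N) * (1 + 2 * N)) (hα0 : α ≠ 0) (hNα : ‖(N : Q2bar)‖ ≤ ‖α‖)
    {c : Z2bar} (hc : (c : Q2bar) = u + N / α) :
    IsNaturalQuotient (2 * N + 2) a
      (Polynomial.X ^ 2 - Polynomial.C (IsLocalRing.residue Z2bar c) * Polynomial.X + 1) := by
  obtain ⟨k, o, ho, hk⟩ := Nat.exists_eq_two_pow_mul_odd (show N ≠ 0 by omega)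
  have heven : Even (2 * N + 2) := ⟨N + 1, by ring⟩
  refine isNaturalQuotient_of_elemX_one (by omega) heven
    (projP_eq_zero_of_filtration ha hu) ?_
  simp only [map_add, map_sub, map_mul, map_one, Polynomial.aeval_X, Polynomial.aeval_C,
    pow_two, LinearMap.add_apply, LinearMap.sub_apply, Module.End.mul_apply, Module.End.one_apply,
    Module.algebraMap_end_apply, map_smul]
  rw [hecke_hecke_elemX_one, hecke_elemX_one]
  simp only [map_add, naturalMap_elemX]
  simp only [← map_add, residue_smul_thetaBarMk, ← map_sub]
  apply thetaBarMk_eq_zero_of_small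
  change Small 1 (toAmbient _ a _)
  simp only [map_add, map_sub, toAmbient_smul, toAmbient_elemE]
  have h := brE_relation (ρ := ‖α‖) hk ho ha hu hα hNα le_rfl
  have h1 : Small 1 (brE N a 1 + brTTE N a - u • brTE N a + (N / α) • brTE N a) := by
    refine Small.of_smul hα0 ?_
    rw [mul_one]
    convert h using 1
    rw [smul_add, smul_smul, mul_div_cancel₀ _ hα0]
  have hNα' : ‖(N : Q2bar) / α‖ ≤ 1 := by
    rw [norm_div]; exact div_le_one_of_le₀ hNα (norm_nonneg _)
  -- The relation carries N/α with the opposite sign from c; as N/α is integral, changing the sign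
  -- costs an even multiple.
  have h2 : Small 1 ((2 * (N / α)) • brTE N a) := by
    have hs : ∀ g, Small 1 ((2 * (N / α)) • brE N a g) := fun g => by
      rw [brE, smul_sub]
      exact (small_smul_of_two_mul one_pos hNα' _ _).sub (small_smul_of_two_mul one_pos hNα' _ _)
    rw [brTE, smul_add]
    exact (hs _).add (hs _)
  convert h1.sub h2 using 1
  rw [hc, brTTE, brTE]
  module

/-- The case in which the relation is divided by `N`. -/
lemma isNaturalQuotient_X (hN : 2 ≤ N) (ha : a = 2 * u) (hu : ‖u‖ = 1) {α : Q2bar}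
    (hα : u * α = u ^ 2 - (1 + N) * (1 + 2 * N)) (hNα : ‖α‖ < ‖(N : Q2bar)‖) :
    IsNaturalQuotient (2 * N + 2) a Polynomial.X := by
  obtain ⟨k, o, ho, hk⟩ := Nat.exists_eq_two_pow_mul_odd (show N ≠ 0 by omega)
  have heven : Even (2 * N + 2) := ⟨N + 1, by ring⟩
  refine isNaturalQuotient_of_elemX_one (by omega) heven
    (projP_eq_zero_of_filtration ha hu) ?_
  rw [Polynomial.aeval_X, hecke_elemX_one, map_add, naturalMap_elemX, naturalMap_elemX, ← map_add]
  apply thetaBarMk_eq_zero_of_small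
  change Small 1 (toAmbient _ a _)
  rw [map_add, toAmbient_elemE, toAmbient_elemE, ← brTE]
  have h := brE_relation hk ho ha hu hα le_rfl hNα.le
  refine Small.of_smul (c := (N : Q2bar)) (by exact_mod_cast (show N ≠ 0 by omega)) ?_
  rw [mul_one]
  have hs : ∀ {c : Q2bar} (g), ‖c‖ < ‖(N : Q2bar)‖ → Small ‖(N : Q2bar)‖ (c • brE N a g) :=
    fun g hc => by
      rw [brE, smul_sub]
      exact (small_smul_br _ _ hc).sub (small_smul_br _ _ hc)
  have hu' : ‖α * u‖ < ‖(N : Q2bar)‖ := by rwa [norm_mul, hu, mul_one]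
  -- Since |α| < |N| strictly, this whole part is negligible and only N TE survives.
  have h1 : Small ‖(N : Q2bar)‖ (α • (brE N a 1 + brTTE N a - u • brTE N a)) := by
    rw [brTTE, brTE]
    simp only [smul_add, smul_sub, smul_smul]
    exact ((hs _ hNα).add ((((hs _ hNα).add (hs _ hNα)).add (hs _ hNα)).add (hs _ hNα))).sub
      ((hs _ hu').add (hs _ hu'))
  convert h.sub h1 using 1
  module
end

/-! ## Valuations -/

lemma val_le_val_iff {x y : Q2bar} : val x ≤ val y ↔ ‖y‖ ≤ ‖x‖ := by
  by_cases hx : x = 0 <;> by_cases hy : y = 0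
  · simp [val, hx, hy]
  · simp [val, hx, hy]
  · simp [val, hx, hy]
  · simp only [val, hx, hy, if_false]
    rw [EReal.coe_le_coe_iff, neg_le_neg_iff,
      Real.logb_le_logb (by norm_num) (norm_pos_iff.2 hy) (norm_pos_iff.2 hx)]

lemma val_sub_one (x : Q2bar) : val (2 * x) - 1 = val x := by
  by_cases hx : x = 0
  · simp [val, hx]; rfl
  · have h2 : (2 : Q2bar) * x ≠ 0 := mul_ne_zero two_ne_zero hx
    simp only [val, hx, h2, if_false]
    rw [← EReal.coe_one, ← EReal.coe_sub, norm_mul, norm_two_Q2bar,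
      Real.logb_mul (by norm_num) (norm_ne_zero_iff.2 hx), one_div, Real.logb_inv,
      Real.logb_self_eq_one (by norm_num)]
    congr 1; ring

lemma norm_eq_of_val_eq_one {a : Q2bar} (ha : val a = 1) : ‖a‖ = 1 / 2 := by
  have h2 : val 2 = 1 := by
    simp only [val, two_ne_zero, if_false, norm_two_Q2bar]
    rw [one_div, Real.logb_inv, Real.logb_self_eq_one (by norm_num)]; simp
  have h : val a = val 2 := ha.trans h2.symm
  rw [← norm_two_Q2bar]
  exact le_antisymm (val_le_val_iff.1 h.ge) (val_le_val_iff.1 h.le)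

end ModTwo

end

/-- For even `r ≥ 6` and `v(a₂) = 1`, with `τ = v(α)` and `t = v(r - 2)`: if `τ ≤ t - 1`, then
`a₂/2 + (r-2)/(2α)` is integral and, `c₀` being its reduction, `F'_2` is a quotient of `I(V_1)/(T² - c₀T + 1)`;
if `τ > t - 1`, then `F'_2` is a quotient of `I(V_1)/(T)`. -/
theorem propositionF2 (r : ℕ) (hr : 6 ≤ r) (heven : Even r) (a₂ : Q2bar) (ha₂ : val a₂ = 1) :
    (val (alpha r a₂) ≤ val ((r : Q2bar) - 2) - 1 →
      ∃ c : Z2bar, (c : Q2bar) = a₂ / 2 + ((r : Q2bar) - 2) / (2 * alpha r a₂) ∧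
        IsNaturalQuotient r a₂
          (Polynomial.X ^ 2 - Polynomial.C (IsLocalRing.residue Z2bar c) * Polynomial.X + 1)) ∧
    (val ((r : Q2bar) - 2) - 1 < val (alpha r a₂) →
      IsNaturalQuotient r a₂ Polynomial.X) := by
  obtain ⟨M, rfl⟩ := heven
  obtain ⟨N, rfl⟩ := Nat.exists_eq_add_of_le' (show 1 ≤ M by omega)
  rw [show N + 1 + (N + 1) = 2 * N + 2 by ring]
  obtain ⟨u, rfl⟩ : ∃ u, a₂ = 2 * u := ⟨a₂ / 2, by field_simp⟩
  have hu : ‖u‖ = 1 := by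
    have := norm_eq_of_val_eq_one ha₂
    rw [norm_mul, norm_two_Q2bar] at this
    linarith
  have hu0 : u ≠ 0 := norm_ne_zero_iff.1 (by rw [hu]; exact one_ne_zero)
  have hs : ((2 * N + 2 : ℕ) : Q2bar) - 2 = 2 * N := by push_cast; ring
  have hchoose : ((2 * N + 2).choose 2 : Q2bar) = (1 + N) * (1 + 2 * N) := by
    have : (2 * N + 2).choose 2 = (1 + N) * (1 + 2 * N) := by
      rw [Nat.choose_two_right, show (2 * N + 2) * (2 * N + 2 - 1) = (1 + N) * (1 + 2 * N) * 2 by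
        rw [show 2 * N + 2 - 1 = 2 * N + 1 by omega]; ring, Nat.mul_div_cancel _ (by norm_num)]
    rw [this]; push_cast; ring
  have hα : u * alpha (2 * N + 2) (2 * u) = u ^ 2 - (1 + N) * (1 + 2 * N) := by
    rw [alpha, hchoose]; field_simp
  -- As r - 2 = 2N, t - 1 is v(N), and both cases become comparisons of |α| with |N|.
  rw [hs, val_sub_one, val_le_val_iff, lt_iff_not_ge, val_le_val_iff, not_le]
  refine ⟨fun h => ?_, isNaturalQuotient_X (by omega) rfl hu hα⟩
  -- If α = 0 then τ = ∞, which exceeds the finite v(N), so the first case does not arise.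
  have hα0 : alpha (2 * N + 2) (2 * u) ≠ 0 := by
    intro h0
    rw [h0, norm_zero, norm_le_zero_iff, Nat.cast_eq_zero] at h
    omega
  have hc : 2 * u / 2 + 2 * (N : Q2bar) / (2 * alpha (2 * N + 2) (2 * u)) =
      u + N / alpha (2 * N + 2) (2 * u) := by field_simp
  have hint : ‖u + N / alpha (2 * N + 2) (2 * u)‖ ≤ 1 := by
    refine (IsUltrametricDist.norm_add_le_max _ _).trans (max_le hu.le ?_)
    rw [norm_div]; exact div_le_one_of_le₀ h (norm_nonneg _)
  rw [hc]
  exact ⟨⟨_, mem_Z2bar hint⟩, rfl, isNaturalQuotient_quadratic (by omega) rfl hu hα hα0 h rfl⟩
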